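/- Let $(G,V,\|\cdot\|)$ be a sub-Finsler Lie group: $G$ is a finite-dimensional, second countable real Lie group with Lie algebra $\mathfrak g$, $V\subseteq\mathfrak g$ is a linear subspace that generates $\mathfrak g$ as a Lie algebra, and $\|\cdot\|$ is a norm on $V$. Let $I\subseteq\mathbb R$ be an interval. A curve $\gamma:I\to G$, absolutely continuous on compact subintervals of $I$, is horizontal with control $u:I\to V$ if $\dot\gamma(t)=\mathrm dL_{\gamma(t)}u(t)$ for a.e. $t\in I$. The Carnot–Carathéodory distance $d(g,h)\in[0,\infty]$ is the infimum of $\int_0^1\|u(t)\|\,\mathrm dt$ over all horizontal curves $\gamma:[0,1]\to G$ with control $u$ and $\gamma(0)=g$, $\gamma(1)=h$. A horizontal curve $\gamma:I\to G$ with control $u\in L^2_{\mathrm{loc}}(I,V)$ is a normal curve with associated covector $\lambda\in\mathfrak g^*$ if, for a.e. $t\in I$, the functional $\lambda\circ\mathrm{Ad}_{\gamma(t)}|_V$ belongs to the subdifferential at $u(t)$ of the energy $\mathrm E(v)=\tfrac12\|v\|^2$ on $V$, that is, $$\lambda(\mathrm{Ad}_{\gamma(t)}(v-u(t)))\le \mathrm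 E(v)-\mathrm E(u(t))\qquad\text{for all } v\in V.$$ A map $f$ between sub-Finsler Lie groups is a submetry if $f(\bar B(p,r))=\bar B(f(p),r)$ for all points $p$ and all $r>0$, where $\bar B$ denotes closed balls for the Carnot–Carathéodory distances. Let $H$ be a Lie group and let $\pi:G\to H$ be a surjective (smooth) Lie group homomorphism. Then there exists a unique sub-Finsler structure on $H$ (a bracket-generating subspace $W$ of the Lie algebra of $H$ together with a norm on $W$) that makes $\pi$ a submetry. It is given by $$W=\mathrm d\pi_1(V),\qquad \|w\|=\inf\{\|v\| : v\in V,\ \mathrm d\pi_1(v)=w\}\quad (w\in W).$$ Moreover, equip $H$ with this structure and let $\gamma:I\to H$ be a normal curve with control $u$ and associated covector $\lambda$. Then there exist horizontal curves $\tilde\gamma:I\to G$ with control $\tilde u$ such that $\pi\circ\tilde\gamma=\gamma$ on $I$ and $\|\tilde u(t)\|=\|u(t)\|$ for a.e. $t\in I$, and every such $\tilde\gamma$ is a normal curve in $G$ with associated covector $\lambda\circ\mathrm d\pi_1$. -/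

import Mathlib

open Set MeasureTheory
open scoped Manifold ContDiff

/-! ### Lie groups

A Lie group is a finite-dimensional real `C^∞` Lie group, modelled on a finite-dimensional real
normed space `E` (only the topology of `E` plays a role). Its Lie algebra is Mathlib's
`GroupLieAlgebra`, the tangent space at `1` with the bracket of left-invariant vector fields. -/

instance completeSpace_of_finiteDimensional_real {E : Type*} [NormedAddCommGroup E]
    [NormedSpace ℝ E] [FiniteDimensional ℝ E] : CompleteSpace E :=
  FiniteDimensional.complete ℝ E

instance leInfty_minSmoothness_real_three : ENat.LEInfty (minSmoothness ℝ 3) :=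
  ⟨by simpa using (ENat.LEInfty.out : (3 : ℕ∞ω) ≤ ∞)⟩

noncomputable section

/-- The adjoint map `Ad_g`, the differential at `1` of `h ↦ g * h * g⁻¹`. -/
def lieAd {E : Type*} [NormedAddCommGroup E] [NormedSpace ℝ E]
    {G : Type*} [TopologicalSpace G] [ChartedSpace E G] [Group G] (g : G) :
    GroupLieAlgebra 𝓘(ℝ, E) G →ₗ[ℝ] GroupLieAlgebra 𝓘(ℝ, E) G where
  toFun v := mfderiv 𝓘(ℝ, E) 𝓘(ℝ, E) (fun h : G => g * h * g⁻¹) 1 v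
  map_add' v w := (mfderiv 𝓘(ℝ, E) 𝓘(ℝ, E) (fun h : G => g * h * g⁻¹) 1).map_add v w
  map_smul' c v := (mfderiv 𝓘(ℝ, E) 𝓘(ℝ, E) (fun h : G => g * h * g⁻¹) 1).map_smul c v

/-- The differential at `1` of a Lie group homomorphism, as a map of Lie algebras. -/
def lieDifferential {E F : Type*} [NormedAddCommGroup E] [NormedSpace ℝ E]
    [NormedAddCommGroup F] [NormedSpace ℝ F]
    {G : Type*} [TopologicalSpace G] [ChartedSpace E G] [Group G]
    {H : Type*} [TopologicalSpace H] [ChartedSpace F H] [Group H]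
    (π : ContMDiffMonoidMorphism 𝓘(ℝ, E) 𝓘(ℝ, F) ∞ G H) :
    GroupLieAlgebra 𝓘(ℝ, E) G →ₗ[ℝ] GroupLieAlgebra 𝓘(ℝ, F) H where
  toFun v := mfderiv 𝓘(ℝ, E) 𝓘(ℝ, F) π 1 v
  map_add' v w := (mfderiv 𝓘(ℝ, E) 𝓘(ℝ, F) π 1).map_add v w
  map_smul' c v := (mfderiv 𝓘(ℝ, E) 𝓘(ℝ, F) π 1).map_smul c v

/-! ### Curves -/

/-- `γ` is absolutely continuous on the interval `I` (more precisely, on every compact subinterval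
of `I`): it is continuous on `I` and absolutely continuous in charts. Values of `γ` outside of `I`
are irrelevant. -/
def IsAbsContCurveOn (E : Type*) [NormedAddCommGroup E] [NormedSpace ℝ E]
    {M : Type*} [TopologicalSpace M] [ChartedSpace E M] (γ : ℝ → M) (I : Set ℝ) : Prop :=
  ContinuousOn γ I ∧
    ∀ (x : M) (a b : ℝ), a ≤ b → Icc a b ⊆ I → MapsTo γ (Icc a b) (chartAt E x).source →
      AbsolutelyContinuousOnInterval (fun t => chartAt E x (γ t)) a b

/-! ### Convex analysis -/

/-- The subdifferential at `u` of a real function on a (finite-dimensional) vector space. -/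
def subdifferential {V : Type*} [AddCommGroup V] [Module ℝ V] (f : V → ℝ) (u : V) :
    Set (Module.Dual ℝ V) :=
  {η | ∀ v, η (v - u) ≤ f v - f u}

/-! ### Sub-Finsler structures -/

/-- A sub-Finsler structure on a Lie group `G`: a bracket-generating linear subspace `V` of the Lie
algebra and a norm on `V`. -/
@[ext]
structure SubFinslerStructure (E : Type*) [NormedAddCommGroup E] [NormedSpace ℝ E]
    [FiniteDimensional ℝ E]
    (G : Type*) [TopologicalSpace G] [ChartedSpace E G] [Group G] [LieGroup 𝓘(ℝ, E) ∞ G] where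
  /-- The polarization `V`. -/
  polarization : Submodule ℝ (GroupLieAlgebra 𝓘(ℝ, E) G)
  bracketGenerating :
    LieSubalgebra.lieSpan ℝ (GroupLieAlgebra 𝓘(ℝ, E) G)
      (polarization : Set (GroupLieAlgebra 𝓘(ℝ, E) G)) = ⊤
  /-- The norm on `V`: a seminorm which vanishes only at `0`. -/
  norm : Seminorm ℝ polarization
  norm_definite : ∀ v, norm v = 0 → v = 0

namespace SubFinslerStructure

variable {E : Type*} [NormedAddCommGroup E] [NormedSpace ℝ E] [FiniteDimensional ℝ E]
  {G : Type*} [TopologicalSpace G] [ChartedSpace E G] [Group G] [LieGroup 𝓘(ℝ, E) ∞ G]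

/-- `γ` is horizontal on the interval `I` with control `u : I → V`, that is, it is absolutely
continuous and `γ'(t) = dL_{γ(t)} u(t)` for almost every `t ∈ I`. -/
def IsHorizontal (S : SubFinslerStructure E G) (I : Set ℝ) (γ : ℝ → G)
    (u : ℝ → S.polarization) : Prop :=
  IsAbsContCurveOn E γ I ∧
    ∀ᵐ t ∂(volume.restrict I), HasMFDerivWithinAt 𝓘(ℝ, ℝ) 𝓘(ℝ, E) γ I t
      ((1 : ℝ →L[ℝ] ℝ).smulRight
        (mulInvariantVectorField (I := 𝓘(ℝ, E)) (u t : GroupLieAlgebra 𝓘(ℝ, E) G) (γ t)))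

/-- The Carnot–Carathéodory distance, with values in `[0, ∞]`. -/
def ccDist (S : SubFinslerStructure E G) (g h : G) : ENNReal :=
  sInf {ℓ | ∃ (γ : ℝ → G) (u : ℝ → S.polarization), S.IsHorizontal (Icc 0 1) γ u ∧
    γ 0 = g ∧ γ 1 = h ∧ ℓ = ∫⁻ t in Icc (0 : ℝ) 1, ENNReal.ofReal (S.norm (u t))}

/-- The energy `v ↦ ‖v‖² / 2`. -/
def energy (S : SubFinslerStructure E G) (v : S.polarization) : ℝ :=
  S.norm v ^ 2 / 2

/-- `γ` is, on the interval `I`, a normal curve with control `u` and associated covector `lam`: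
it is horizontal with control `u`, the control is square integrable (on compact subintervals
of `I`), and `lam ∘ Ad_{γ(t)}`, restricted to `V`, is a subgradient at `u(t)` of the energy for
almost every `t ∈ I`. -/
def IsNormal (S : SubFinslerStructure E G) (I : Set ℝ) (γ : ℝ → G)
    (u : ℝ → S.polarization) (lam : Module.Dual ℝ (GroupLieAlgebra 𝓘(ℝ, E) G)) : Prop :=
  S.IsHorizontal I γ u ∧
    (∀ a b : ℝ, Icc a b ⊆ I → ∫⁻ t in Icc a b, ENNReal.ofReal (S.norm (u t) ^ 2) < ⊤) ∧
    ∀ᵐ t ∂(volume.restrict I),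
      (lam ∘ₗ lieAd (γ t)) ∘ₗ S.polarization.subtype ∈ subdifferential S.energy (u t)

variable {F : Type*} [NormedAddCommGroup F] [NormedSpace ℝ F] [FiniteDimensional ℝ F]
  {H : Type*} [TopologicalSpace H] [ChartedSpace F H] [Group H] [LieGroup 𝓘(ℝ, F) ∞ H]

/-- `f` is a submetry for the Carnot–Carathéodory distances: it maps the closed ball of radius `r`
at `p` onto the closed ball of radius `r` at `f p`. -/
def IsSubmetry (S : SubFinslerStructure E G) (T : SubFinslerStructure F H) (f : G → H) : Prop :=
  ∀ (p : G) (r : ℝ), 0 < r →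
    f '' {q | S.ccDist p q ≤ ENNReal.ofReal r} = {q | T.ccDist (f p) q ≤ ENNReal.ofReal r}

/-- `T` is the push-forward of `S`: its polarization is `W = dπ(V)` and its norm is the quotient
norm `‖w‖ = inf {‖v‖ : v ∈ V, dπ(v) = w}`. -/
def IsPushforward (S : SubFinslerStructure E G) (T : SubFinslerStructure F H)
    (π : ContMDiffMonoidMorphism 𝓘(ℝ, E) 𝓘(ℝ, F) ∞ G H) : Prop :=
  T.polarization = S.polarization.map (lieDifferential π) ∧
    ∀ w : T.polarization,
      IsGLB {r : ℝ | ∃ v : S.polarization, lieDifferential π v = w ∧ S.norm v = r} (T.norm w)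

/-- `γ'`, horizontal with control `u'`, is a length-preserving horizontal lift on `I` of the
horizontal curve `γ` with control `u`. -/
def IsLift (S : SubFinslerStructure E G) (T : SubFinslerStructure F H) (π : G → H) (I : Set ℝ)
    (γ : ℝ → H) (u : ℝ → T.polarization) (γ' : ℝ → G) (u' : ℝ → S.polarization) : Prop :=
  S.IsHorizontal I γ' u' ∧ (∀ t ∈ I, π (γ' t) = γ t) ∧
    ∀ᵐ t ∂(volume.restrict I), S.norm (u' t) = T.norm (u t)

end SubFinslerStructure

end

open Filter Topology

/-! ### Absolutely continuous functions -/

/-! The proof rests on a dictionary between the Carnot–Carathéodory distance and the norm on `V`.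
Call a seminorm `p` on the Lie algebra admissible if `p ≤ ‖·‖` on `V`. Near the identity the
left-invariant frame in a chart is close to the identity map, so `d(g,h) ≤ r` forces `p(h - g) ≤ (1
+ ε) r` in the chart (`exists_chart_estimate`). Conversely, a vector on which every admissible
seminorm is at most `r` lies in `V` and has norm at most `r` (`exists_incl_eq_of_seminorm_le`).
Hence a curve whose distance increments are dominated by an absolutely continuous function is
horizontal, with the derivative of that function bounding its speed
(`exists_isHorizontal_of_ccDist_le`), and closed balls are compact (`isCompact_ccDist_le`).

Existence. Take `W = dπ(V)` with the quotient norm. The differential is onto because a surjective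
homomorphism from a second countable Lie group is open (`modelDifferential_surjective`), and it
preserves brackets (`lieDifferential_lie`), so `W` generates. Projecting horizontal curves shows
that distances do not increase. For the other inclusion of balls no differential equation is solved:
a nearly optimal curve in `H` is cut into short steps, each increment is lifted to first order
(`exists_lift_approx`), the errors add up to something arbitrarily small, and the remaining gap
closes because the image of a compact ball is closed (`exists_lift_of_ccDist_lt`).

Uniqueness. A submetry determines the closed balls at the identity of `H`. Balls determine the norm,
since the vectors of `W` of norm at most `r` are exactly the initial velocities of curves with `d(1,
c t) ≤ t r` for small `t > 0` (`eq_of_ccDist_le_iff`).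

Normal curves. Points are lifted along finite sets of times without increasing arclength increments,
and an ultrafilter limit over finite sets yields a lifted curve (`exists_lift_of_ccDist_increment`),
which the dictionary shows to be horizontal. Normality of any length-preserving lift is then the
chain `λ(dπ Ad(v - ũ)) = λ(Ad(dπ v - u)) ≤ E(dπ v) - E(u) ≤ E(v) - E(ũ)` (`IsNormal.of_isLift`). -/

theorem Seminorm.exists_linearMap_eq_le {E : Type*} [AddCommGroup E] [Module ℝ E]
    (p : Seminorm ℝ E) (x : E) : ∃ ℓ : E →ₗ[ℝ] ℝ, ℓ x = p x ∧ ∀ y, ℓ y ≤ p y := by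
  -- Hahn–Banach extends `c • x ↦ c * p x` from the line through `x`; this compatibility is what
  -- makes the functional well defined when `x = 0`.
  have hz : ∀ c : ℝ, c • x = 0 → c • p x = 0 := fun c hc => by
    rcases smul_eq_zero.1 hc with h | h <;> simp [h]
  obtain ⟨ℓ, h1, h2⟩ := exists_extension_of_le_sublinear
    (LinearPMap.mkSpanSingleton' x (p x) hz) p
    (fun c hc x => by rw [map_smul_eq_mul, Real.norm_of_nonneg hc.le])
    (fun x y => map_add_le_add p x y)
    (fun ⟨x, hx⟩ => by
      obtain ⟨c, rfl⟩ := Submodule.mem_span_singleton.1 hx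
      rw [LinearPMap.mkSpanSingleton'_apply, map_smul_eq_mul, smul_eq_mul]
      exact mul_le_mul_of_nonneg_right (le_abs_self c) (apply_nonneg p _))
  refine ⟨ℓ, ?_, h2⟩
  rw [h1 ⟨x, Submodule.mem_span_singleton_self _⟩]
  exact LinearPMap.mkSpanSingleton'_apply_self _ _ _ _

namespace AbsolutelyContinuousOnInterval

theorem of_dist_le {X Y : Type*} [PseudoMetricSpace X] [PseudoMetricSpace Y] {f : ℝ → X}
    {g : ℝ → Y} {a b C : ℝ} (hg : AbsolutelyContinuousOnInterval g a b)
    (h : ∀ s ∈ uIcc a b, ∀ t ∈ uIcc a b, dist (f s) (f t) ≤ C * dist (g s) (g t)) :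
    AbsolutelyContinuousOnInterval f a b := by
  rw [absolutelyContinuousOnInterval_iff] at hg ⊢
  intro ε hε
  obtain ⟨δ, hδ, H⟩ := hg (ε / (|C| + 1)) (by positivity)
  refine ⟨δ, hδ, fun E hE hE' => ?_⟩
  have h1 := H E hE hE'
  calc ∑ i ∈ Finset.range E.1, dist (f (E.2 i).1) (f (E.2 i).2)
      ≤ ∑ i ∈ Finset.range E.1, (|C| + 1) * dist (g (E.2 i).1) (g (E.2 i).2) := by
        refine Finset.sum_le_sum fun i hi => (h _ (hE.1 i hi).1 _ (hE.1 i hi).2).trans ?_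
        gcongr
        linarith [le_abs_self C]
    _ = (|C| + 1) * ∑ i ∈ Finset.range E.1, dist (g (E.2 i).1) (g (E.2 i).2) := by
        rw [Finset.mul_sum]
    _ < (|C| + 1) * (ε / (|C| + 1)) := by gcongr
    _ = ε := by field_simp

/-- Monotonicity keeps disjoint intervals disjoint, and the Lipschitz bound keeps their total length
small. Constant stretches of `σ` are allowed, as needed for the truncations `min · b` and `max · b`.
-/
theorem comp_monotone {X : Type*} [PseudoMetricSpace X] {f : ℝ → X} {σ : ℝ → ℝ} {a b c d C : ℝ}
    (hf : AbsolutelyContinuousOnInterval f c d) (hσ : Monotone σ)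
    (hC : ∀ s t, dist (σ s) (σ t) ≤ C * dist s t) (hmap : MapsTo σ (uIcc a b) (uIcc c d)) :
    AbsolutelyContinuousOnInterval (f ∘ σ) a b := by
  rw [absolutelyContinuousOnInterval_iff] at hf ⊢
  intro ε hε
  obtain ⟨δ, hδ, H⟩ := hf ε hε
  refine ⟨δ / (|C| + 1), by positivity, fun E hE hE' => ?_⟩
  refine H (E.1, fun i => (σ (E.2 i).1, σ (E.2 i).2)) ⟨fun i hi => ?_, fun i hi j hj hij => ?_⟩ ?_
  · exact ⟨hmap (hE.1 i hi).1, hmap (hE.1 i hi).2⟩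
  · have hd := hE.2 hi hj hij
    simp only [Function.onFun, uIoc, Set.disjoint_left, mem_Ioc, ← hσ.map_min, ← hσ.map_max]
      at hd ⊢
    rintro x ⟨h1, h2⟩ ⟨h3, h4⟩
    have e1 : min (E.2 i).1 (E.2 i).2 < max (E.2 j).1 (E.2 j).2 :=
      hσ.reflect_lt (h1.trans_le h4)
    have e2 : min (E.2 j).1 (E.2 j).2 < max (E.2 i).1 (E.2 i).2 :=
      hσ.reflect_lt (h3.trans_le h2)
    have e3 : min (E.2 i).1 (E.2 i).2 < max (E.2 i).1 (E.2 i).2 :=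
      hσ.reflect_lt (h1.trans_le h2)
    have e4 : min (E.2 j).1 (E.2 j).2 < max (E.2 j).1 (E.2 j).2 :=
      hσ.reflect_lt (h3.trans_le h4)
    -- If the images overlap, the original half-open intervals overlap too, and the smaller of their
    -- right endpoints is a common point.
    exact @hd (min (max (E.2 i).1 (E.2 i).2) (max (E.2 j).1 (E.2 j).2))
      ⟨lt_min e3 e1, min_le_left _ _⟩ ⟨lt_min e2 e4, min_le_right _ _⟩
  · calc ∑ i ∈ Finset.range E.1, dist (σ (E.2 i).1) (σ (E.2 i).2)
        ≤ ∑ i ∈ Finset.range E.1, (|C| + 1) * dist (E.2 i).1 (E.2 i).2 := by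
          refine Finset.sum_le_sum fun i hi => (hC _ _).trans ?_
          gcongr
          linarith [le_abs_self C]
      _ = (|C| + 1) * ∑ i ∈ Finset.range E.1, dist (E.2 i).1 (E.2 i).2 := by
          rw [Finset.mul_sum]
      _ < (|C| + 1) * (δ / (|C| + 1)) := by gcongr
      _ = δ := by field_simp

/-- Each increment of `f` is at most the sum of the increments of `f (min · b)` and `f (max · b)`,
by the triangle inequality through `f b`. This avoids splitting families of intervals at `b`. -/
theorem union {X : Type*} [PseudoMetricSpace X] {f : ℝ → X} {a b c : ℝ} (hab : a ≤ b)
    (hbc : b ≤ c) (h1 : AbsolutelyContinuousOnInterval f a b)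
    (h2 : AbsolutelyContinuousOnInterval f b c) : AbsolutelyContinuousOnInterval f a c := by
  have k1 : AbsolutelyContinuousOnInterval (f ∘ fun x => min x b) a c := by
    refine h1.comp_monotone (C := 1) (fun x y h => min_le_min_right _ h) (fun s t => ?_) ?_
    · simpa [Real.dist_eq] using abs_min_sub_min_le_max s b t b
    · intro x hx
      rw [uIcc_of_le (hab.trans hbc)] at hx
      rw [uIcc_of_le hab]
      exact ⟨le_min hx.1 hab, min_le_right _ _⟩
  have k2 : AbsolutelyContinuousOnInterval (f ∘ fun x => max x b) a c := by
    refine h2.comp_monotone (C := 1) (fun x y h => max_le_max_right _ h) (fun s t => ?_) ?_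
    · simpa [Real.dist_eq] using abs_max_sub_max_le_max s b t b
    · intro x hx
      rw [uIcc_of_le (hab.trans hbc)] at hx
      rw [uIcc_of_le hbc]
      exact ⟨le_max_right _ _, max_le hx.2 hbc⟩
  rw [AbsolutelyContinuousOnInterval] at k1 k2 ⊢
  have := k1.add k2
  rw [add_zero] at this
  refine squeeze_zero (fun E => Finset.sum_nonneg fun _ _ => dist_nonneg) (fun E => ?_) this
  rw [← Finset.sum_add_distrib]
  refine Finset.sum_le_sum fun i _ => ?_
  generalize (E.2 i).1 = s
  generalize (E.2 i).2 = t
  simp only [Function.comp]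
  rcases le_total s b with hs | hs <;> rcases le_total t b with ht | ht <;>
    simp only [min_eq_left, min_eq_right, max_eq_left, max_eq_right, hs, ht, dist_self, add_zero,
      zero_add, le_refl]
  · exact dist_triangle _ _ _
  · rw [add_comm]
    exact dist_triangle _ _ _

theorem of_forall_nhds {X : Type*} [PseudoMetricSpace X] {f : ℝ → X} {a b : ℝ} (hab : a ≤ b)
    (h : ∀ t ∈ Icc a b, ∃ U ∈ 𝓝 t, ∀ c d, c ≤ d → Icc c d ⊆ Icc a b ∩ U →
      AbsolutelyContinuousOnInterval f c d) : AbsolutelyContinuousOnInterval f a b := by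
  choose! U hU H using h
  obtain ⟨t, t0, tm, ⟨m, hm⟩, ht⟩ := exists_monotone_Icc_subset_open_cover_Icc hab
    (c := fun s : Icc a b => Subtype.val ⁻¹' interior (U s))
    (fun s => isOpen_interior.preimage continuous_subtype_val)
    (fun s _ => mem_iUnion.2 ⟨s, mem_interior_iff_mem_nhds.2 (hU s s.2)⟩)
  have key : ∀ n, AbsolutelyContinuousOnInterval f a (t n) := by
    intro n
    induction n with
    | zero =>
      rw [t0]
      have : LipschitzOnWith 0 f (uIcc a a) := by
        simp [LipschitzOnWith]
      exact this.absolutelyContinuousOnInterval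
    | succ n ih =>
      refine ih.union (t n).2.1 (tm n.le_succ) ?_
      obtain ⟨s, hs⟩ := ht n
      refine H s s.2 _ _ (tm n.le_succ) fun x hx => ?_
      have hx' : x ∈ Icc a b := ⟨(t n).2.1.trans hx.1, hx.2.trans (t (n+1)).2.2⟩
      exact ⟨hx', interior_subset (@hs ⟨x, hx'⟩ ⟨hx.1, hx.2⟩)⟩
  have := key m
  rwa [hm m le_rfl] at this

variable {E : Type*} [NormedAddCommGroup E] [NormedSpace ℝ E]

theorem clm_comp {F : Type*} [NormedAddCommGroup F] [NormedSpace ℝ F] {f : ℝ → E} {a b : ℝ}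
    (hf : AbsolutelyContinuousOnInterval f a b) (L : E →L[ℝ] F) :
    AbsolutelyContinuousOnInterval (fun t => L (f t)) a b := by
  refine hf.of_dist_le (C := ‖L‖) fun s _ t _ => ?_
  rw [dist_eq_norm, dist_eq_norm, ← map_sub]
  exact L.le_opNorm _

theorem ae_differentiableAt' [FiniteDimensional ℝ E] {f : ℝ → E} {a b : ℝ}
    (hf : AbsolutelyContinuousOnInterval f a b) :
    ∀ᵐ x, x ∈ uIcc a b → DifferentiableAt ℝ f x :=
  hf.boundedVariationOn.ae_differentiableAt_of_mem_uIcc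

/-- A linear functional supporting `p` at `f b - f a` reduces this to the scalar fundamental theorem
of calculus. No integrability of `f'` itself has to be assumed. -/
theorem seminorm_sub_le [FiniteDimensional ℝ E] {f f' : ℝ → E} {a b : ℝ} (hab : a ≤ b)
    (hf : AbsolutelyContinuousOnInterval f a b) (p : Seminorm ℝ E) {k : ℝ → ℝ}
    (hk : IntervalIntegrable k volume a b)
    (hd : ∀ᵐ t ∂(volume.restrict (Icc a b)), HasDerivAt f (f' t) t ∧ p (f' t) ≤ k t) :
    p (f b - f a) ≤ ∫ t in a..b, k t := by
  obtain ⟨ℓ, h1, h2⟩ := p.exists_linearMap_eq_le (f b - f a)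
  have hac := hf.clm_comp ℓ.toContinuousLinearMap
  have hI := hac.integral_deriv_eq_sub
  rw [← h1, map_sub]
  simp only [LinearMap.coe_toContinuousLinearMap'] at hI
  rw [← hI]
  refine intervalIntegral.integral_mono_ae_restrict hab hac.intervalIntegrable_deriv hk ?_
  filter_upwards [hd] with t ht
  have : HasDerivAt (fun t => ℓ.toContinuousLinearMap (f t)) (ℓ (f' t)) t :=
    ℓ.toContinuousLinearMap.hasFDerivAt.comp_hasDerivAt t ht.1
  simp only [LinearMap.coe_toContinuousLinearMap'] at this ⊢
  rw [this.deriv]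
  exact (h2 _).trans ht.2

end AbsolutelyContinuousOnInterval

/-! ### Seminorms on finite-dimensional spaces -/

section FiniteDimensionalSeminorm

variable {E : Type*} [NormedAddCommGroup E] [NormedSpace ℝ E] [FiniteDimensional ℝ E]

theorem Seminorm.continuous_of_finiteDimensional_real (p : Seminorm ℝ E) : Continuous p := by
  have := p.convexOn.continuousOn isOpen_univ
  rwa [continuousOn_univ] at this

theorem Seminorm.exists_le_mul_norm (p : Seminorm ℝ E) : ∃ C, 0 < C ∧ ∀ x, p x ≤ C * ‖x‖ := 
  Seminorm.bound_of_continuous_normedSpace p p.continuous_of_finiteDimensional_real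

variable (V : Submodule ℝ E) (N : Seminorm ℝ V)

omit [FiniteDimensional ℝ E] in
/-- A norm on a subspace extends to the whole space by penalizing a complement. -/
theorem Submodule.exists_seminorm_extension :
    ∃ P : E →ₗ[ℝ] V, (∀ v : V, P v = v) ∧ ∀ k : ℝ, 0 ≤ k → ∃ p : Seminorm ℝ E,
      ∀ x, p x = N (P x) + k * ‖x - (P x : E)‖ := by
  obtain ⟨P, hP⟩ := LinearMap.exists_leftInverse_of_injective V.subtype (by simp)
  refine ⟨P, fun v => congrArg (fun f => f v) hP, fun k hk => ?_⟩
  refine ⟨N.comp P + (normSeminorm ℝ E).comp (k • (LinearMap.id - V.subtype ∘ₗ P)), fun x => ?_⟩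
  simp [norm_smul, abs_of_nonneg hk]

theorem Submodule.exists_norm_le_mul (hN : ∀ v, N v = 0 → v = 0) :
    ∃ C, 0 < C ∧ ∀ v : V, ‖(v : E)‖ ≤ C * N v := by
  obtain ⟨P, hP, H⟩ := V.exists_seminorm_extension N
  have hc : Continuous N := N.continuous_of_finiteDimensional_real
  rcases (Metric.sphere (0 : V) 1).eq_empty_or_nonempty with h | h
  · refine ⟨1, one_pos, fun v => ?_⟩
    by_cases hv : v = 0
    · simp [hv]
    · have : ‖v‖⁻¹ • v ∈ Metric.sphere (0 : V) 1 := by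
        simpa [norm_smul] using inv_mul_cancel₀ (norm_ne_zero_iff.2 hv)
      simp [h] at this
  · obtain ⟨w, hw, hmin⟩ := (isCompact_sphere (0 : V) 1).exists_isMinOn h hc.continuousOn
    have hw0 : 0 < N w := (apply_nonneg N w).lt_of_ne fun e => by
      have := hN w e.symm
      simp [this] at hw
    refine ⟨(N w)⁻¹, by positivity, fun v => ?_⟩
    by_cases hv : v = 0
    · simp [hv]
    · have hv' : 0 < ‖v‖ := norm_pos_iff.2 hv
      have : ‖v‖⁻¹ • v ∈ Metric.sphere (0 : V) 1 := by
        simpa [norm_smul] using inv_mul_cancel₀ hv'.ne'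
      have h2 := hmin this
      simp only [mem_ofPred_eq, map_smul_eq_mul, norm_inv, norm_norm] at h2
      rw [inv_mul_eq_div, le_div_iff₀ hv'] at h2
      rw [inv_mul_eq_div, le_div_iff₀ hw0, mul_comm]
      exact h2

end FiniteDimensionalSeminorm

/-! ### The chart at the identity of a Lie group -/

section LocalLieGroup

variable {E : Type*} [NormedAddCommGroup E] [NormedSpace ℝ E]
  {G : Type*} [TopologicalSpace G] [ChartedSpace E G] [Group G] [LieGroup 𝓘(ℝ, E) ∞ G]

variable (E) in
theorem LieGroup.isTopologicalGroup_real (G : Type*) [TopologicalSpace G] [ChartedSpace E G]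
    [Group G] [LieGroup 𝓘(ℝ, E) ∞ G] : IsTopologicalGroup G :=
  topologicalGroup_of_lieGroup 𝓘(ℝ, E) ∞

variable (E) in
theorem LieGroup.t2Space_real (G : Type*) [TopologicalSpace G] [ChartedSpace E G]
    [Group G] [LieGroup 𝓘(ℝ, E) ∞ G] : T2Space G := by
  have := LieGroup.isTopologicalGroup_real E G
  have : T1Space G := ChartedSpace.t1Space E G
  infer_instance

omit [NormedSpace ℝ E] [LieGroup 𝓘(ℝ, E) ∞ G] in
theorem chartAt_one_source_mem_nhds : (chartAt E (1 : G)).source ∈ 𝓝 (1 : G) :=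
  (chartAt E (1 : G)).open_source.mem_nhds (mem_chart_source E 1)

omit [NormedSpace ℝ E] [LieGroup 𝓘(ℝ, E) ∞ G] in
theorem chartAt_one_target_mem_nhds : (chartAt E (1 : G)).target ∈ 𝓝 (chartAt E (1 : G) 1) :=
  (chartAt E (1 : G)).open_target.mem_nhds (mem_chart_target E 1)

theorem contMDiffAt_chartAt (x : G) {g : G} (hg : g ∈ (chartAt E x).source) :
    ContMDiffAt 𝓘(ℝ, E) 𝓘(ℝ, E) ∞ (chartAt E x) g :=
  have : IsManifold 𝓘(ℝ, E) ∞ G := inferInstance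
  contMDiffOn_chart.contMDiffAt ((chartAt E x).open_source.mem_nhds hg)

theorem contMDiffAt_chartAt_symm (x : G) {y : E} (hy : y ∈ (chartAt E x).target) :
    ContMDiffAt 𝓘(ℝ, E) 𝓘(ℝ, E) ∞ (chartAt E x).symm y :=
  have : IsManifold 𝓘(ℝ, E) ∞ G := inferInstance
  contMDiffOn_chart_symm.contMDiffAt ((chartAt E x).open_target.mem_nhds hy)

/-- The tangent space at `x` is the model space seen through the preferred chart at `x`, so there
the chart has derivative the identity. The separate variable `g` permits base points that equal `x`
only propositionally, such as `(γ t)⁻¹ * γ t`. -/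
theorem hasMFDerivAt_chartAt_of_eq {x g : G} (hg : g = x) :
    HasMFDerivAt 𝓘(ℝ, E) 𝓘(ℝ, E) (chartAt E x) g (ContinuousLinearMap.id ℝ E) := by
  subst hg
  refine ⟨(contMDiffAt_chartAt g (mem_chart_source E g)).continuousAt, ?_⟩
  change HasFDerivWithinAt (writtenInExtChartAt 𝓘(ℝ, E) 𝓘(ℝ, E) g (chartAt E g) : E → E)
    (ContinuousLinearMap.id ℝ E) (range 𝓘(ℝ, E)) (extChartAt 𝓘(ℝ, E) g g)
  refine ((hasFDerivAt_id (𝕜 := ℝ) (extChartAt 𝓘(ℝ, E) g g)).congr_of_eventuallyEq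
    ?_).hasFDerivWithinAt
  filter_upwards [(chartAt E g).open_target.mem_nhds (mem_chart_target E g)] with y hy
  simp [writtenInExtChartAt, hy]
  rfl

theorem hasMFDerivAt_chartAt_symm_of_eq {x : G} {y : E} (hy : y = chartAt E x x) :
    HasMFDerivAt 𝓘(ℝ, E) 𝓘(ℝ, E) (chartAt E x).symm y (ContinuousLinearMap.id ℝ E) := by
  subst hy
  refine ⟨(contMDiffAt_chartAt_symm x (mem_chart_target E x)).continuousAt, ?_⟩
  have hx : (chartAt E x).symm (chartAt E x x) = x := (chartAt E x).left_inv (mem_chart_source E x)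
  change HasFDerivWithinAt
    (writtenInExtChartAt 𝓘(ℝ, E) 𝓘(ℝ, E) (chartAt E x x) (chartAt E x).symm : E → E)
    (ContinuousLinearMap.id ℝ E) (range 𝓘(ℝ, E)) (chartAt E x x)
  refine ((hasFDerivAt_id (𝕜 := ℝ) (chartAt E x x)).congr_of_eventuallyEq
    ?_).hasFDerivWithinAt
  filter_upwards [(chartAt E x).open_target.mem_nhds (mem_chart_target E x)] with y hy
  simp [writtenInExtChartAt, hx]
  exact (chartAt E x).right_inv hy

theorem mdifferentiable_mul_left_real (g : G) :
    MDifferentiable 𝓘(ℝ, E) 𝓘(ℝ, E) (fun h : G => g * h) :=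
  (contMDiff_mul_left (I := 𝓘(ℝ, E)) (n := ∞)).mdifferentiable (by simp)

theorem mfderiv_mul_left_inv_apply (g : G) (v : GroupLieAlgebra 𝓘(ℝ, E) G) :
    mfderiv 𝓘(ℝ, E) 𝓘(ℝ, E) (fun h : G => g⁻¹ * h) g
      (mulInvariantVectorField (I := 𝓘(ℝ, E)) v g) = (v : E) := by
  have h1 := (mdifferentiable_mul_left_real (E := E) g (1 : G)).hasMFDerivAt
  have h2 : HasMFDerivAt 𝓘(ℝ, E) 𝓘(ℝ, E) (fun h : G => g⁻¹ * h) (g * 1)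
      (mfderiv 𝓘(ℝ, E) 𝓘(ℝ, E) (fun h : G => g⁻¹ * h) (g * 1)) :=
    (mdifferentiable_mul_left_real (E := E) g⁻¹ _).hasMFDerivAt
  have h3 := h2.comp (1 : G) h1
  have h4 : (fun h : G => g⁻¹ * h) ∘ (fun h : G => g * h) = id := by ext; simp
  rw [h4] at h3
  have h5 := hasMFDerivAt_unique h3 (hasMFDerivAt_id (1 : G))
  have h6 := congrArg (fun L => L v) h5
  rw [mul_one] at h6
  exact h6

theorem hasMFDerivAt_mul_left_of_eq_one (g : G) {h : G} (hh : h = 1) :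
    HasMFDerivAt 𝓘(ℝ, E) 𝓘(ℝ, E) (fun h : G => g * h) h
      (mfderiv 𝓘(ℝ, E) 𝓘(ℝ, E) (fun h : G => g * h) 1 : E →L[ℝ] E) := by
  subst hh
  exact (mdifferentiable_mul_left_real (E := E) g (1 : G)).hasMFDerivAt

/-- A curve has the left-invariant velocity `v` at time `t` if and only if its left translate
through the identity has velocity `v` in the chart at the identity. -/
theorem hasMFDerivWithinAt_mulInvariant_iff {γ : ℝ → G} {I : Set ℝ} {t : ℝ}
    {v : GroupLieAlgebra 𝓘(ℝ, E) G} :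
    HasMFDerivWithinAt 𝓘(ℝ, ℝ) 𝓘(ℝ, E) γ I t
      ((1 : ℝ →L[ℝ] ℝ).smulRight (mulInvariantVectorField (I := 𝓘(ℝ, E)) v (γ t))) ↔
    ContinuousWithinAt γ I t ∧
      HasDerivWithinAt (fun s => chartAt E (1 : G) ((γ t)⁻¹ * γ s)) (v : E) I t := by
  have := LieGroup.isTopologicalGroup_real E G
  constructor
  · intro h
    refine ⟨h.continuousWithinAt, ?_⟩
    have h1 := (mdifferentiable_mul_left_real (E := E) (γ t)⁻¹ (γ t)).hasMFDerivAt
    have h2 := hasMFDerivAt_chartAt_of_eq (E := E) (inv_mul_cancel (γ t))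
    have h3 := (h2.comp (γ t) h1).comp_hasMFDerivWithinAt t h
    rw [hasMFDerivWithinAt_iff_hasFDerivWithinAt] at h3
    refine (hasDerivWithinAt_iff_hasFDerivWithinAt.2 (h3.congr_fderiv ?_))
    refine ContinuousLinearMap.ext fun (c : ℝ) => ?_
    refine ((mfderiv 𝓘(ℝ, E) 𝓘(ℝ, E) (fun h : G => (γ t)⁻¹ * h) (γ t)).map_smul c
      (mulInvariantVectorField (I := 𝓘(ℝ, E)) v (γ t))).trans ?_
    exact congrArg (fun w : E => c • w) (mfderiv_mul_left_inv_apply (E := E) (γ t) v)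
  · rintro ⟨hc, h⟩
    have h0 : (γ t)⁻¹ * γ t = 1 := inv_mul_cancel _
    have h1 := h.hasFDerivWithinAt.hasMFDerivWithinAt
    have h2 := hasMFDerivAt_chartAt_symm_of_eq (x := (1 : G))
      (y := chartAt E (1 : G) ((γ t)⁻¹ * γ t)) (by rw [h0])
    have h3 := h2.comp_hasMFDerivWithinAt t h1
    have h4 := hasMFDerivAt_mul_left_of_eq_one (E := E) (γ t)
      (h := (chartAt E (1 : G)).symm (chartAt E (1 : G) ((γ t)⁻¹ * γ t)))
      (by rw [h0]; exact (chartAt E (1 : G)).left_inv (mem_chart_source E 1))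
    have h5 := h4.comp_hasMFDerivWithinAt t h3
    have hev : ∀ᶠ s in 𝓝[I] t, (γ t)⁻¹ * γ s ∈ (chartAt E (1 : G)).source := by
      have : ContinuousWithinAt (fun s => (γ t)⁻¹ * γ s) I t := continuousWithinAt_const.mul hc
      refine this (?_ : _ ∈ 𝓝 ((γ t)⁻¹ * γ t))
      rw [h0]
      exact chartAt_one_source_mem_nhds
    have h6 := h5.congr_of_eventuallyEq (f₁ := γ) (by
      filter_upwards [hev] with s hs
      simp [(chartAt E (1 : G)).left_inv hs]) (by
      simp [(chartAt E (1 : G)).left_inv (mem_chart_source E (1 : G))])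
    refine h6.congr_mfderiv ?_
    refine ContinuousLinearMap.ext fun (c : ℝ) => ?_
    exact (mfderiv 𝓘(ℝ, E) 𝓘(ℝ, E) (fun h : G => γ t * h) 1).map_smul c v

end LocalLieGroup

section LocalSmooth

variable {E : Type*} [NormedAddCommGroup E] [NormedSpace ℝ E]
  {G : Type*} [TopologicalSpace G] [ChartedSpace E G] [Group G] [LieGroup 𝓘(ℝ, E) ∞ G]
  {F : Type*} [NormedAddCommGroup F] [NormedSpace ℝ F]
  {H : Type*} [TopologicalSpace H] [ChartedSpace F H] [Group H] [LieGroup 𝓘(ℝ, F) ∞ H]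

theorem contDiffAt_chartAt_comp {E' : Type*} [NormedAddCommGroup E'] [NormedSpace ℝ E']
    {f : E' → G} {y : E'} (x : G) (hf : ContMDiffAt 𝓘(ℝ, E') 𝓘(ℝ, E) ∞ f y)
    (hy : f y ∈ (chartAt E x).source) : ContDiffAt ℝ ∞ (fun z => chartAt E x (f z)) y :=
  contMDiffAt_iff_contDiffAt.1 ((contMDiffAt_chartAt x hy).comp y hf)

theorem exists_nhds_lipschitz_chartAt {f : G → H} {g : G} (x : G) (x' : H)
    (hf : ContMDiffAt 𝓘(ℝ, E) 𝓘(ℝ, F) ∞ f g) (hg : g ∈ (chartAt E x).source)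
    (hg' : f g ∈ (chartAt F x').source) :
    ∃ U ∈ 𝓝 g, ∃ C : ℝ, ∀ h ∈ U, ∀ h' ∈ U,
      dist (chartAt F x' (f h)) (chartAt F x' (f h')) ≤ C * dist (chartAt E x h) (chartAt E x h') := by
  have hs := (chartAt E x).left_inv hg
  have h1 : ContDiffAt ℝ ∞ (fun y => chartAt F x' (f ((chartAt E x).symm y))) (chartAt E x g) := by
    refine contDiffAt_chartAt_comp x' ?_ (by simpa [hs] using hg')
    refine ContMDiffAt.comp (chartAt E x g) ?_ (contMDiffAt_chartAt_symm x ((chartAt E x).map_source hg))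
    rwa [hs]
  obtain ⟨K, t, ht, hK⟩ := (h1.of_le (m := 1) (by exact_mod_cast le_top)).exists_lipschitzOnWith
  refine ⟨(chartAt E x).source ∩ (chartAt E x) ⁻¹' t,
    inter_mem ((chartAt E x).open_source.mem_nhds hg)
      ((contMDiffAt_chartAt x hg).continuousAt.preimage_mem_nhds ht), K, ?_⟩
  rintro h ⟨h1, h2⟩ h' ⟨h1', h2'⟩
  have := hK.dist_le_mul _ h2 _ h2'
  rwa [(chartAt E x).left_inv h1, (chartAt E x).left_inv h1'] at this

/-- Joint smoothness makes the Lipschitz constant in the second variable uniform in the first one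
near `a`; this uniformity feeds the later compactness arguments. -/
theorem exists_nhds_lipschitz_chartAt_one_prod {f : G × G → G} {a : G}
    (hf : ContMDiff (𝓘(ℝ, E).prod 𝓘(ℝ, E)) 𝓘(ℝ, E) ∞ f) (ha : f (a, 1) = 1) :
    ∃ U ∈ 𝓝 a, ∃ V ∈ 𝓝 (1 : G), ∃ C : ℝ, 0 < C ∧ ∀ b ∈ U, ∀ h ∈ V, ∀ h' ∈ V,
      dist (chartAt E (1 : G) (f (b, h))) (chartAt E (1 : G) (f (b, h'))) ≤
        C * dist (chartAt E (1 : G) h) (chartAt E (1 : G) h') := by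
  have hs := (chartAt E a).left_inv (mem_chart_source E a)
  have hs1 := (chartAt E (1 : G)).left_inv (mem_chart_source E (1 : G))
  have h1 : ContDiffAt ℝ ∞ (fun z : E × E => chartAt E (1 : G)
      (f ((chartAt E a).symm z.1, (chartAt E (1 : G)).symm z.2)))
      (chartAt E a a, chartAt E (1 : G) 1) := by
    refine contDiffAt_chartAt_comp 1 ?_ (by simp [hs, hs1, ha])
    refine ContMDiffAt.comp (I' := 𝓘(ℝ, E).prod 𝓘(ℝ, E)) (chartAt E a a, chartAt E (1 : G) 1)
      hf.contMDiffAt (ContMDiffAt.prodMk ?_ ?_)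
    · exact ContMDiffAt.comp (I' := 𝓘(ℝ, E)) (chartAt E a a, chartAt E (1 : G) 1)
        (contMDiffAt_chartAt_symm a (mem_chart_target E a)) contDiff_fst.contMDiff.contMDiffAt
    · exact ContMDiffAt.comp (I' := 𝓘(ℝ, E)) (chartAt E a a, chartAt E (1 : G) 1)
        (contMDiffAt_chartAt_symm 1 (mem_chart_target E 1)) contDiff_snd.contMDiff.contMDiffAt
  obtain ⟨K, t, ht, hK⟩ := (h1.of_le (m := 1) (by exact_mod_cast le_top)).exists_lipschitzOnWith
  obtain ⟨u, hu, v, hv, huv⟩ := mem_nhds_prod_iff.1 ht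
  refine ⟨(chartAt E a).source ∩ (chartAt E a) ⁻¹' u,
    inter_mem ((chartAt E a).open_source.mem_nhds (mem_chart_source E a))
      ((contMDiffAt_chartAt a (mem_chart_source E a)).continuousAt.preimage_mem_nhds hu),
    (chartAt E (1 : G)).source ∩ (chartAt E (1 : G)) ⁻¹' v,
    inter_mem chartAt_one_source_mem_nhds
      ((contMDiffAt_chartAt 1 (mem_chart_source E 1)).continuousAt.preimage_mem_nhds hv),
    K + 1, by positivity, ?_⟩
  rintro b ⟨b1, b2⟩ h ⟨h1, h2⟩ h' ⟨h1', h2'⟩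
  have := hK.dist_le_mul (chartAt E a b, chartAt E 1 h) (huv ⟨b2, h2⟩)
    (chartAt E a b, chartAt E 1 h') (huv ⟨b2, h2'⟩)
  simp only [(chartAt E (1 : G)).left_inv h1, (chartAt E (1 : G)).left_inv h1',
    (chartAt E a).left_inv b1, Prod.dist_eq, dist_self] at this
  rw [max_eq_right dist_nonneg] at this
  refine this.trans ?_
  gcongr
  linarith

/-! ### The left-invariant frame in the chart at the identity -/

variable (E G) in
/-- The left-invariant frame in the chart at the identity. -/
noncomputable def leftFrame (x : E) : E →L[ℝ] E :=
  fderiv ℝ (fun y => chartAt E (1 : G) ((chartAt E (1 : G)).symm x * (chartAt E (1 : G)).symm y))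
    (chartAt E (1 : G) 1)

theorem contDiffAt_chartAt_mul {x y : E} (hx : x ∈ (chartAt E (1 : G)).target)
    (hy : y ∈ (chartAt E (1 : G)).target)
    (hxy : (chartAt E (1 : G)).symm x * (chartAt E (1 : G)).symm y ∈ (chartAt E (1 : G)).source) :
    ContDiffAt ℝ ∞ (fun z : E × E => chartAt E (1 : G)
      ((chartAt E (1 : G)).symm z.1 * (chartAt E (1 : G)).symm z.2)) (x, y) := by
  refine contDiffAt_chartAt_comp 1 ?_ hxy
  refine ContMDiffAt.mul ?_ ?_
  · exact ContMDiffAt.comp (I' := 𝓘(ℝ, E)) (x, y) (contMDiffAt_chartAt_symm 1 hx)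
      contDiff_fst.contMDiff.contMDiffAt
  · exact ContMDiffAt.comp (I' := 𝓘(ℝ, E)) (x, y) (contMDiffAt_chartAt_symm 1 hy)
      contDiff_snd.contMDiff.contMDiffAt

omit [LieGroup 𝓘(ℝ, E) ∞ G] in
theorem leftFrame_one : leftFrame E G (chartAt E (1 : G) 1) = ContinuousLinearMap.id ℝ E := by
  have hs1 := (chartAt E (1 : G)).left_inv (mem_chart_source E (1 : G))
  rw [leftFrame, hs1]
  refine HasFDerivAt.fderiv ((hasFDerivAt_id (𝕜 := ℝ) _).congr_of_eventuallyEq ?_)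
  filter_upwards [chartAt_one_target_mem_nhds (E := E) (G := G)] with y hy
  simp [hy]

theorem continuousAt_leftFrame : ContinuousAt (leftFrame E G) (chartAt E (1 : G) 1) := by
  have := LieGroup.isTopologicalGroup_real E G
  have hs1 := (chartAt E (1 : G)).left_inv (mem_chart_source E (1 : G))
  have h1 := contDiffAt_chartAt_mul (mem_chart_target E (1 : G)) (mem_chart_target E (1 : G))
    (by rw [hs1, mul_one]; exact mem_chart_source E 1)
  have h2 : ContinuousAt (fderiv ℝ (fun z : E × E => chartAt E (1 : G)
      ((chartAt E (1 : G)).symm z.1 * (chartAt E (1 : G)).symm z.2)))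
      (chartAt E (1 : G) 1, chartAt E (1 : G) 1) :=
    (h1.fderiv_right (m := 0) (by exact_mod_cast le_top)).continuousAt
  have h3 : ContinuousAt (fun x : E => (x, chartAt E (1 : G) 1)) (chartAt E (1 : G) 1) := by
    fun_prop
  have h4 : ContinuousAt (fun x => (fderiv ℝ (fun z : E × E => chartAt E (1 : G)
      ((chartAt E (1 : G)).symm z.1 * (chartAt E (1 : G)).symm z.2))
      (x, chartAt E (1 : G) 1)).comp (ContinuousLinearMap.inr ℝ E E)) (chartAt E (1 : G) 1) :=
    (ContinuousAt.comp (f := fun x : E => (x, chartAt E (1 : G) 1)) h2 h3).clm_comp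
      continuousAt_const
  refine h4.congr ?_
  filter_upwards [chartAt_one_target_mem_nhds (E := E) (G := G)] with x hx
  have h5 := contDiffAt_chartAt_mul (G := G) hx (mem_chart_target E (1 : G))
    (by rw [hs1, mul_one]; exact (chartAt E (1 : G)).map_target hx)
  have h6 := (h5.differentiableAt (by simp)).hasFDerivAt
  exact (h6.comp (chartAt E (1 : G) 1) (hasFDerivAt_prodMk_right x (chartAt E (1 : G) 1))).fderiv.symm

/-- The chain rule for a function along a curve with prescribed left-invariant velocity. -/
theorem HasDerivWithinAt.comp_leftInvariant {E' : Type*} [NormedAddCommGroup E'] [NormedSpace ℝ E']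
    {γ : ℝ → G} {I : Set ℝ} {t : ℝ} {v : E} {f : G → E'} (hc : ContinuousWithinAt γ I t)
    (h : HasDerivWithinAt (fun s => chartAt E (1 : G) ((γ t)⁻¹ * γ s)) v I t)
    (hf : ContMDiffAt 𝓘(ℝ, E) 𝓘(ℝ, E') ∞ f (γ t)) :
    HasDerivWithinAt (fun s => f (γ s)) (fderiv ℝ (fun y => f (γ t * (chartAt E (1 : G)).symm y))
      (chartAt E (1 : G) 1) v) I t := by
  have := LieGroup.isTopologicalGroup_real E G
  have h0 : (γ t)⁻¹ * γ t = 1 := inv_mul_cancel _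
  have hs1 := (chartAt E (1 : G)).left_inv (mem_chart_source E (1 : G))
  have h1 : ContDiffAt ℝ ∞ (fun y => f (γ t * (chartAt E (1 : G)).symm y))
      (chartAt E (1 : G) 1) := by
    refine contMDiffAt_iff_contDiffAt.1 (ContMDiffAt.comp (I' := 𝓘(ℝ, E)) _ (g := f) ?_ ?_)
    · rwa [hs1, mul_one]
    · exact contMDiffAt_const.mul (contMDiffAt_chartAt_symm 1 (mem_chart_target E 1))
  have h2 := (h1.differentiableAt (by simp)).hasFDerivAt
  have hev : ∀ᶠ s in 𝓝[I] t, (γ t)⁻¹ * γ s ∈ (chartAt E (1 : G)).source := by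
    have : ContinuousWithinAt (fun s => (γ t)⁻¹ * γ s) I t := continuousWithinAt_const.mul hc
    refine this (?_ : _ ∈ 𝓝 ((γ t)⁻¹ * γ t))
    rw [h0]
    exact chartAt_one_source_mem_nhds
  have h3 := HasFDerivAt.comp_hasDerivWithinAt_of_eq t h2 h (by rw [h0])
  refine h3.congr_of_eventuallyEq ?_ ?_
  · filter_upwards [hev] with s hs
    simp [(chartAt E (1 : G)).left_inv hs]
  · simp [hs1]

theorem HasDerivWithinAt.chartAt_one_comp {γ : ℝ → G} {I : Set ℝ} {t : ℝ} {v : E}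
    (hc : ContinuousWithinAt γ I t)
    (h : HasDerivWithinAt (fun s => chartAt E (1 : G) ((γ t)⁻¹ * γ s)) v I t)
    (ht : γ t ∈ (chartAt E (1 : G)).source) :
    HasDerivWithinAt (fun s => chartAt E (1 : G) (γ s))
      (leftFrame E G (chartAt E (1 : G) (γ t)) v) I t := by
  have := h.comp_leftInvariant hc (contMDiffAt_chartAt 1 ht)
  rwa [leftFrame, (chartAt E (1 : G)).left_inv ht]

/-- Almost everywhere differentiability comes from absolute continuity in the translate by one fixed
`g`, while horizontality refers to the translate by `γ t`, which moves with `t`. A smooth change of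
chart passes between them. -/
theorem DifferentiableWithinAt.chartAt_one_translate {γ : ℝ → G} {I : Set ℝ} {t : ℝ} {g : G}
    (hc : ContinuousWithinAt γ I t)
    (h : DifferentiableWithinAt ℝ (fun s => chartAt E (1 : G) (g⁻¹ * γ s)) I t)
    (ht : g⁻¹ * γ t ∈ (chartAt E (1 : G)).source) :
    DifferentiableWithinAt ℝ (fun s => chartAt E (1 : G) ((γ t)⁻¹ * γ s)) I t := by
  have := LieGroup.isTopologicalGroup_real E G
  have hs := (chartAt E (1 : G)).left_inv ht
  have h1 : ContDiffAt ℝ ∞ (fun y => chartAt E (1 : G)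
      ((γ t)⁻¹ * (g * (chartAt E (1 : G)).symm y))) (chartAt E (1 : G) (g⁻¹ * γ t)) := by
    refine contDiffAt_chartAt_comp 1 ?_ (by simp [hs])
    exact contMDiffAt_const.mul (contMDiffAt_const.mul
      (contMDiffAt_chartAt_symm 1 ((chartAt E (1 : G)).map_source ht)))
  have hev : ∀ᶠ s in 𝓝[I] t, g⁻¹ * γ s ∈ (chartAt E (1 : G)).source :=
    (continuousWithinAt_const.mul hc) ((chartAt E (1 : G)).open_source.mem_nhds ht)
  have h2 := (h1.differentiableAt (by simp)).comp_differentiableWithinAt (f := fun s =>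
    chartAt E (1 : G) (g⁻¹ * γ s)) t h
  refine h2.congr_of_eventuallyEq ?_ ?_
  · filter_upwards [hev] with s hs
    simp [(chartAt E (1 : G)).left_inv hs]
  · simp [hs]

/-! ### Absolutely continuous curves in Lie groups -/

omit [Group G] [LieGroup 𝓘(ℝ, E) ∞ G] in
theorem IsAbsContCurveOn.mono {γ : ℝ → G} {I J : Set ℝ} (h : IsAbsContCurveOn E γ I) (hJ : J ⊆ I) :
    IsAbsContCurveOn E γ J :=
  ⟨h.1.mono hJ, fun x a b hab hs => h.2 x a b hab (hs.trans hJ)⟩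

theorem IsAbsContCurveOn.contMDiff_comp {γ : ℝ → G} {I : Set ℝ} (h : IsAbsContCurveOn E γ I)
    {f : G → H} (hf : ContMDiff 𝓘(ℝ, E) 𝓘(ℝ, F) ∞ f) : IsAbsContCurveOn F (f ∘ γ) I := by
  refine ⟨hf.continuous.comp_continuousOn h.1, fun x a b hab hI hx => ?_⟩
  refine AbsolutelyContinuousOnInterval.of_forall_nhds hab fun t ht => ?_
  obtain ⟨U, hU, C, hC⟩ := exists_nhds_lipschitz_chartAt (γ t) x hf.contMDiffAt
    (mem_chart_source E (γ t)) (hx ht)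
  have hc : ContinuousWithinAt γ (Icc a b) t := (h.1.mono hI) t ht
  obtain ⟨O, hO, hO'⟩ := mem_nhdsWithin_iff_exists_mem_nhds_inter.1
    (hc (inter_mem hU ((chartAt E (γ t)).open_source.mem_nhds (mem_chart_source E (γ t)))))
  refine ⟨O, hO, fun c d hcd hs => ?_⟩
  have hs' : ∀ s ∈ Icc c d, γ s ∈ U ∩ (chartAt E (γ t)).source := fun s hs1 =>
    hO' ⟨(hs hs1).2, (hs hs1).1⟩
  refine (h.2 (γ t) c d hcd (fun s h1 => hI (hs h1).1) fun s h1 => (hs' s h1).2).of_dist_le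
    (C := C) ?_
  rw [uIcc_of_le hcd]
  exact fun s h1 s' h2 => hC _ (hs' s h1).1 _ (hs' s' h2).1

/-- Left translation by `γ t` is smooth, hence locally Lipschitz from the chart at the identity to
any other chart, and absolute continuity is a local property. -/
theorem isAbsContCurveOn_of_translates {γ : ℝ → G} {I : Set ℝ} (hγ : ContinuousOn γ I)
    (h : ∀ t ∈ I, ∃ U ∈ 𝓝 t, ∀ c d, c ≤ d → Icc c d ⊆ I ∩ U →
      AbsolutelyContinuousOnInterval (fun s => chartAt E (1 : G) ((γ t)⁻¹ * γ s)) c d) :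
    IsAbsContCurveOn E γ I := by
  have := LieGroup.isTopologicalGroup_real E G
  refine ⟨hγ, fun x a b hab hI hx => ?_⟩
  refine AbsolutelyContinuousOnInterval.of_forall_nhds hab fun t ht => ?_
  obtain ⟨W, hW, H⟩ := h t (hI ht)
  obtain ⟨U, hU, C, hC⟩ := exists_nhds_lipschitz_chartAt (E := E) (F := E) (g := (γ t)⁻¹ * γ t)
    (f := fun h => γ t * h) (1 : G) x
    contMDiffAt_mul_left (by rw [inv_mul_cancel]; exact mem_chart_source E 1)
    (by simpa using hx ht)
  have hc : ContinuousWithinAt (fun s => (γ t)⁻¹ * γ s) (Icc a b) t :=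
    continuousWithinAt_const.mul ((hγ.mono hI) t ht)
  obtain ⟨O, hO, hO'⟩ := mem_nhdsWithin_iff_exists_mem_nhds_inter.1 (hc hU)
  refine ⟨O ∩ W, inter_mem hO hW, fun c d hcd hs => ?_⟩
  have hs' : ∀ s ∈ Icc c d, (γ t)⁻¹ * γ s ∈ U := fun s hs1 => hO' ⟨(hs hs1).2.1, (hs hs1).1⟩
  refine (H c d hcd fun s h1 => ⟨hI (hs h1).1, (hs h1).2.2⟩).of_dist_le (C := C) ?_
  rw [uIcc_of_le hcd]
  intro s h1 s' h2
  simpa using hC _ (hs' s h1) _ (hs' s' h2)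

end LocalSmooth

/-! ### Affine changes of time and interior points of intervals. -/

theorem quasiMeasurePreserving_affine_real {m k : ℝ} (hm : m ≠ 0) :
    Measure.QuasiMeasurePreserving (fun t : ℝ => m * t + k) volume volume :=
  ((measurePreserving_add_right volume k).quasiMeasurePreserving.comp
    (Measure.quasiMeasurePreserving_smul volume hm) :)

theorem hasDerivAt_affine_real {m k : ℝ} (t : ℝ) : HasDerivAt (fun t : ℝ => m * t + k) m t := by
  simpa only [mul_one, id] using ((hasDerivAt_id t).const_mul m).add_const k

theorem image_affine_Icc_real {m k a b : ℝ} (hm : 0 < m) :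
    (fun t : ℝ => m * t + k) '' Icc a b = Icc (m * a + k) (m * b + k) := by
  rw [show (fun t : ℝ => m * t + k) = (fun t => t + k) ∘ fun t => m * t from rfl, image_comp,
    image_mul_left_Icc' hm, image_add_const_Icc]

/-- Almost every point of an interval is an interior point. -/
theorem Set.OrdConnected.ae_mem_interior {I : Set ℝ} (hI : I.OrdConnected) :
    ∀ᵐ t ∂(volume.restrict I), t ∈ interior I := by
  have h : volume (frontier I) = 0 := hI.convex.addHaar_frontier volume
  have h2 : ∀ᵐ t ∂(volume.restrict I), t ∉ frontier I :=
    ae_restrict_of_ae (measure_eq_zero_iff_ae_notMem.1 h)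
  filter_upwards [h2, ae_restrict_mem hI.measurableSet] with t h1 h2
  by_contra h3
  exact h1 ⟨subset_closure h2, h3⟩

/-! ### Horizontal curves: translation, reparametrization, concatenation. -/

namespace SubFinslerStructure

variable {E : Type*} [NormedAddCommGroup E] [NormedSpace ℝ E] [FiniteDimensional ℝ E]
  {G : Type*} [TopologicalSpace G] [ChartedSpace E G] [Group G] [LieGroup 𝓘(ℝ, E) ∞ G]
  (S : SubFinslerStructure E G)

/-- The inclusion of the polarization in the model space. -/
def incl : S.polarization →ₗ[ℝ] E where
  toFun v := (v : GroupLieAlgebra 𝓘(ℝ, E) G)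
  map_add' _ _ := rfl
  map_smul' _ _ := rfl

theorem incl_injective : Function.Injective S.incl := fun _ _ h => Subtype.ext h

theorem isHorizontal_iff {I : Set ℝ} {γ : ℝ → G} {u : ℝ → S.polarization} :
    S.IsHorizontal I γ u ↔ IsAbsContCurveOn E γ I ∧ ∀ᵐ t ∂(volume.restrict I),
      ContinuousWithinAt γ I t ∧
      HasDerivWithinAt (fun s => chartAt E (1 : G) ((γ t)⁻¹ * γ s))
        (S.incl (u t)) I t := by
  simp only [IsHorizontal, hasMFDerivWithinAt_mulInvariant_iff]
  rfl

variable {S}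

theorem IsHorizontal.mono {I J : Set ℝ} {γ : ℝ → G} {u : ℝ → S.polarization}
    (h : S.IsHorizontal I γ u) (hJ : J ⊆ I) : S.IsHorizontal J γ u :=
  ⟨h.1.mono hJ, (ae_restrict_of_ae_restrict_of_subset hJ h.2).mono fun _ ht => ht.mono hJ⟩

theorem IsHorizontal.mul_left {I : Set ℝ} {γ : ℝ → G} {u : ℝ → S.polarization}
    (h : S.IsHorizontal I γ u) (g : G) : S.IsHorizontal I (fun t => g * γ t) u := by
  have := LieGroup.isTopologicalGroup_real E G
  rw [isHorizontal_iff] at h ⊢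
  refine ⟨h.1.contMDiff_comp (f := fun h => g * h) contMDiff_mul_left, ?_⟩
  filter_upwards [h.2] with t ht
  refine ⟨continuousWithinAt_const.mul ht.1, ?_⟩
  simpa [mul_assoc] using ht.2

theorem isHorizontal_const (S : SubFinslerStructure E G) (I : Set ℝ) (g : G) :
    S.IsHorizontal I (fun _ => g) 0 := by
  rw [isHorizontal_iff]
  refine ⟨⟨continuousOn_const, fun x a b hab _ _ => ?_⟩, ae_of_all _ fun t =>
    ⟨continuousWithinAt_const, ?_⟩⟩
  · exact (LipschitzWith.const _).lipschitzOnWith.absolutelyContinuousOnInterval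
  · exact hasDerivWithinAt_const t I (chartAt E (1 : G) (g⁻¹ * g))

theorem IsHorizontal.comp_affine {a b m k : ℝ} {γ : ℝ → G} {u : ℝ → S.polarization} (hm : 0 < m)
    (h : S.IsHorizontal (Icc (m * a + k) (m * b + k)) γ u) :
    S.IsHorizontal (Icc a b) (fun t => γ (m * t + k)) (fun t => m • u (m * t + k)) := by
  rw [isHorizontal_iff] at h ⊢
  set σ : ℝ → ℝ := fun t => m * t + k with hσ
  have hmap : MapsTo σ (Icc a b) (Icc (m * a + k) (m * b + k)) := by
    rw [← image_affine_Icc_real hm]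
    exact mapsTo_image _ _
  have hcont : Continuous σ := by fun_prop
  refine ⟨⟨h.1.1.comp hcont.continuousOn hmap, fun x c d hcd hI hx => ?_⟩, ?_⟩
  · have h1 : σ c ≤ σ d := by simp only [hσ]; gcongr
    have h2 : σ '' Icc c d = Icc (σ c) (σ d) := image_affine_Icc_real hm
    refine (h.1.2 x (σ c) (σ d) h1 ?_ ?_).comp_monotone (σ := σ) (C := m) ?_ ?_ ?_
    · rw [← h2]
      exact (hmap.mono_left hI).image_subset
    · rw [← h2]
      rintro _ ⟨t, ht, rfl⟩
      exact hx ht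
    · intro s t hst
      simp only [hσ]
      gcongr
    · intro s t
      simp only [hσ, Real.dist_eq]
      rw [add_sub_add_right_eq_sub, ← mul_sub, abs_mul, abs_of_pos hm]
    · rw [uIcc_of_le hcd, uIcc_of_le h1, ← h2]
      exact mapsTo_image _ _
  · have h3 := (ae_restrict_iff' measurableSet_Icc).1 h.2
    have h4 := (quasiMeasurePreserving_affine_real (k := k) hm.ne').ae h3
    rw [ae_restrict_iff' measurableSet_Icc]
    filter_upwards [h4] with t ht hI
    obtain ⟨h5, h6⟩ := ht (hmap hI)
    refine ⟨ContinuousWithinAt.comp (f := σ) (x := t) h5 hcont.continuousWithinAt hmap, ?_⟩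
    have h7 : HasDerivAt σ m t := hasDerivAt_affine_real t
    have h8 := HasDerivWithinAt.scomp (h := σ) t h6 h7.hasDerivWithinAt hmap
    exact h8

theorem lintegral_comp_affine (S : SubFinslerStructure E G) {a b m k : ℝ} (hm : 0 < m)
    (u : ℝ → S.polarization) :
    ∫⁻ t in Icc a b, ENNReal.ofReal (S.norm (m • u (m * t + k))) =
      ∫⁻ t in Icc (m * a + k) (m * b + k), ENNReal.ofReal (S.norm (u t)) := by
  rw [← image_affine_Icc_real hm, lintegral_image_eq_lintegral_abs_deriv_mul
    (f := fun t : ℝ => m * t + k) (f' := fun _ => m) measurableSet_Icc]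
  · refine lintegral_congr fun t => ?_
    rw [map_smul_eq_mul, ENNReal.ofReal_mul (norm_nonneg m)]
    rfl
  · intro t _
    exact (hasDerivAt_affine_real t).hasDerivWithinAt
  · intro s _ t _ hst
    simpa [hm.ne'] using hst

theorem IsHorizontal.glue {a b c : ℝ} {γ₁ γ₂ : ℝ → G} {u₁ u₂ : ℝ → S.polarization} (hab : a ≤ b)
    (hbc : b ≤ c) (h₁ : S.IsHorizontal (Icc a b) γ₁ u₁) (h₂ : S.IsHorizontal (Icc b c) γ₂ u₂)
    (h : γ₁ b = γ₂ b) :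
    S.IsHorizontal (Icc a c) (fun t => if t ≤ b then γ₁ t else γ₂ t)
      (fun t => if t ≤ b then u₁ t else u₂ t) := by
  rw [isHorizontal_iff] at h₁ h₂ ⊢
  have e1 : EqOn (fun t => if t ≤ b then γ₁ t else γ₂ t) γ₁ (Iic b) := fun t ht => if_pos ht
  have e2 : EqOn (fun t => if t ≤ b then γ₁ t else γ₂ t) γ₂ (Ici b) := fun t ht => by
    rcases eq_or_lt_of_le (mem_Ici.1 ht) with rfl | h3
    · simp [h]
    · exact if_neg h3.not_ge
  have hu : Icc a c = Icc a b ∪ Icc b c := (Icc_union_Icc_eq_Icc hab hbc).symm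
  refine ⟨⟨?_, ?_⟩, ?_⟩
  · rw [hu]
    exact (h₁.1.1.congr (e1.mono Icc_subset_Iic_self)).union_of_isClosed
      (h₂.1.1.congr (e2.mono Icc_subset_Ici_self)) isClosed_Icc isClosed_Icc
  · intro x s t hst hI hx
    have hs : s ∈ Icc a c := hI ⟨le_rfl, hst⟩
    have ht : t ∈ Icc a c := hI ⟨hst, le_rfl⟩
    have A : ∀ s' t', s' ≤ t' → Icc s' t' ⊆ Icc s t → t' ≤ b → AbsolutelyContinuousOnInterval
        (fun r => chartAt E x (if r ≤ b then γ₁ r else γ₂ r)) s' t' := by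
      intro s' t' hst' hsub hb
      have hE : EqOn (fun t => if t ≤ b then γ₁ t else γ₂ t) γ₁ (Icc s' t') := fun r hr =>
        e1 (hr.2.trans hb)
      refine (h₁.1.2 x s' t' hst' (fun r hr => ⟨(hI (hsub hr)).1, hr.2.trans hb⟩) fun r hr => by
        rw [← hE hr]; exact hx (hsub hr)).of_dist_le (C := 1) ?_
      rw [uIcc_of_le hst']
      intro r hr r' hr'
      have e1 := hE hr
      have e2 := hE hr'
      simp only at e1 e2
      rw [e1, e2, one_mul]
    have B : ∀ s' t', s' ≤ t' → Icc s' t' ⊆ Icc s t → b ≤ s' → AbsolutelyContinuousOnInterval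
        (fun r => chartAt E x (if r ≤ b then γ₁ r else γ₂ r)) s' t' := by
      intro s' t' hst' hsub hb
      have hE : EqOn (fun t => if t ≤ b then γ₁ t else γ₂ t) γ₂ (Icc s' t') := fun r hr =>
        e2 (hb.trans hr.1)
      refine (h₂.1.2 x s' t' hst' (fun r hr => ⟨hb.trans hr.1, (hI (hsub hr)).2⟩) fun r hr => by
        rw [← hE hr]; exact hx (hsub hr)).of_dist_le (C := 1) ?_
      rw [uIcc_of_le hst']
      intro r hr r' hr'
      have e1 := hE hr
      have e2 := hE hr'
      simp only at e1 e2
      rw [e1, e2, one_mul]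
    rcases le_total t b with htb | htb
    · exact A s t hst subset_rfl htb
    rcases le_total b s with hbs | hbs
    · exact B s t hst subset_rfl hbs
    · exact (A s b hbs (Icc_subset_Icc_right htb) le_rfl).union hbs htb
        (B b t htb (Icc_subset_Icc_left hbs) le_rfl)
  -- The junction time is a null set; at any other time the glued curve agrees with one of the two
  -- pieces in a neighbourhood.
  · have n1 : ∀ᵐ t : ℝ, t ≠ b := by simp [ae_iff, measure_singleton]
    rw [ae_restrict_iff' measurableSet_Icc]
    filter_upwards [(ae_restrict_iff' measurableSet_Icc).1 h₁.2,
      (ae_restrict_iff' measurableSet_Icc).1 h₂.2, n1] with t k1 k2 hne ht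
    rcases lt_or_gt_of_ne hne with hlt | hgt
    · obtain ⟨k3, k4⟩ := k1 ⟨ht.1, hlt.le⟩
      have hn : Icc a b ∈ 𝓝[Icc a c] t := mem_nhdsWithin.2
        ⟨Iio b, isOpen_Iio, hlt, fun s hs => ⟨hs.2.1, (mem_Iio.1 hs.1).le⟩⟩
      have hev : ∀ᶠ s in 𝓝 t, s ≤ b := (gt_mem_nhds hlt).mono fun s => le_of_lt
      refine ⟨?_, ?_⟩
      · refine (k3.mono_of_mem_nhdsWithin hn).congr_of_eventuallyEq ?_ (e1 hlt.le)
        filter_upwards [nhdsWithin_le_nhds hev] with s hs using e1 hs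
      · simp only [if_pos hlt.le]
        refine (k4.mono_of_mem_nhdsWithin hn).congr_of_eventuallyEq ?_ (by simp [hlt.le])
        filter_upwards [nhdsWithin_le_nhds hev] with s hs
        simp [hs]
    · obtain ⟨k3, k4⟩ := k2 ⟨hgt.le, ht.2⟩
      have hn : Icc b c ∈ 𝓝[Icc a c] t := mem_nhdsWithin.2
        ⟨Ioi b, isOpen_Ioi, hgt, fun s hs => ⟨(mem_Ioi.1 hs.1).le, hs.2.2⟩⟩
      have hev : ∀ᶠ s in 𝓝 t, ¬ s ≤ b := (lt_mem_nhds hgt).mono fun s hs => not_le.2 hs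
      refine ⟨?_, ?_⟩
      · refine (k3.mono_of_mem_nhdsWithin hn).congr_of_eventuallyEq ?_ (e2 hgt.le)
        filter_upwards [nhdsWithin_le_nhds hev] with s hs using e2 (not_le.1 hs).le
      · simp only [if_neg hgt.not_ge]
        refine (k4.mono_of_mem_nhdsWithin hn).congr_of_eventuallyEq ?_ (by simp [hgt.not_ge])
        filter_upwards [nhdsWithin_le_nhds hev] with s hs
        simp [hs]

/-! ### The Carnot–Carathéodory distance -/

variable (S)

theorem ccDist_self (g : G) : S.ccDist g g = 0 := by
  refine le_antisymm (sInf_le ⟨fun _ => g, 0, S.isHorizontal_const _ g, rfl, rfl, ?_⟩) bot_le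
  simp

variable {S} in
theorem IsHorizontal.ccDist_le {a b : ℝ} {γ : ℝ → G} {u : ℝ → S.polarization} (hab : a ≤ b)
    (h : S.IsHorizontal (Icc a b) γ u) :
    S.ccDist (γ a) (γ b) ≤ ∫⁻ t in Icc a b, ENNReal.ofReal (S.norm (u t)) := by
  rcases hab.eq_or_lt with rfl | hlt
  · simp [ccDist_self]
  · have hm : 0 < b - a := sub_pos.2 hlt
    have e0 : (b - a) * 0 + a = a := by ring
    have e1 : (b - a) * 1 + a = b := by ring
    refine sInf_le ⟨fun t => γ ((b - a) * t + a), fun t => (b - a) • u ((b - a) * t + a),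
      IsHorizontal.comp_affine hm (by rwa [e0, e1]), by simp, by simp, ?_⟩
    rw [lintegral_comp_affine S hm, e0, e1]

theorem exists_isHorizontal_of_ccDist_lt {g h : G} {r : ENNReal} (hr : S.ccDist g h < r) :
    ∃ (γ : ℝ → G) (u : ℝ → S.polarization), S.IsHorizontal (Icc 0 1) γ u ∧ γ 0 = g ∧ γ 1 = h ∧
      ∫⁻ t in Icc (0 : ℝ) 1, ENNReal.ofReal (S.norm (u t)) < r := by
  obtain ⟨_, ⟨γ, u, h1, h2, h3, rfl⟩, h5⟩ := sInf_lt_iff.1 hr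
  exact ⟨γ, u, h1, h2, h3, h5⟩

theorem ccDist_mul_left (k g h : G) : S.ccDist (k * g) (k * h) = S.ccDist g h := by
  have key : ∀ k g h : G, S.ccDist (k * g) (k * h) ≤ S.ccDist g h := by
    intro k g h
    refine le_sInf ?_
    rintro _ ⟨γ, u, h1, rfl, rfl, rfl⟩
    exact sInf_le ⟨fun t => k * γ t, u, h1.mul_left k, rfl, rfl, rfl⟩
  refine le_antisymm (key k g h) ?_
  simpa using key k⁻¹ (k * g) (k * h)

theorem ccDist_eq_one_left (g h : G) : S.ccDist g h = S.ccDist 1 (g⁻¹ * h) := by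
  rw [← S.ccDist_mul_left g⁻¹ g h, inv_mul_cancel]

theorem ccDist_triangle (g h k : G) : S.ccDist g k ≤ S.ccDist g h + S.ccDist h k := by
  refine ENNReal.le_of_forall_pos_le_add fun ε hε hfin => ?_
  have hε' : (0 : ENNReal) < ε / 2 := by
    simpa using hε.ne'
  obtain ⟨f1, f2⟩ := ENNReal.add_lt_top.1 hfin
  obtain ⟨γ₁, u₁, h1, h1a, h1b, h1l⟩ :=
    S.exists_isHorizontal_of_ccDist_lt (ENNReal.lt_add_right f1.ne hε'.ne')
  obtain ⟨γ₂, u₂, h2, h2a, h2b, h2l⟩ :=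
    S.exists_isHorizontal_of_ccDist_lt (ENNReal.lt_add_right f2.ne hε'.ne')
  have h3 : S.IsHorizontal (Icc 1 2) (fun t => γ₂ (1 * t + -1)) (fun t => (1 : ℝ) • u₂ (1 * t + -1)) :=
    IsHorizontal.comp_affine one_pos (by convert h2 using 2 <;> norm_num)
  have h4 := h1.glue zero_le_one one_le_two h3 (by simp [h1b, h2a])
  have h5 := h4.ccDist_le (by norm_num)
  have e1 : (1 : ℝ) * 1 + -1 = 0 := by norm_num
  have e2 : (1 : ℝ) * 2 + -1 = 1 := by norm_num
  simp only [zero_le_one, if_true, h1a, show ¬ ((2 : ℝ) ≤ 1) by norm_num, if_false, e2, h2b] at h5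
  refine h5.trans ?_
  calc ∫⁻ t in Icc (0 : ℝ) 2, ENNReal.ofReal (S.norm
        (if t ≤ 1 then u₁ t else (1 : ℝ) • u₂ (1 * t + -1)))
      ≤ ∫⁻ t in Icc (0 : ℝ) 1 ∪ Ioc 1 2, ENNReal.ofReal (S.norm
        (if t ≤ 1 then u₁ t else (1 : ℝ) • u₂ (1 * t + -1))) := by
        refine lintegral_mono_set fun t ht => ?_
        rcases le_or_gt t 1 with h | h
        · exact Or.inl ⟨ht.1, h⟩
        · exact Or.inr ⟨h, ht.2⟩
    _ ≤ (∫⁻ t in Icc (0 : ℝ) 1, ENNReal.ofReal (S.norm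
        (if t ≤ 1 then u₁ t else (1 : ℝ) • u₂ (1 * t + -1)))) +
        ∫⁻ t in Ioc (1 : ℝ) 2, ENNReal.ofReal (S.norm
        (if t ≤ 1 then u₁ t else (1 : ℝ) • u₂ (1 * t + -1))) := lintegral_union_le _ _ _
    _ ≤ (∫⁻ t in Icc (0 : ℝ) 1, ENNReal.ofReal (S.norm (u₁ t))) +
        ∫⁻ t in Icc (1 : ℝ) 2, ENNReal.ofReal (S.norm ((1 : ℝ) • u₂ (1 * t + -1))) := by
        refine add_le_add (le_of_eq ?_) ?_
        · refine setLIntegral_congr_fun measurableSet_Icc fun t ht => ?_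
          simp [ht.2]
        · refine le_trans (le_of_eq ?_) (lintegral_mono_set Ioc_subset_Icc_self)
          refine setLIntegral_congr_fun measurableSet_Ioc fun t ht => ?_
          simp [ht.1.not_ge]
    _ ≤ (S.ccDist g h + ε / 2) + (S.ccDist h k + ε / 2) := by
        rw [lintegral_comp_affine S one_pos, e1, e2]
        exact add_le_add h1l.le h2l.le
    _ = S.ccDist g h + S.ccDist h k + ε := by
        rw [add_add_add_comm, ENNReal.add_halves]

end SubFinslerStructure

/-! ### Length and distance in the chart at the identity. -/

namespace SubFinslerStructure

variable {E : Type*} [NormedAddCommGroup E] [NormedSpace ℝ E] [FiniteDimensional ℝ E]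
  {G : Type*} [TopologicalSpace G] [ChartedSpace E G] [Group G] [LieGroup 𝓘(ℝ, E) ∞ G]
  (S : SubFinslerStructure E G)

theorem exists_seminorm_extension : ∃ P : E → S.polarization,
    (∀ v : S.polarization, P (S.incl v) = v) ∧
    ∀ k : ℝ, 0 ≤ k → ∃ p : Seminorm ℝ E,
      ∀ x, p x = S.norm (P x) + k * ‖x - (S.incl (P x))‖ := by
  obtain ⟨P, h1, h2⟩ := Submodule.exists_seminorm_extension (E := E) S.polarization S.norm
  exact ⟨P, h1, h2⟩

theorem exists_model_norm_le : ∃ C, 0 < C ∧ ∀ v : S.polarization,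
    ‖(S.incl v)‖ ≤ C * S.norm v :=
  Submodule.exists_norm_le_mul (E := E) S.polarization S.norm S.norm_definite

variable {S}

/-- The definition of a horizontal curve does not ask the control to be measurable. Its norm is
nevertheless an almost everywhere limit of seminorms of difference quotients of `γ` in
left-translated charts, and these are measurable. -/
theorem IsHorizontal.aemeasurable_norm {I : Set ℝ} (hI : I.OrdConnected) {γ : ℝ → G}
    {u : ℝ → S.polarization} (h : S.IsHorizontal I γ u) :
    AEMeasurable (fun t => S.norm (u t)) (volume.restrict I) := by
  classical
  have := LieGroup.isTopologicalGroup_real E G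
  obtain ⟨P, hP, Hp⟩ := S.exists_seminorm_extension
  -- No penalty off `V` is needed here: `p` only has to restrict to the norm on `V`.
  obtain ⟨p, hp⟩ := Hp 0 le_rfl
  have hpc := p.continuous_of_finiteDimensional_real
  rw [isHorizontal_iff] at h
  set ε : ℕ → ℝ := fun n => 1 / ((n : ℝ) + 1)
  set J := interior I
  have hγ : ContinuousOn γ J := h.1.1.mono interior_subset
  let A : ℕ → Set ℝ := fun n => J ∩ (fun t => t + ε n) ⁻¹' J
  have hA : ∀ n, IsOpen (A n) := fun n =>
    isOpen_interior.inter (isOpen_interior.preimage (by fun_prop))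
  have hk : ∀ n, ContinuousOn (fun t => (γ t)⁻¹ * γ (t + ε n)) (A n) := fun n =>
    (hγ.mono inter_subset_left).inv.mul
      (hγ.comp (by fun_prop : Continuous fun t : ℝ => t + ε n).continuousOn fun t ht => ht.2)
  -- The open set of times at which the `n`-th difference quotient makes sense; elsewhere the
  -- approximant is set to `0`. Each interior time at which `γ` is continuous belongs to `O n` for
  -- all large `n`.
  let O : ℕ → Set ℝ := fun n => A n ∩ (fun t => (γ t)⁻¹ * γ (t + ε n)) ⁻¹' (chartAt E (1 : G)).source
  have hO : ∀ n, IsOpen (O n) := fun n =>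
    (hk n).isOpen_inter_preimage (hA n) (chartAt E (1 : G)).open_source
  let f : ℕ → ℝ → ℝ := fun n => (O n).piecewise (fun t => p ((ε n)⁻¹ •
    (chartAt E (1 : G) ((γ t)⁻¹ * γ (t + ε n)) - chartAt E (1 : G) 1))) 0
  refine aemeasurable_of_tendsto_metrizable_ae' (f := f) (fun n => ?_) ?_
  · refine (ContinuousOn.measurable_piecewise ?_ continuousOn_const
      (hO n).measurableSet).aemeasurable
    refine hpc.comp_continuousOn (ContinuousOn.const_smul (ContinuousOn.sub ?_ continuousOn_const) _)
    exact (chartAt E (1 : G)).continuousOn.comp ((hk n).mono inter_subset_left) fun t ht => ht.2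
  · filter_upwards [h.2, hI.ae_mem_interior] with t ⟨h1, h2⟩ ht
    have hε : Tendsto ε atTop (𝓝[≠] 0) := tendsto_nhdsWithin_iff.2
      ⟨tendsto_one_div_add_atTop_nhds_zero_nat, Eventually.of_forall fun n => by
        simp only [ε, mem_compl_iff, mem_singleton_iff]; positivity⟩
    have h3 := (hasDerivAt_iff_tendsto_slope_zero.1
      (h2.hasDerivAt (mem_interior_iff_mem_nhds.1 ht))).comp hε
    have h4 := (hpc.tendsto _).comp h3
    rw [show p (S.incl (u t)) = S.norm (u t) by rw [hp, hP, zero_mul, add_zero]] at h4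
    refine h4.congr' ?_
    have hε0 : Tendsto (fun n => t + ε n) atTop (𝓝 t) := by
      simpa using (tendsto_nhdsWithin_iff.1 hε).1.const_add t
    have hγt : ContinuousAt γ t := hγ.continuousAt (isOpen_interior.mem_nhds ht)
    have h5 : Tendsto (fun n => (γ t)⁻¹ * γ (t + ε n)) atTop (𝓝 1) := by
      simpa using (hγt.tendsto.comp hε0).const_mul (γ t)⁻¹
    filter_upwards [hε0 (isOpen_interior.mem_nhds ht), h5 (chartAt_one_source_mem_nhds (E := E))] with n h6 h7
    have : t ∈ O n := ⟨⟨ht, h6⟩, h7⟩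
    simp [f, this]

theorem IsHorizontal.intervalIntegrable_norm {a b : ℝ} (hab : a ≤ b) {γ : ℝ → G}
    {u : ℝ → S.polarization} (h : S.IsHorizontal (Icc a b) γ u)
    (hL : ∫⁻ t in Icc a b, ENNReal.ofReal (S.norm (u t)) ≠ ⊤) :
    IntervalIntegrable (fun t => S.norm (u t)) volume a b := by
  rw [intervalIntegrable_iff_integrableOn_Icc_of_le hab]
  refine ⟨(h.aemeasurable_norm ordConnected_Icc).aestronglyMeasurable, ?_⟩
  rw [hasFiniteIntegral_iff_ofReal (ae_of_all _ fun t => apply_nonneg _ _)]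
  exact hL.lt_top

theorem IsHorizontal.intervalIntegral_norm {a b : ℝ} (hab : a ≤ b) {γ : ℝ → G}
    {u : ℝ → S.polarization} (h : S.IsHorizontal (Icc a b) γ u) :
    ∫ t in a..b, S.norm (u t) = (∫⁻ t in Icc a b, ENNReal.ofReal (S.norm (u t))).toReal := by
  rw [intervalIntegral.integral_of_le hab, ← integral_Icc_eq_integral_Ioc,
    integral_eq_lintegral_of_nonneg_ae (ae_of_all _ fun t => apply_nonneg _ _)
      (h.aemeasurable_norm ordConnected_Icc).aestronglyMeasurable]

theorem IsHorizontal.seminorm_chartAt_sub_le {a b c : ℝ} (hab : a ≤ b) {γ : ℝ → G}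
    {u : ℝ → S.polarization} (h : S.IsHorizontal (Icc a b) γ u)
    (hL : ∫⁻ t in Icc a b, ENNReal.ofReal (S.norm (u t)) ≠ ⊤) (q : Seminorm ℝ E)
    (hγ : MapsTo γ (Icc a b) (chartAt E (1 : G)).source)
    (hq : ∀ t ∈ Icc a b, ∀ v : S.polarization, q (leftFrame E G (chartAt E (1 : G) (γ t))
      (S.incl v)) ≤ c * S.norm v) :
    q (chartAt E (1 : G) (γ b) - chartAt E (1 : G) (γ a)) ≤
      c * (∫⁻ t in Icc a b, ENNReal.ofReal (S.norm (u t))).toReal := by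
  rw [← h.intervalIntegral_norm hab, ← intervalIntegral.integral_const_mul]
  have h' := S.isHorizontal_iff.1 h
  refine AbsolutelyContinuousOnInterval.seminorm_sub_le (f := fun t => chartAt E (1 : G) (γ t))
    (f' := fun t => leftFrame E G (chartAt E (1 : G) (γ t))
      (S.incl (u t))) hab
    (h'.1.2 1 a b hab subset_rfl hγ) q ((h.intervalIntegrable_norm hab hL).const_mul c) ?_
  filter_upwards [h'.2, ordConnected_Icc.ae_mem_interior, ae_restrict_mem measurableSet_Icc]
    with t ⟨h1, h2⟩ h3 h4
  exact ⟨(HasDerivWithinAt.chartAt_one_comp h1 h2 (hγ h4)).hasDerivAt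
    (mem_interior_iff_mem_nhds.1 h3), hq t h4 (u t)⟩

variable (S)

/-- At the identity the left frame is the identity map, so by continuity it inflates `p` by a factor
at most `1 + ε` nearby, relative to the norm on `V`. Integrating along an almost optimal curve gives
the bound, provided that the curve stays in the chart; a first-exit-time argument ensures this. -/
theorem exists_chart_estimate (p : Seminorm ℝ E)
    (hp : ∀ v : S.polarization, p (S.incl v) ≤ S.norm v)
    {ε : ℝ} (hε : 0 < ε) :
    ∃ U ∈ 𝓝 (1 : G), ∃ δ > 0, ∀ g ∈ U, ∀ (h : G) (r : ℝ), 0 ≤ r → r < δ →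
      S.ccDist g h ≤ ENNReal.ofReal r → h ∈ (chartAt E (1 : G)).source ∧
        p (chartAt E (1 : G) h - chartAt E (1 : G) g) ≤ (1 + ε) * r := by
  have := LieGroup.t2Space_real E G
  obtain ⟨C, hC, hC'⟩ := p.exists_le_mul_norm
  obtain ⟨D, hD, hD'⟩ := S.exists_model_norm_le
  set x₀ := chartAt E (1 : G) 1
  obtain ⟨r₀, hr₀, H⟩ : ∃ r₀ > 0, ∀ x ∈ Metric.ball x₀ r₀, x ∈ (chartAt E (1 : G)).target ∧
      ‖leftFrame E G x - ContinuousLinearMap.id ℝ E‖ ≤ min 1 (ε / (C * D)) := by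
    have h1 : ∀ᶠ x in 𝓝 x₀, ‖leftFrame E G x - ContinuousLinearMap.id ℝ E‖ <
        min 1 (ε / (C * D)) := by
      have h2 : Tendsto (fun x => ‖leftFrame E G x - ContinuousLinearMap.id ℝ E‖) (𝓝 x₀) (𝓝 0) := by
        have h3 := ((continuousAt_leftFrame (E := E) (G := G)).sub
          (continuousAt_const (y := ContinuousLinearMap.id ℝ E))).norm
        have h4 := h3.tendsto
        rw [Pi.sub_apply, leftFrame_one, sub_self, norm_zero] at h4
        exact h4
      exact h2.eventually (gt_mem_nhds (by positivity))
    obtain ⟨r, hr, hr'⟩ := Metric.eventually_nhds_iff_ball.1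
      ((eventually_mem_set.2 (chartAt_one_target_mem_nhds (E := E) (G := G))).and h1)
    exact ⟨r, hr, fun x hx => ⟨(hr' x hx).1, (hr' x hx).2.le⟩⟩
  have Hp : ∀ x ∈ Metric.ball x₀ r₀, ∀ v : S.polarization,
      p (leftFrame E G x (S.incl v)) ≤ (1 + ε) * S.norm v ∧
      ‖leftFrame E G x (S.incl v)‖ ≤ (2 * D) * S.norm v := by
    intro x hx v
    obtain ⟨-, hx2⟩ := H x hx
    have hv := hD' v
    set w : E := (S.incl v)
    have e : leftFrame E G x w = w + (leftFrame E G x - ContinuousLinearMap.id ℝ E) w := by simp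
    have h1 : ‖(leftFrame E G x - ContinuousLinearMap.id ℝ E) w‖ ≤
        min 1 (ε / (C * D)) * (D * S.norm v) :=
      (ContinuousLinearMap.le_opNorm _ _).trans (by gcongr)
    have hn : 0 ≤ S.norm v := apply_nonneg _ _
    constructor
    · rw [e]
      refine (map_add_le_add p _ _).trans ?_
      have h2 := (hC' ((leftFrame E G x - ContinuousLinearMap.id ℝ E) w)).trans
        (mul_le_mul_of_nonneg_left h1 hC.le)
      have h3 : C * (min 1 (ε / (C * D)) * (D * S.norm v)) ≤ ε * S.norm v := by
        calc C * (min 1 (ε / (C * D)) * (D * S.norm v))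
            ≤ C * ((ε / (C * D)) * (D * S.norm v)) := by
              gcongr
              exact min_le_right _ _
          _ = ε * S.norm v := by field_simp
      linarith [hp v]
    · rw [e]
      refine (norm_add_le _ _).trans ?_
      have h3 : min 1 (ε / (C * D)) * (D * S.norm v) ≤ 1 * (D * S.norm v) := by
        gcongr
        exact min_le_left _ _
      linarith
  -- A curve starting within `r₀ / 2` of `x₀` and of length below `r₀ / (4 * D)` moves by less than
  -- `2 * D * (r₀ / (4 * D)) = r₀ / 2` in the chart, so it cannot leave the ball of radius `r₀`.
  refine ⟨(chartAt E (1 : G)).source ∩ chartAt E (1 : G) ⁻¹' Metric.ball x₀ (r₀ / 2),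
    inter_mem chartAt_one_source_mem_nhds
      ((contMDiffAt_chartAt 1 (mem_chart_source E 1)).continuousAt.preimage_mem_nhds
        (Metric.ball_mem_nhds _ (by positivity))), r₀ / (4 * D), by positivity, ?_⟩
  rintro g ⟨hg1, hg2⟩ h r hr hrδ hd
  -- The slack `η` is there because the infimum defining the distance need not be attained; it tends
  -- to `0` at the end.
  have key : ∀ η > 0, r + η < r₀ / (4 * D) → h ∈ (chartAt E (1 : G)).source ∧
      p (chartAt E (1 : G) h - chartAt E (1 : G) g) ≤ (1 + ε) * (r + η) := by
    intro η hη hrη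
    obtain ⟨γ, u, hγ, rfl, rfl, hL⟩ := S.exists_isHorizontal_of_ccDist_lt (r := ENNReal.ofReal (r + η))
      (hd.trans_lt ((ENNReal.ofReal_lt_ofReal_iff (by positivity)).2 (by linarith)))
    have hLsub : ∀ t ∈ Icc (0 : ℝ) 1, ∫⁻ s in Icc 0 t, ENNReal.ofReal (S.norm (u s)) <
        ENNReal.ofReal (r + η) := fun t ht =>
      (lintegral_mono_set (Icc_subset_Icc_right ht.2)).trans_lt hL
    set O : Set G := (chartAt E (1 : G)).source ∩ chartAt E (1 : G) ⁻¹' Metric.ball x₀ r₀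
    have hO : IsOpen O := (chartAt E (1 : G)).isOpen_inter_preimage Metric.isOpen_ball
    have step : ∀ t ∈ Icc (0 : ℝ) 1, (∀ s ∈ Icc 0 t, γ s ∈ O) →
        ‖chartAt E (1 : G) (γ t) - chartAt E (1 : G) (γ 0)‖ ≤ 2 * D * (r + η) ∧
        p (chartAt E (1 : G) (γ t) - chartAt E (1 : G) (γ 0)) ≤ (1 + ε) * (r + η) := by
      intro t ht hs
      have h1 := hγ.mono (Icc_subset_Icc_right ht.2)
      have h2 := hLsub t ht
      have h3 : (∫⁻ s in Icc 0 t, ENNReal.ofReal (S.norm (u s))).toReal ≤ r + η :=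
        ENNReal.toReal_le_of_le_ofReal (by positivity) h2.le
      constructor
      · refine (h1.seminorm_chartAt_sub_le ht.1 h2.ne_top (normSeminorm ℝ E)
          (fun s hs' => (hs s hs').1) (fun s hs' v => (Hp _ (hs s hs').2 v).2)).trans ?_
        gcongr
      · refine (h1.seminorm_chartAt_sub_le ht.1 h2.ne_top p
          (fun s hs' => (hs s hs').1) (fun s hs' v => (Hp _ (hs s hs').2 v).1)).trans ?_
        gcongr
    have hD2 : 2 * D * (r + η) < r₀ / 2 := by
      rw [lt_div_iff₀ (by positivity)] at hrη
      linarith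
    have hall : ∀ t ∈ Icc (0 : ℝ) 1, γ t ∈ O := by
      by_contra! hbad
      set B : Set ℝ := Icc (0 : ℝ) 1 ∩ γ ⁻¹' Oᶜ
      have hBc : IsCompact B := by
        refine isCompact_Icc.of_isClosed_subset ?_ inter_subset_left
        exact hγ.1.1.preimage_isClosed_of_isClosed isClosed_Icc hO.isClosed_compl
      obtain ⟨t₁, h1, h2⟩ := hbad
      obtain ⟨t₀, ⟨ht₀, ht₀'⟩, hmin⟩ := hBc.exists_isLeast ⟨t₁, h1, h2⟩
      have hbefore : ∀ s ∈ Ico 0 t₀, γ s ∈ O := by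
        intro s hs
        by_contra hs'
        exact absurd (hmin ⟨⟨hs.1, hs.2.le.trans ht₀.2⟩, hs'⟩) (not_le.2 hs.2)
      have hpos : 0 < t₀ := by
        refine lt_of_le_of_ne ht₀.1 fun e => ht₀' ?_
        rw [← e]
        exact ⟨hg1, Metric.ball_subset_ball (by linarith) hg2⟩
      set ρ := dist (chartAt E (1 : G) (γ 0)) x₀ + 2 * D * (r + η)
      have hρ : ρ < r₀ := by
        have : dist (chartAt E (1 : G) (γ 0)) x₀ < r₀ / 2 := hg2
        linarith
      have hcl : Metric.closedBall x₀ ρ ⊆ Metric.ball x₀ r₀ := Metric.closedBall_subset_ball hρ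
      -- Before the first exit time the curve stays in this compact set, which is closed since `G`
      -- is Hausdorff and is contained in `O`; so the exit point would lie in `O` as well.
      set K : Set G := (chartAt E (1 : G)).symm '' Metric.closedBall x₀ ρ
      have hK : IsCompact K := (isCompact_closedBall x₀ ρ).image_of_continuousOn
        ((chartAt E (1 : G)).continuousOn_symm.mono fun x hx => (H x (hcl hx)).1)
      have hin : ∀ s ∈ Ico 0 t₀, γ s ∈ K := by
        intro s hs
        have h1 := (step s ⟨hs.1, hs.2.le.trans ht₀.2⟩ fun s' hs' =>
          hbefore s' ⟨hs'.1, hs'.2.trans_lt hs.2⟩).1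
        refine ⟨chartAt E (1 : G) (γ s), ?_, (chartAt E (1 : G)).left_inv (hbefore s hs).1⟩
        rw [← dist_eq_norm] at h1
        exact Metric.mem_closedBall.2 ((dist_triangle _ _ _).trans (by linarith))
      have hlim : Tendsto γ (𝓝[Ico 0 t₀] t₀) (𝓝 (γ t₀)) :=
        (hγ.1.1 t₀ ht₀).mono fun s hs => ⟨hs.1, hs.2.le.trans ht₀.2⟩
      have hne : (𝓝[Ico 0 t₀] t₀).NeBot := by
        rw [← mem_closure_iff_nhdsWithin_neBot, closure_Ico hpos.ne]
        exact ⟨hpos.le, le_rfl⟩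
      obtain ⟨x, hx, hx'⟩ := hK.isClosed.mem_of_tendsto hlim
        (eventually_nhdsWithin_of_forall hin)
      refine ht₀' ?_
      rw [← hx']
      refine ⟨(chartAt E (1 : G)).map_target (H x (hcl hx)).1, ?_⟩
      rw [mem_preimage, (chartAt E (1 : G)).right_inv (H x (hcl hx)).1]
      exact hcl hx
    exact ⟨(hall 1 ⟨zero_le_one, le_rfl⟩).1,
      (step 1 ⟨zero_le_one, le_rfl⟩ fun s hs => hall s hs).2⟩
  obtain ⟨η₀, hη₀, hη₀'⟩ : ∃ η₀ > 0, r + η₀ < r₀ / (4 * D) :=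
    ⟨(r₀ / (4 * D) - r) / 2, by linarith, by linarith⟩
  refine ⟨(key η₀ hη₀ hη₀').1, ?_⟩
  refine ge_of_tendsto (x := 𝓝[>] (0 : ℝ)) (f := fun η => (1 + ε) * (r + η)) ?_ ?_
  · refine tendsto_nhdsWithin_of_tendsto_nhds ?_
    have : Continuous fun η : ℝ => (1 + ε) * (r + η) := by fun_prop
    simpa using this.tendsto 0
  · filter_upwards [Ioo_mem_nhdsGT hη₀] with η hη
    exact (key η hη.1 (by linarith [hη.2])).2

end SubFinslerStructure

/-- A derivative inherits an infinitesimal seminorm bound. -/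
theorem Seminorm.le_of_hasDerivWithinAt {E : Type*} [NormedAddCommGroup E] [NormedSpace ℝ E]
    [FiniteDimensional ℝ E] (p : Seminorm ℝ E) {f : ℝ → E} {Θ : ℝ → ℝ} {x : E} {θ t : ℝ}
    (hf : HasDerivWithinAt f x (Ioi t) t) (hΘ : HasDerivWithinAt Θ θ (Ioi t) t)
    (h : ∀ ε > 0, ∀ᶠ s in 𝓝[>] t, p (f s - f t) ≤ (1 + ε) * (Θ s - Θ t)) : p x ≤ θ := by
  have hpc := p.continuous_of_finiteDimensional_real
  have key : ∀ ε > 0, p x ≤ (1 + ε) * θ := by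
    intro ε hε
    rw [hasDerivWithinAt_iff_tendsto_slope' (by simp)] at hf hΘ
    refine le_of_tendsto_of_tendsto ((hpc.tendsto x).comp hf) (hΘ.const_mul (1 + ε)) ?_
    filter_upwards [h ε hε, self_mem_nhdsWithin] with s hs hst
    have hst' : 0 < s - t := sub_pos.2 hst
    simp only [Function.comp, slope_def_module, map_smul_eq_mul, smul_eq_mul, norm_inv,
      Real.norm_of_nonneg hst'.le]
    rw [mul_left_comm]
    gcongr
  refine ge_of_tendsto (x := 𝓝[>] (0 : ℝ)) (f := fun ε => (1 + ε) * θ) ?_ ?_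
  · refine tendsto_nhdsWithin_of_tendsto_nhds ?_
    have : Continuous fun ε : ℝ => (1 + ε) * θ := by fun_prop
    simpa using this.tendsto 0
  · filter_upwards [self_mem_nhdsWithin] with ε hε using key ε hε

/-! ### Integral curves of left-invariant vector fields. -/

section IntegralCurve

variable {E : Type*} [NormedAddCommGroup E] [NormedSpace ℝ E] [FiniteDimensional ℝ E]
  (G : Type*) [TopologicalSpace G] [ChartedSpace E G] [Group G] [LieGroup 𝓘(ℝ, E) ∞ G]

/-- A left-invariant vector field has a local integral curve through the identity. -/
theorem exists_leftInvariant_integralCurve (v : E) : ∃ c : ℝ → G, c 0 = 1 ∧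
    ∀ᶠ t in 𝓝 (0 : ℝ), ContinuousAt c t ∧
      HasDerivAt (fun s => chartAt E (1 : G) ((c t)⁻¹ * c s)) v t := by
  have := LieGroup.t2Space_real E G
  have h1 : ContMDiffAt 𝓘(ℝ, E) (𝓘(ℝ, E).prod 𝓘(ℝ, E)) 1 (fun g : G =>
      (⟨g, mulInvariantVectorField (I := 𝓘(ℝ, E)) (v : GroupLieAlgebra 𝓘(ℝ, E) G) g⟩ :
        TangentBundle 𝓘(ℝ, E) G)) 1 :=
    (contMDiffAt_mulInvariantVectorField (I := 𝓘(ℝ, E)) (G := G) v).of_le (by simp)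
  have : IsManifold 𝓘(ℝ, E) 1 G := .of_le (n := ∞) (by exact_mod_cast le_top)
  obtain ⟨c, hc0, hc⟩ := exists_isMIntegralCurveAt_of_contMDiffAt_boundaryless (t₀ := (0 : ℝ)) h1
  refine ⟨c, hc0, ?_⟩
  filter_upwards [hc] with t ht
  have h2 := hasMFDerivWithinAt_mulInvariant_iff.1 (hasMFDerivWithinAt_univ.2 ht)
  rwa [continuousWithinAt_univ, hasDerivWithinAt_univ] at h2

variable {G}

omit [FiniteDimensional ℝ E] in
theorem exists_nhds_leftFrame_norm_le : ∃ U ∈ 𝓝 (1 : G), U ⊆ (chartAt E (1 : G)).source ∧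
    ∃ C : ℝ, ∀ g ∈ U, ‖leftFrame E G (chartAt E (1 : G) g)‖ ≤ C := by
  have h1 := (continuousAt_leftFrame (E := E) (G := G)).norm.eventually
    (gt_mem_nhds (lt_add_one _))
  refine ⟨(chartAt E (1 : G)).source ∩ chartAt E (1 : G) ⁻¹' _,
    inter_mem chartAt_one_source_mem_nhds
      ((contMDiffAt_chartAt 1 (mem_chart_source E 1)).continuousAt.preimage_mem_nhds h1),
    inter_subset_left, _, fun g hg => (mem_preimage.1 hg.2).le⟩

omit [FiniteDimensional ℝ E] in
theorem isAbsContCurveOn_of_hasDerivAt {c : ℝ → G} {v : E} {I : Set ℝ}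
    (hc : ∀ t ∈ I, ContinuousAt c t ∧
      HasDerivAt (fun s => chartAt E (1 : G) ((c t)⁻¹ * c s)) v t) : IsAbsContCurveOn E c I := by
  have := LieGroup.isTopologicalGroup_real E G
  obtain ⟨U, hU, hUs, C, hC⟩ := exists_nhds_leftFrame_norm_le (E := E) (G := G)
  refine isAbsContCurveOn_of_translates (fun t ht => (hc t ht).1.continuousWithinAt) fun t ht => ?_
  have h1 : Tendsto (fun s => (c t)⁻¹ * c s) (𝓝 t) (𝓝 1) := by
    simpa using ((hc t ht).1.tendsto.const_mul (c t)⁻¹)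
  refine ⟨_, h1 hU, fun a b hab hs => ?_⟩
  have h2 : ∀ s ∈ Icc a b, HasDerivWithinAt (fun s => chartAt E (1 : G) ((c t)⁻¹ * c s))
      (leftFrame E G (chartAt E (1 : G) ((c t)⁻¹ * c s)) v) (Icc a b) s := by
    intro s hs'
    obtain ⟨k1, k2⟩ := hc s (hs hs').1
    refine HasDerivWithinAt.chartAt_one_comp (γ := fun s => (c t)⁻¹ * c s)
      (continuousAt_const.mul k1).continuousWithinAt ?_ (hUs (hs hs').2)
    simpa using k2.hasDerivWithinAt
  have h3 : LipschitzOnWith (C * ‖v‖).toNNReal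
      (fun s => chartAt E (1 : G) ((c t)⁻¹ * c s)) (Icc a b) := by
    refine (convex_Icc a b).lipschitzOnWith_of_nnnorm_hasDerivWithin_le h2 fun s hs' => ?_
    rw [← NNReal.coe_le_coe, coe_nnnorm]
    refine le_trans ?_ (Real.le_coe_toNNReal _)
    exact (ContinuousLinearMap.le_opNorm _ _).trans
      (mul_le_mul_of_nonneg_right (hC _ (hs hs').2) (norm_nonneg v))
  rw [← uIcc_of_le hab] at h3
  exact h3.absolutelyContinuousOnInterval

end IntegralCurve

/-! ### Recognizing horizontal curves from their increments. -/

namespace SubFinslerStructure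

variable {E : Type*} [NormedAddCommGroup E] [NormedSpace ℝ E] [FiniteDimensional ℝ E]
  {G : Type*} [TopologicalSpace G] [ChartedSpace E G] [Group G] [LieGroup 𝓘(ℝ, E) ∞ G]
  (S : SubFinslerStructure E G)

/-- Every horizontal vector is the velocity of a curve of the corresponding speed. -/
theorem exists_curve_tangent (v : S.polarization) : ∃ c : ℝ → G, c 0 = 1 ∧ ContinuousAt c 0 ∧
    HasDerivAt (fun s => chartAt E (1 : G) (c s)) (S.incl v) 0 ∧
    ∀ᶠ t in 𝓝[≥] (0 : ℝ), S.ccDist 1 (c t) ≤ ENNReal.ofReal (t * S.norm v) := by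
  obtain ⟨c, hc0, hc⟩ := exists_leftInvariant_integralCurve G (S.incl v)
  have hc' := hc.self_of_nhds
  refine ⟨c, hc0, hc'.1, by simpa [hc0] using hc'.2, ?_⟩
  obtain ⟨τ, hτ, H⟩ := Metric.eventually_nhds_iff_ball.1 hc
  filter_upwards [Ico_mem_nhdsGE hτ] with t ht
  have hsub : ∀ s ∈ Icc 0 t, s ∈ Metric.ball (0 : ℝ) τ := fun s hs => by
    rw [mem_ball_zero_iff, Real.norm_of_nonneg hs.1]
    exact hs.2.trans_lt ht.2
  have hh : S.IsHorizontal (Icc 0 t) c (fun _ => v) := by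
    rw [isHorizontal_iff]
    refine ⟨isAbsContCurveOn_of_hasDerivAt fun s hs => H s (hsub s hs), ?_⟩
    filter_upwards [ae_restrict_mem measurableSet_Icc] with s hs
    exact ⟨(H s (hsub s hs)).1.continuousWithinAt, (H s (hsub s hs)).2.hasDerivWithinAt⟩
  have := hh.ccDist_le ht.1
  rw [hc0, setLIntegral_const, Real.volume_Icc, sub_zero, ← ENNReal.ofReal_mul (apply_nonneg _ _),
    mul_comm] at this
  exact this

theorem exists_normSeminorm_le : ∃ D, 0 < D ∧ ∃ p : Seminorm ℝ E,
    (∀ v : S.polarization, p (S.incl v) ≤ S.norm v) ∧ ∀ x, ‖x‖ = D * p x := by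
  obtain ⟨D, hD, hD'⟩ := S.exists_model_norm_le
  refine ⟨D, hD, (normSeminorm ℝ E).comp (D⁻¹ • LinearMap.id), fun v => ?_, fun x => ?_⟩
  · simp only [Seminorm.comp_apply, LinearMap.smul_apply, LinearMap.id_apply, map_smul_eq_mul,
      coe_normSeminorm, norm_inv, Real.norm_of_nonneg hD.le]
    rw [inv_mul_le_iff₀ hD]
    exact hD' v
  · simp only [Seminorm.comp_apply, LinearMap.smul_apply, LinearMap.id_apply, map_smul_eq_mul,
      coe_normSeminorm, norm_inv, Real.norm_of_nonneg hD.le]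
    field_simp

variable {S} in
-- The ball of radius `r` in `V` is cut out by the admissible seminorms. Those of the form `‖P x‖ +
-- k |x - P x|`, with `P` a projection onto `V`, force `x = P x` when `k` is large, and `k = 0`
-- gives the norm bound. Bounds on displacements in the full Lie algebra thus yield membership in
-- `V`.
theorem exists_incl_eq_of_seminorm_le {x : E} {r : ℝ}
    (h : ∀ p : Seminorm ℝ E, (∀ v : S.polarization, p (S.incl v) ≤ S.norm v) → p x ≤ r) :
    ∃ v : S.polarization, S.incl v = x ∧ S.norm v ≤ r := by
  obtain ⟨P, hP, Hp⟩ := S.exists_seminorm_extension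
  have key : ∀ k : ℝ, 0 ≤ k → S.norm (P x) + k * ‖x - S.incl (P x)‖ ≤ r := by
    intro k hk
    obtain ⟨p, hp⟩ := Hp k hk
    rw [← hp]
    refine h p fun v => ?_
    rw [hp, hP]
    simp
  refine ⟨P x, ?_, by simpa using key 0 le_rfl⟩
  by_contra hne
  have hpos : 0 < ‖x - S.incl (P x)‖ := norm_pos_iff.2 (sub_ne_zero.2 (Ne.symm hne))
  have h0 : 0 ≤ r := by simpa using (apply_nonneg S.norm (P x)).trans (by simpa using key 0 le_rfl)
  -- With this `k` the penalty alone equals `r + 1`, exceeding the bound `r`.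
  have := key ((r + 1) / ‖x - S.incl (P x)‖) (by positivity)
  rw [div_mul_cancel₀ _ hpos.ne'] at this
  linarith [apply_nonneg S.norm (P x)]

theorem exists_ccDist_lt_mem {W : Set G} (hW : W ∈ 𝓝 (1 : G)) :
    ∃ δ > 0, ∀ h : G, S.ccDist 1 h < ENNReal.ofReal δ → h ∈ W := by
  obtain ⟨D, hD, p, hp, hpn⟩ := S.exists_normSeminorm_le
  obtain ⟨U, hU, δ, hδ, H⟩ := S.exists_chart_estimate p hp one_pos
  have h1 : (chartAt E (1 : G)).symm ⁻¹' W ∈ 𝓝 (chartAt E (1 : G) 1) := by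
    refine (contMDiffAt_chartAt_symm 1 (mem_chart_target E 1)).continuousAt.preimage_mem_nhds ?_
    rwa [(chartAt E (1 : G)).left_inv (mem_chart_source E 1)]
  obtain ⟨r, hr, hr'⟩ := Metric.mem_nhds_iff.1 h1
  refine ⟨min δ (r / (2 * D)), by positivity, fun h hh => ?_⟩
  have hfin : S.ccDist 1 h ≠ ⊤ := hh.ne_top
  have h2 : (S.ccDist 1 h).toReal < min δ (r / (2 * D)) :=
    (ENNReal.lt_ofReal_iff_toReal_lt hfin).1 hh
  obtain ⟨h3, h4⟩ := H 1 (mem_of_mem_nhds hU) h _ ENNReal.toReal_nonneg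
    (h2.trans_le (min_le_left _ _)) (ENNReal.ofReal_toReal hfin).ge
  rw [← (chartAt E (1 : G)).left_inv h3]
  refine hr' (Metric.mem_ball.2 ?_)
  rw [dist_eq_norm, hpn]
  calc D * p (chartAt E (1 : G) h - chartAt E (1 : G) 1) ≤ D * ((1 + 1) * (S.ccDist 1 h).toReal) := by gcongr
    _ < D * ((1 + 1) * (r / (2 * D))) := by
      gcongr
      exact h2.trans_le (min_le_right _ _)
    _ = r := by field_simp; norm_num

variable {S}

/-- A curve whose increments in the left-translated charts are controlled by those of an
absolutely continuous function is horizontal, with the corresponding bound on its speed. -/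
theorem exists_isHorizontal_of_increment {I : Set ℝ} (hI : I.OrdConnected) {γ : ℝ → G}
    (hγ : ContinuousOn γ I) {Θ ρ : ℝ → ℝ}
    (hΘ : ∀ a b, a ≤ b → Icc a b ⊆ I → AbsolutelyContinuousOnInterval Θ a b)
    (hρ : ∀ᵐ t ∂(volume.restrict I), HasDerivAt Θ (ρ t) t)
    (hinc : ∀ t ∈ I, ∀ p : Seminorm ℝ E, (∀ v : S.polarization, p (S.incl v) ≤ S.norm v) →
      ∀ ε > 0, ∃ U ∈ 𝓝 t, ∀ s ∈ I ∩ U, ∀ s' ∈ I ∩ U, s ≤ s' →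
        p (chartAt E (1 : G) ((γ t)⁻¹ * γ s') - chartAt E (1 : G) ((γ t)⁻¹ * γ s)) ≤
          (1 + ε) * (Θ s' - Θ s)) :
    ∃ u : ℝ → S.polarization, S.IsHorizontal I γ u ∧
      ∀ᵐ t ∂(volume.restrict I), S.norm (u t) ≤ ρ t := by
  classical
  have := LieGroup.isTopologicalGroup_real E G
  obtain ⟨D, hD, q, hq, hqn⟩ := S.exists_normSeminorm_le
  have hac : ∀ t ∈ I, ∃ U ∈ 𝓝 t, ∀ c d, c ≤ d → Icc c d ⊆ I ∩ U →
      AbsolutelyContinuousOnInterval (fun s => chartAt E (1 : G) ((γ t)⁻¹ * γ s)) c d := by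
    intro t ht
    obtain ⟨U, hU, H⟩ := hinc t ht q hq 1 one_pos
    refine ⟨U, hU, fun c d hcd hs => (hΘ c d hcd fun s h => (hs h).1).of_dist_le
      (C := 2 * D) ?_⟩
    rw [uIcc_of_le hcd]
    have main : ∀ s ∈ Icc c d, ∀ s' ∈ Icc c d, s ≤ s' →
        dist (chartAt E (1 : G) ((γ t)⁻¹ * γ s')) (chartAt E (1 : G) ((γ t)⁻¹ * γ s)) ≤
          2 * D * dist (Θ s') (Θ s) := by
      intro s h1 s' h2 hss
      rw [dist_eq_norm, hqn, Real.dist_eq]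
      have h3 := H s (hs h1) s' (hs h2) hss
      have h4 := le_abs_self (Θ s' - Θ s)
      calc D * q _ ≤ D * ((1 + 1) * (Θ s' - Θ s)) := by gcongr
        _ ≤ D * ((1 + 1) * |Θ s' - Θ s|) := by gcongr
        _ = _ := by ring
    intro s h1 s' h2
    rcases le_total s s' with h | h
    · rw [dist_comm, dist_comm (Θ s)]
      exact main s h1 s' h2 h
    · exact main s' h2 s h1 h
  have hdiff : ∀ᵐ t ∂(volume.restrict I),
      DifferentiableAt ℝ (fun s => chartAt E (1 : G) ((γ t)⁻¹ * γ s)) t := by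
    -- Absolute continuity in the translate by a single `γ t₀` gives differentiability almost
    -- everywhere near `t₀`, which is then moved to the translate by `γ t`. A locally null set is
    -- null.
    have hnull : volume {t | t ∈ interior I ∧
        ¬ DifferentiableAt ℝ (fun s => chartAt E (1 : G) ((γ t)⁻¹ * γ s)) t} = 0 := by
      refine measure_null_of_locally_null _ fun t₀ ht₀ => ?_
      have ht₀I : t₀ ∈ I := interior_subset ht₀.1
      obtain ⟨U, hU, H⟩ := hac t₀ ht₀I
      have hIn : I ∈ 𝓝 t₀ := mem_interior_iff_mem_nhds.1 ht₀.1
      have hc0 : ContinuousAt γ t₀ := hγ.continuousAt hIn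
      have hsrc : ∀ᶠ s in 𝓝 t₀, (γ t₀)⁻¹ * γ s ∈ (chartAt E (1 : G)).source := by
        have : Tendsto (fun s => (γ t₀)⁻¹ * γ s) (𝓝 t₀) (𝓝 1) := by
          simpa using hc0.tendsto.const_mul (γ t₀)⁻¹
        exact this chartAt_one_source_mem_nhds
      obtain ⟨r, hr, hr'⟩ := Metric.nhds_basis_closedBall.mem_iff.1
        (inter_mem (inter_mem (interior_mem_nhds.2 hIn) hU) hsrc)
      rw [Real.closedBall_eq_Icc] at hr'
      have hle : t₀ - r ≤ t₀ + r := by linarith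
      refine ⟨_, inter_mem self_mem_nhdsWithin (mem_nhdsWithin_of_mem_nhds
        (Icc_mem_nhds (a := t₀ - r) (b := t₀ + r) (by linarith) (by linarith))), ?_⟩
      have h1 := (H (t₀ - r) (t₀ + r) hle
        fun s hs => ⟨interior_subset (hr' hs).1.1, (hr' hs).1.2⟩).ae_differentiableAt'
      rw [uIcc_of_le hle] at h1
      refine measure_mono_null (fun t hbad => ?_) h1
      intro hcon
      have h2 := hcon hbad.2
      refine hbad.1.2 ?_
      have h3 := DifferentiableWithinAt.chartAt_one_translate (γ := γ) (I := univ) (t := t)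
        (g := γ t₀) (hγ.continuousAt (mem_interior_iff_mem_nhds.1 hbad.1.1)).continuousWithinAt
        h2.differentiableWithinAt (hr' hbad.2).2
      rwa [differentiableWithinAt_univ] at h3
    have h1 := measure_eq_zero_iff_ae_notMem.1 hnull
    filter_upwards [ae_restrict_of_ae h1, hI.ae_mem_interior] with t h2 h3
    by_contra h4
    exact h2 ⟨h3, h4⟩
  -- At a point of differentiability each admissible seminorm of the velocity is at most `ρ t`, so
  -- the velocity is horizontal of norm at most `ρ t`.
  have hmain : ∀ᵐ t ∂(volume.restrict I), ContinuousWithinAt γ I t ∧ ∃ v : S.polarization,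
      HasDerivAt (fun s => chartAt E (1 : G) ((γ t)⁻¹ * γ s)) (S.incl v) t ∧ S.norm v ≤ ρ t := by
    filter_upwards [hdiff, hρ, hI.ae_mem_interior] with t h1 h2 h3
    have htI := interior_subset h3
    refine ⟨hγ t htI, ?_⟩
    obtain ⟨v, hv, hv'⟩ := exists_incl_eq_of_seminorm_le (S := S)
      (x := deriv (fun s => chartAt E (1 : G) ((γ t)⁻¹ * γ s)) t) (r := ρ t) fun p hp => by
        refine p.le_of_hasDerivWithinAt h1.hasDerivAt.hasDerivWithinAt h2.hasDerivWithinAt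
          fun ε hε => ?_
        obtain ⟨U, hU, H⟩ := hinc t htI p hp ε hε
        filter_upwards [self_mem_nhdsWithin, nhdsWithin_le_nhds hU,
          nhdsWithin_le_nhds (mem_interior_iff_mem_nhds.1 h3)] with s hs hsU hsI
        exact H t ⟨htI, mem_of_mem_nhds hU⟩ s ⟨hsI, hsU⟩ (le_of_lt hs)
    exact ⟨v, by rw [hv]; exact h1.hasDerivAt, hv'⟩
  let u : ℝ → S.polarization := fun t => if h : ∃ v : S.polarization,
    HasDerivAt (fun s => chartAt E (1 : G) ((γ t)⁻¹ * γ s)) (S.incl v) t ∧ S.norm v ≤ ρ t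
    then h.choose else 0
  have hu : ∀ᵐ t ∂(volume.restrict I), ContinuousWithinAt γ I t ∧
      HasDerivAt (fun s => chartAt E (1 : G) ((γ t)⁻¹ * γ s)) (S.incl (u t)) t ∧
      S.norm (u t) ≤ ρ t := by
    filter_upwards [hmain] with t ht
    have : u t = ht.2.choose := dif_pos ht.2
    rw [this]
    exact ⟨ht.1, ht.2.choose_spec⟩
  refine ⟨u, S.isHorizontal_iff.2 ⟨isAbsContCurveOn_of_translates hγ hac, ?_⟩, ?_⟩
  · filter_upwards [hu] with t ht using ⟨ht.1, ht.2.1.hasDerivWithinAt⟩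
  · filter_upwards [hu] with t ht using ht.2.2

/-- A curve along which the distance is dominated by an absolutely continuous function is
horizontal. -/
theorem exists_isHorizontal_of_ccDist_le {I : Set ℝ} (hI : I.OrdConnected) {γ : ℝ → G}
    {Θ ρ : ℝ → ℝ} (hΘc : ContinuousOn Θ I)
    (hΘ : ∀ a b, a ≤ b → Icc a b ⊆ I → AbsolutelyContinuousOnInterval Θ a b)
    (hρ : ∀ᵐ t ∂(volume.restrict I), HasDerivAt Θ (ρ t) t) (hmono : MonotoneOn Θ I)
    (hd : ∀ s ∈ I, ∀ t ∈ I, s ≤ t → S.ccDist (γ s) (γ t) ≤ ENNReal.ofReal (Θ t - Θ s)) :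
    ∃ u : ℝ → S.polarization, S.IsHorizontal I γ u ∧
      ∀ᵐ t ∂(volume.restrict I), S.norm (u t) ≤ ρ t := by
  have := LieGroup.isTopologicalGroup_real E G
  have hnear : ∀ t ∈ I, ∀ δ > 0, ∀ᶠ s in 𝓝[I] t, |Θ s - Θ t| < δ := fun t ht δ hδ => by
    filter_upwards [hΘc t ht (Metric.ball_mem_nhds (Θ t) hδ)] with s hs
    rwa [mem_preimage, Metric.mem_ball, Real.dist_eq] at hs
  have htr : ∀ t ∈ I, Tendsto (fun s => (γ t)⁻¹ * γ s) (𝓝[I] t) (𝓝 1) := by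
    intro t ht W hW
    -- Distances are only controlled forward in time; intersecting with the inverse neighbourhood
    -- handles `s ≤ t`.
    obtain ⟨δ, hδ, H⟩ := S.exists_ccDist_lt_mem (inter_mem hW (inv_mem_nhds_one G hW))
    rw [mem_map]
    filter_upwards [hnear t ht δ hδ, self_mem_nhdsWithin] with s hs hsI
    rw [mem_preimage]
    rcases le_total t s with h | h
    · refine (H _ ?_).1
      rw [← ccDist_eq_one_left]
      exact (hd t ht s hsI h).trans_lt ((ENNReal.ofReal_lt_ofReal_iff hδ).2 (abs_lt.1 hs).2)
    · have h1 := (H ((γ s)⁻¹ * γ t) (by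
        rw [← ccDist_eq_one_left]
        exact (hd s hsI t ht h).trans_lt ((ENNReal.ofReal_lt_ofReal_iff hδ).2
          (by linarith [(abs_lt.1 hs).1])))).2
      simpa using h1
  have hγ : ContinuousOn γ I := by
    intro t ht
    have := (htr t ht).const_mul (γ t)
    simpa [ContinuousWithinAt] using this
  refine exists_isHorizontal_of_increment hI hγ hΘ hρ fun t ht p hp ε hε => ?_
  obtain ⟨U, hU, δ, hδ, H⟩ := S.exists_chart_estimate p hp hε
  obtain ⟨O, hO, hO'⟩ := mem_nhdsWithin_iff_exists_mem_nhds_inter.1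
    (inter_mem (htr t ht hU) (hnear t ht (δ / 2) (by positivity)))
  refine ⟨O, hO, fun s hs s' hs' hss => ?_⟩
  have h1 := hO' ⟨hs.2, hs.1⟩
  have h2 := hO' ⟨hs'.2, hs'.1⟩
  refine (H _ h1.1 _ (Θ s' - Θ s) (sub_nonneg.2 (hmono hs.1 hs'.1 hss)) ?_ ?_).2
  · have e1 : |Θ s - Θ t| < δ / 2 := h1.2
    rw [abs_lt] at e1
    have e2 : |Θ s' - Θ t| < δ / 2 := h2.2
    rw [abs_lt] at e2
    linarith
  · rw [ccDist_mul_left]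
    exact hd s hs.1 s' hs'.1 hss

end SubFinslerStructure

/-! ### Compactness of closed balls. -/

namespace SubFinslerStructure

variable {E : Type*} [NormedAddCommGroup E] [NormedSpace ℝ E] [FiniteDimensional ℝ E]
  {G : Type*} [TopologicalSpace G] [ChartedSpace E G] [Group G] [LieGroup 𝓘(ℝ, E) ∞ G]
  (S : SubFinslerStructure E G)

/-- Reparametrization by arclength, keeping only the metric bound on increments. No regularity of
the new parameter is claimed, and later arguments use just this bound. -/
theorem exists_lipschitz_param {g h : G} {L : ℝ} (hgh : S.ccDist g h < ENNReal.ofReal L) :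
    ∃ c : ℝ → G, c 0 = g ∧ c 1 = h ∧ ∀ s t, 0 ≤ s → s ≤ t → t ≤ 1 →
      S.ccDist (c s) (c t) ≤ ENNReal.ofReal (L * (t - s)) := by
  obtain ⟨γ, u, hγ, h0, h1, hL⟩ := S.exists_isHorizontal_of_ccDist_lt hgh
  have hint := hγ.intervalIntegrable_norm zero_le_one hL.ne_top
  have hℓ : ∫ t in (0 : ℝ)..1, S.norm (u t) < L := by
    rw [hγ.intervalIntegral_norm zero_le_one]
    exact (ENNReal.lt_ofReal_iff_toReal_lt hL.ne_top).1 hL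
  set ℓ := ∫ t in (0 : ℝ)..1, S.norm (u t) with hℓd
  have hsub : ∀ s t, 0 ≤ s → s ≤ t → t ≤ 1 →
      IntervalIntegrable (fun t => S.norm (u t)) volume s t := fun s t hs hst ht =>
    hint.mono_set (by rw [uIcc_of_le hst, uIcc_of_le zero_le_one]; exact Icc_subset_Icc hs ht)
  -- The term `(L - ℓ) * t` makes `Θ` strictly increasing even where the control vanishes, and makes
  -- its total increment exactly `L`.
  set Θ : ℝ → ℝ := fun t => (∫ r in (0 : ℝ)..t, S.norm (u r)) + (L - ℓ) * t with hΘ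
  have hdiff : ∀ s t, 0 ≤ s → s ≤ t → t ≤ 1 →
      Θ t - Θ s = (∫ r in s..t, S.norm (u r)) + (L - ℓ) * (t - s) := by
    intro s t hs hst ht
    have := intervalIntegral.integral_interval_sub_left (hsub 0 t le_rfl (hs.trans hst) ht)
      (hsub 0 s le_rfl hs (hst.trans ht))
    simp only [hΘ]
    linarith
  have hnn : ∀ s t, s ≤ t → 0 ≤ ∫ r in s..t, S.norm (u r) := fun s t hst =>
    intervalIntegral.integral_nonneg hst fun r _ => apply_nonneg _ _
  have hstrict : StrictMonoOn Θ (Icc 0 1) := by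
    intro s hs t ht hst
    have := hdiff s t hs.1 hst.le ht.2
    have h2 := hnn s t hst.le
    have : 0 < (L - ℓ) * (t - s) := mul_pos (by linarith) (by linarith)
    linarith
  have hcont : ContinuousOn Θ (Icc 0 1) := by
    refine ContinuousOn.add ?_ (by fun_prop)
    have := intervalIntegral.continuousOn_primitive_interval
      (μ := volume) (f := fun r => S.norm (u r)) (a := 0) (b := 1)
      (by rw [uIcc_of_le zero_le_one]
          exact (intervalIntegrable_iff_integrableOn_Icc_of_le zero_le_one).1 hint)
    rwa [uIcc_of_le zero_le_one] at this
  have hΘ0 : Θ 0 = 0 := by simp [hΘ]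
  have hΘ1 : Θ 1 = L := by simp [hΘ, ← hℓd]
  have hL0 : 0 ≤ L := (hnn 0 1 zero_le_one).trans hℓ.le
  have hex : ∀ s, s ∈ Icc (0 : ℝ) 1 → ∃ τ ∈ Icc (0 : ℝ) 1, Θ τ = L * s := by
    intro s hs
    refine intermediate_value_Icc zero_le_one hcont ?_
    rw [hΘ0, hΘ1]
    exact ⟨mul_nonneg hL0 hs.1, mul_le_of_le_one_right hL0 hs.2⟩
  choose! τ hτ hτe using hex
  refine ⟨fun s => γ (τ s), ?_, ?_, fun s t hs hst ht => ?_⟩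
  · have h0' : (0 : ℝ) ∈ Icc (0 : ℝ) 1 := ⟨le_rfl, zero_le_one⟩
    have : τ 0 = 0 := hstrict.injOn (hτ 0 h0') h0' (by rw [hτe 0 h0', hΘ0, mul_zero])
    simp only [this, h0]
  · have h1' : (1 : ℝ) ∈ Icc (0 : ℝ) 1 := ⟨zero_le_one, le_rfl⟩
    have : τ 1 = 1 := hstrict.injOn (hτ 1 h1') h1' (by rw [hτe 1 h1', hΘ1, mul_one])
    simp only [this, h1]
  · have hs' : s ∈ Icc (0 : ℝ) 1 := ⟨hs, hst.trans ht⟩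
    have ht' : t ∈ Icc (0 : ℝ) 1 := ⟨hs.trans hst, ht⟩
    have hle : τ s ≤ τ t := by
      rw [← hstrict.le_iff_le (hτ s hs') (hτ t ht'), hτe s hs', hτe t ht']
      exact mul_le_mul_of_nonneg_left hst hL0
    have hm := hγ.mono (Icc_subset_Icc (hτ s hs').1 (hτ t ht').2)
    refine (hm.ccDist_le hle).trans ?_
    have hfin : ∫⁻ r in Icc (τ s) (τ t), ENNReal.ofReal (S.norm (u r)) ≠ ⊤ :=
      ((lintegral_mono_set (Icc_subset_Icc (hτ s hs').1 (hτ t ht').2)).trans_lt hL).ne_top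
    rw [← ENNReal.ofReal_toReal hfin, ← hm.intervalIntegral_norm hle]
    refine ENNReal.ofReal_le_ofReal ?_
    have := hdiff _ _ (hτ s hs').1 hle (hτ t ht').2
    rw [hτe s hs', hτe t ht'] at this
    have h2 : 0 ≤ (L - ℓ) * (τ t - τ s) := mul_nonneg (by linarith) (by linarith)
    linarith

/-- A path of length about `L` splits into `n` increments lying in a fixed compact neighbourhood
`K₀` of the identity, so its endpoint lies in the `n`-fold product of `K₀`, which is compact. -/
theorem exists_isCompact_ccDist_subset (L : ℝ) : ∃ K : Set G, IsCompact K ∧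
    ∀ h, S.ccDist 1 h ≤ ENNReal.ofReal L → h ∈ K := by
  have := LieGroup.isTopologicalGroup_real E G
  have : LocallyCompactSpace G := Manifold.locallyCompact_of_finiteDimensional 𝓘(ℝ, E)
  obtain ⟨K₀, hK₀, h1⟩ := exists_compact_mem_nhds (1 : G)
  obtain ⟨δ, hδ, H⟩ := S.exists_ccDist_lt_mem h1
  obtain ⟨n, hn⟩ := exists_nat_gt ((|L| + 1) / δ)
  have hn0 : (0 : ℝ) < n := lt_of_le_of_lt (by positivity) hn
  have hKc : ∀ k : ℕ, IsCompact (Nat.rec (motive := fun _ => Set G) {1}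
      (fun _ K => (fun x : G × G => x.1 * x.2) '' (K ×ˢ K₀)) k : Set G) := by
    intro k
    induction k with
    | zero => exact isCompact_singleton
    | succ k ih => exact (ih.prod hK₀).image continuous_mul
  refine ⟨_, hKc n, fun h hh => ?_⟩
  have hlt : S.ccDist 1 h < ENNReal.ofReal (|L| + 1) :=
    hh.trans_lt ((ENNReal.ofReal_lt_ofReal_iff (by positivity)).2
      (by linarith [le_abs_self L]))
  obtain ⟨c, h0, h1, hc⟩ := S.exists_lipschitz_param hlt
  have key : ∀ k : ℕ, k ≤ n → c (k / n) ∈ (Nat.rec (motive := fun _ => Set G) {1}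
      (fun _ K => (fun x : G × G => x.1 * x.2) '' (K ×ˢ K₀)) k : Set G) := by
    intro k
    induction k with
    | zero => intro; simp [h0]
    | succ k ih =>
      intro hk
      refine ⟨(c (k / n), (c (k / n))⁻¹ * c ((k + 1 : ℕ) / n)), ⟨ih (by omega), H _ ?_⟩, by simp⟩
      rw [← ccDist_eq_one_left]
      have hk' : ((k + 1 : ℕ) : ℝ) ≤ n := by exact_mod_cast hk
      refine (hc _ _ (by positivity) (by gcongr; omega) ((div_le_one hn0).2 hk')).trans_lt
        ((ENNReal.ofReal_lt_ofReal_iff hδ).2 ?_)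
      have : (|L| + 1) * (((k + 1 : ℕ) : ℝ) / n - k / n) = (|L| + 1) / n := by
        push_cast; field_simp; ring
      rw [this, div_lt_iff₀ hn0]
      rw [div_lt_iff₀ hδ] at hn
      linarith
  have := key n le_rfl
  rwa [div_self hn0.ne', h1] at this

/-- An Arzelà–Ascoli argument with ultrafilters: uniformly Lipschitz curves from `1` to the points
`q` converge pointwise along `U`, and the limit curve is shown to be horizontal of speed at most `L
+ ε`. -/
theorem isClosed_ccDist_le {L : ℝ} (hL : 0 ≤ L) : IsClosed {q | S.ccDist 1 q ≤ ENNReal.ofReal L} := by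
  have := LieGroup.isTopologicalGroup_real E G
  have := LieGroup.t2Space_real E G
  rw [isClosed_iff_ultrafilter]
  intro x U hU hball
  refine ENNReal.le_of_forall_pos_le_add fun ε hε _ => ?_
  rw [← ENNReal.ofReal_coe_nnreal]
  rw [← ENNReal.ofReal_add hL ε.coe_nonneg]
  set L' := L + ε with hL'
  have hL'0 : 0 < L' := by have : (0 : ℝ) < ε := hε; linarith
  have hex : ∀ q, S.ccDist 1 q ≤ ENNReal.ofReal L → ∃ c : ℝ → G, c 0 = 1 ∧ c 1 = q ∧
      ∀ s t, 0 ≤ s → s ≤ t → t ≤ 1 →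
        S.ccDist (c s) (c t) ≤ ENNReal.ofReal (L' * (t - s)) := fun q hq =>
    S.exists_lipschitz_param (hq.trans_lt ((ENNReal.ofReal_lt_ofReal_iff hL'0).2
      (by have : (0 : ℝ) < ε := hε; linarith)))
  choose! c hc0 hc1 hc using hex
  obtain ⟨K, hK, hKm⟩ := S.exists_isCompact_ccDist_subset L'
  have hlim : ∀ s, s ∈ Icc (0 : ℝ) 1 → ∃ y, Tendsto (fun q => c q s) U (𝓝 y) := by
    intro s hs
    obtain ⟨y, -, hy⟩ := hK.ultrafilter_le_nhds (U.map fun q => c q s) (by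
      rw [le_principal_iff, Ultrafilter.coe_map]
      refine mem_map.2 ?_
      filter_upwards [hball] with q hq
      have := hc q hq 0 s le_rfl hs.1 hs.2
      rw [hc0 q hq] at this
      refine hKm _ (this.trans (ENNReal.ofReal_le_ofReal ?_))
      nlinarith [hs.2])
    exact ⟨y, hy⟩
  choose! y hy using hlim
  have hy0 : y 0 = 1 := by
    refine tendsto_nhds_unique (hy 0 ⟨le_rfl, zero_le_one⟩) (tendsto_const_nhds.congr' ?_)
    filter_upwards [hball] with q hq using (hc0 q hq).symm
  have hy1 : y 1 = x := by
    refine tendsto_nhds_unique (hy 1 ⟨zero_le_one, le_rfl⟩)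
      ((tendsto_id'.2 hU).congr' ?_)
    filter_upwards [hball] with q hq using (hc1 q hq).symm
  have hnear : ∀ W ∈ 𝓝 (1 : G), ∃ δ > 0, ∀ s ∈ Icc (0 : ℝ) 1, ∀ t ∈ Icc (0 : ℝ) 1,
      s ≤ t → t - s < δ → (y s)⁻¹ * y t ∈ W := by
    intro W hW
    obtain ⟨W', hW', hcl, hsub⟩ := exists_mem_nhds_isClosed_subset hW
    obtain ⟨δ, hδ, H⟩ := S.exists_ccDist_lt_mem hW'
    refine ⟨δ / L', div_pos hδ hL'0, fun s hs t ht hst hlt => hsub ?_⟩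
    refine hcl.mem_of_tendsto ((hy s hs).inv.mul (hy t ht)) ?_
    filter_upwards [hball] with q hq
    refine H _ ?_
    rw [← ccDist_eq_one_left]
    refine (hc q hq s t hs.1 hst ht.2).trans_lt ((ENNReal.ofReal_lt_ofReal_iff hδ).2 ?_)
    rw [lt_div_iff₀ hL'0] at hlt
    linarith
  have htr : ∀ t ∈ Icc (0 : ℝ) 1, Tendsto (fun s => (y t)⁻¹ * y s) (𝓝[Icc 0 1] t) (𝓝 1) := by
    intro t ht
    rw [tendsto_def]
    intro W hW
    obtain ⟨δ, hδ, H⟩ := hnear (W ∩ W⁻¹) (inter_mem hW (inv_mem_nhds_one G hW))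
    filter_upwards [self_mem_nhdsWithin, mem_nhdsWithin_of_mem_nhds
      (Metric.ball_mem_nhds t hδ)] with s hs hst
    rw [Metric.mem_ball, Real.dist_eq, abs_lt] at hst
    rcases le_total s t with h | h
    · have := (H s hs t ht h (by linarith)).2
      simpa using this
    · exact (H t ht s hs h (by linarith)).1
  have hyc : ContinuousOn y (Icc 0 1) := by
    intro t ht
    have := (htr t ht).const_mul (y t)
    simpa [ContinuousWithinAt] using this
  -- Distance bounds for the limit curve are not yet available, as they would require the
  -- semicontinuity being proved. The chart estimates do pass to the limit, so the increment
  -- criterion is used instead.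
  obtain ⟨u, hu, hul⟩ := exists_isHorizontal_of_increment (S := S) (ordConnected_Icc) hyc
    (Θ := fun s => L' * s) (ρ := fun _ => L')
    (fun a b _ _ => 
      (contDiff_const.mul contDiff_id).contDiffOn.absolutelyContinuousOnInterval)
    (Eventually.of_forall fun t => by simpa using (hasDerivAt_id t).const_mul L') (by
      intro t ht p hp ε' hε'
      obtain ⟨O, hO, δ, hδ, H⟩ := S.exists_chart_estimate p hp hε'
      obtain ⟨O', hO', hO's⟩ := mem_nhdsWithin_iff_exists_mem_nhds_inter.1
        (htr t ht (inter_mem (interior_mem_nhds.2 hO) 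
          (interior_mem_nhds.2 (chartAt_one_source_mem_nhds (E := E)))))
      refine ⟨O' ∩ Metric.ball t (δ / L' / 2), inter_mem hO' (Metric.ball_mem_nhds t (by positivity)),
        fun s hs s' hs' hss => ?_⟩
      have hsO := hO's ⟨hs.2.1, hs.1⟩
      have hsO' := hO's ⟨hs'.2.1, hs'.1⟩
      have hd : L' * (s' - s) < δ := by
        have e1 := hs.2.2
        have e2 := hs'.2.2
        rw [Metric.mem_ball, Real.dist_eq, abs_lt] at e1 e2
        rw [← lt_div_iff₀' hL'0]
        linarith
      have hcs : ∀ r ∈ Icc (0 : ℝ) 1, (y t)⁻¹ * y r ∈ interior (chartAt E (1 : G)).source →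
          Tendsto (fun q => chartAt E (1 : G) ((y t)⁻¹ * c q r)) U
            (𝓝 (chartAt E (1 : G) ((y t)⁻¹ * y r))) := fun r hr hm =>
        ((chartAt E (1 : G)).continuousAt (interior_subset hm)).tendsto.comp ((hy r hr).const_mul _)
      have hlim := (p.continuous_of_finiteDimensional_real.tendsto _).comp
        ((hcs s' hs'.1 hsO'.2).sub (hcs s hs.1 hsO.2))
      have hgoal := le_of_tendsto hlim (b := (1 + ε') * (L' * (s' - s))) (by
        filter_upwards [hball, ((hy s hs.1).const_mul (y t)⁻¹).eventually_mem
          (isOpen_interior.mem_nhds hsO.1)] with q hq hqs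
        refine (H _ (interior_subset hqs) _ _ (mul_nonneg hL'0.le (sub_nonneg.2 hss)) hd ?_).2
        rw [ccDist_mul_left]
        exact hc q hq s s' hs.1.1 hss hs'.1.2)
      rwa [mul_sub] at hgoal)
  have := hu.ccDist_le zero_le_one
  rw [hy0, hy1] at this
  refine this.trans ?_
  calc ∫⁻ t in Icc (0 : ℝ) 1, ENNReal.ofReal (S.norm (u t))
      ≤ ∫⁻ t in Icc (0 : ℝ) 1, ENNReal.ofReal L' :=
        lintegral_mono_ae (hul.mono fun t ht => ENNReal.ofReal_le_ofReal ht)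
    _ = ENNReal.ofReal L' := by simp

theorem isCompact_ccDist_le {L : ℝ} (hL : 0 ≤ L) : IsCompact {q | S.ccDist 1 q ≤ ENNReal.ofReal L} := by
  obtain ⟨K, hK, hKm⟩ := S.exists_isCompact_ccDist_subset L
  exact hK.of_isClosed_subset (S.isClosed_ccDist_le hL) hKm

theorem isClosed_setOf_ccDist_le {r : ℝ} (hr : 0 ≤ r) :
    IsClosed {x : G × G | S.ccDist x.1 x.2 ≤ ENNReal.ofReal r} := by
  have := LieGroup.isTopologicalGroup_real E G
  have h : Continuous fun x : G × G => x.1⁻¹ * x.2 := by fun_prop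
  have h2 : {x : G × G | S.ccDist x.1 x.2 ≤ ENNReal.ofReal r} =
      (fun x : G × G => x.1⁻¹ * x.2) ⁻¹' {q | S.ccDist 1 q ≤ ENNReal.ofReal r} := by
    ext x
    simp [S.ccDist_eq_one_left x.1 x.2]
  rw [h2]
  exact (S.isClosed_ccDist_le hr).preimage h

end SubFinslerStructure

/-! ### Lie group homomorphisms at the identity. -/

section Homomorphism

variable {E : Type*} [NormedAddCommGroup E] [NormedSpace ℝ E]
  {G : Type*} [TopologicalSpace G] [ChartedSpace E G] [Group G] [LieGroup 𝓘(ℝ, E) ∞ G]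
  {F : Type*} [NormedAddCommGroup F] [NormedSpace ℝ F]
  {H : Type*} [TopologicalSpace H] [ChartedSpace F H] [Group H] [LieGroup 𝓘(ℝ, F) ∞ H]
  (π : ContMDiffMonoidMorphism 𝓘(ℝ, E) 𝓘(ℝ, F) ∞ G H)

/-- A Lie group homomorphism in the charts at the identities. -/
noncomputable def chartHom (y : E) : F := chartAt F (1 : H) (π ((chartAt E (1 : G)).symm y))

/-- The differential of a Lie group homomorphism as a continuous map of model spaces. -/
noncomputable def modelDifferential : E →L[ℝ] F :=
  (mfderiv 𝓘(ℝ, E) 𝓘(ℝ, F) π (1 : G) : E →L[ℝ] F)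

omit [LieGroup 𝓘(ℝ, E) ∞ G] [LieGroup 𝓘(ℝ, F) ∞ H] in
theorem hasMFDerivAt_hom_of_eq_one {g : G} (hg : g = 1) :
    HasMFDerivAt 𝓘(ℝ, E) 𝓘(ℝ, F) π g (modelDifferential π : E →L[ℝ] F) := by
  subst hg
  exact (π.contMDiff_toFun.mdifferentiable (by simp) (1 : G)).hasMFDerivAt

theorem hasFDerivAt_chartHom :
    HasFDerivAt (chartHom π) (modelDifferential π) (chartAt E (1 : G) 1) := by
  have hs1 := (chartAt E (1 : G)).left_inv (mem_chart_source E (1 : G))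
  have h1 := hasMFDerivAt_chartAt_symm_of_eq (x := (1 : G)) (y := chartAt E (1 : G) 1) rfl
  have h2 := hasMFDerivAt_hom_of_eq_one π hs1
  have h3 := hasMFDerivAt_chartAt_of_eq (E := F)
    (g := π ((chartAt E (1 : G)).symm (chartAt E (1 : G) 1))) (x := (1 : H))
    (by rw [hs1]; exact map_one π)
  have h4 := h3.comp (chartAt E (1 : G) 1) (h2.comp (chartAt E (1 : G) 1) h1)
  exact hasMFDerivAt_iff_hasFDerivAt.1 h4

omit [LieGroup 𝓘(ℝ, E) ∞ G] [LieGroup 𝓘(ℝ, F) ∞ H] in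
theorem chartHom_one : chartHom π (chartAt E (1 : G) 1) = chartAt F (1 : H) 1 := by
  rw [chartHom, (chartAt E (1 : G)).left_inv (mem_chart_source E (1 : G)), map_one]

theorem HasDerivWithinAt.hom_comp {γ : ℝ → G} {I : Set ℝ} {t : ℝ} {v : E}
    (hc : ContinuousWithinAt γ I t)
    (h : HasDerivWithinAt (fun s => chartAt E (1 : G) ((γ t)⁻¹ * γ s)) v I t) :
    HasDerivWithinAt (fun s => chartAt F (1 : H) ((π (γ t))⁻¹ * π (γ s)))
      (modelDifferential π v) I t := by
  have := LieGroup.isTopologicalGroup_real E G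
  have h0 : (γ t)⁻¹ * γ t = 1 := inv_mul_cancel _
  have hev : ∀ᶠ s in 𝓝[I] t, (γ t)⁻¹ * γ s ∈ (chartAt E (1 : G)).source := by
    have : ContinuousWithinAt (fun s => (γ t)⁻¹ * γ s) I t := continuousWithinAt_const.mul hc
    refine this (?_ : _ ∈ 𝓝 ((γ t)⁻¹ * γ t))
    rw [h0]
    exact chartAt_one_source_mem_nhds
  have h3 := HasFDerivAt.comp_hasDerivWithinAt_of_eq t (hasFDerivAt_chartHom π) h (by rw [h0])
  refine h3.congr_of_eventuallyEq ?_ ?_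
  · filter_upwards [hev] with s hs
    simp [chartHom, (chartAt E (1 : G)).left_inv hs]
  · simp [chartHom, (chartAt E (1 : G)).left_inv (mem_chart_source E (1 : G))]

theorem hasMFDerivAt_conj_of_eq_one (g : G) {h : G} (hh : h = 1) :
    HasMFDerivAt 𝓘(ℝ, E) 𝓘(ℝ, E) (fun h : G => g * h * g⁻¹) h
      (mfderiv 𝓘(ℝ, E) 𝓘(ℝ, E) (fun h : G => g * h * g⁻¹) 1 : E →L[ℝ] E) := by
  subst hh
  have : ContMDiff 𝓘(ℝ, E) 𝓘(ℝ, E) ∞ (fun h : G => g * h * g⁻¹) :=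
    (contMDiff_const.mul contMDiff_id).mul contMDiff_const
  exact (this.mdifferentiable (by simp) (1 : G)).hasMFDerivAt

/-- Differentiate at `1` the identity between `π` after conjugation by `g` and conjugation by `π g`
after `π`. -/
theorem lieDifferential_lieAd (g : G) (v : GroupLieAlgebra 𝓘(ℝ, E) G) :
    lieDifferential π (lieAd g v) = lieAd (π g) (lieDifferential π v) := by
  have h1 := (hasMFDerivAt_hom_of_eq_one π (g := g * 1 * g⁻¹) (by simp)).comp (1 : G)
    (hasMFDerivAt_conj_of_eq_one (E := E) g rfl)
  have h2 := (hasMFDerivAt_conj_of_eq_one (E := F) (π g) (h := π 1) (map_one π)).comp (1 : G)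
    (hasMFDerivAt_hom_of_eq_one π rfl)
  have h3 : (fun h : H => π g * h * (π g)⁻¹) ∘ π = π ∘ fun h : G => g * h * g⁻¹ := by
    ext h
    simp
  rw [h3] at h2
  have h4 := hasMFDerivAt_unique h1 h2
  exact congrArg (fun L : E →L[ℝ] F => L v) h4

end Homomorphism

/-! ### Surjectivity of the differential. -/

section Surjective

variable {E : Type*} [NormedAddCommGroup E] [NormedSpace ℝ E] [FiniteDimensional ℝ E]
  {G : Type*} [TopologicalSpace G] [ChartedSpace E G] [Group G] [LieGroup 𝓘(ℝ, E) ∞ G]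
  {F : Type*} [NormedAddCommGroup F] [NormedSpace ℝ F] [FiniteDimensional ℝ F]
  {H : Type*} [TopologicalSpace H] [ChartedSpace F H] [Group H] [LieGroup 𝓘(ℝ, F) ∞ H]
  (π : ContMDiffMonoidMorphism 𝓘(ℝ, E) 𝓘(ℝ, F) ∞ G H)

/-- Second countability makes the locally compact group `G` σ-compact, and the open mapping theorem
for groups applies. Without it the identity from discrete `ℝ` to `ℝ` is a counterexample. -/
theorem isOpenMap_hom [SecondCountableTopology G] (hπ : Function.Surjective π) : IsOpenMap π := by
  have := LieGroup.isTopologicalGroup_real E G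
  have := LieGroup.isTopologicalGroup_real F H
  have := LieGroup.t2Space_real F H
  have : LocallyCompactSpace G := Manifold.locallyCompact_of_finiteDimensional 𝓘(ℝ, E)
  have : LocallyCompactSpace H := Manifold.locallyCompact_of_finiteDimensional 𝓘(ℝ, F)
  exact MonoidHom.isOpenMap_of_sigmaCompact (G := G) (H := H) π.toMonoidHom hπ
    π.contMDiff_toFun.continuous

omit [FiniteDimensional ℝ F] in
/-- The kernel of the differential is tangent to the kernel. -/
theorem exists_curve_ker {v : E} (hv : modelDifferential π v = 0) : ∃ c : ℝ → G, c 0 = 1 ∧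
    ContinuousAt c 0 ∧ HasDerivAt (fun s => chartAt E (1 : G) (c s)) v 0 ∧
    ∀ᶠ t in 𝓝 (0 : ℝ), π (c t) = 1 := by
  have := LieGroup.isTopologicalGroup_real F H
  have := LieGroup.t2Space_real F H
  obtain ⟨c, h0, hc⟩ := exists_leftInvariant_integralCurve G v
  have h1 := hc.self_of_nhds
  refine ⟨c, h0, h1.1, by simpa [h0] using h1.2, ?_⟩
  have hπc : ContinuousAt (fun t => π (c t)) 0 :=
    (π.contMDiff_toFun.continuous.continuousAt).comp h1.1
  have hs : ∀ᶠ t in 𝓝 (0 : ℝ), π (c t) ∈ (chartAt F (1 : H)).source := by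
    refine hπc (?_ : _ ∈ 𝓝 (π (c 0)))
    rw [h0, map_one]
    exact chartAt_one_source_mem_nhds
  obtain ⟨r, hr, hball⟩ := Metric.eventually_nhds_iff_ball.1 (hc.and hs)
  have hd : ∀ t ∈ Metric.ball (0 : ℝ) r,
      HasDerivAt (fun s => chartAt F (1 : H) (π (c s))) 0 t := by
    intro t ht
    obtain ⟨⟨e1, e2⟩, e3⟩ := hball t ht
    have e4 := HasDerivWithinAt.hom_comp (I := univ) π e1.continuousWithinAt e2.hasDerivWithinAt
    have e5 : ContinuousAt (fun t => π (c t)) t :=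
      (π.contMDiff_toFun.continuous.continuousAt).comp e1
    have e6 := HasDerivWithinAt.chartAt_one_comp (γ := fun t => π (c t)) (I := univ)
      e5.continuousWithinAt e4 e3
    rw [hv, map_zero] at e6
    exact hasDerivWithinAt_univ.1 e6
  filter_upwards [Metric.ball_mem_nhds (0 : ℝ) hr] with t ht
  have hconst : chartAt F (1 : H) (π (c t)) = chartAt F (1 : H) (π (c 0)) :=
    (convex_ball (0 : ℝ) r).is_const_of_fderivWithin_eq_zero (𝕜 := ℝ)
      (f := fun s => chartAt F (1 : H) (π (c s)))
      (fun s hs => (hd s hs).differentiableAt.differentiableWithinAt)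
      (fun s hs => by
        rw [fderivWithin_of_isOpen Metric.isOpen_ball hs]
        ext
        simpa using (hd s hs).deriv) ht (Metric.mem_ball_self hr)
  have := (chartAt F (1 : H)).injOn (hball t ht).2 (hball 0 (Metric.mem_ball_self hr)).2 hconst
  rw [this, h0, map_one]

variable (E G) in
omit [FiniteDimensional ℝ E] in
theorem hasFDerivAt_chartAt_mul :
    HasFDerivAt (fun z : E × E => chartAt E (1 : G)
      ((chartAt E (1 : G)).symm z.1 * (chartAt E (1 : G)).symm z.2))
      (ContinuousLinearMap.fst ℝ E E + ContinuousLinearMap.snd ℝ E E)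
      (chartAt E (1 : G) 1, chartAt E (1 : G) 1) := by
  have hs1 := (chartAt E (1 : G)).left_inv (mem_chart_source E (1 : G))
  have h1 := ((contDiffAt_chartAt_mul (mem_chart_target E (1 : G)) (mem_chart_target E (1 : G))
    (by rw [hs1, mul_one]; exact mem_chart_source E 1)).differentiableAt (by simp)).hasFDerivAt
  refine h1.congr_fderiv ?_
  have h2 := h1.comp (chartAt E (1 : G) 1)
    (hasFDerivAt_prodMk_right (chartAt E (1 : G) 1) (chartAt E (1 : G) 1))
  have h3 := h1.comp (chartAt E (1 : G) 1)
    (f := fun e => (e, chartAt E (1 : G) 1))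
    (hasFDerivAt_prodMk_left (chartAt E (1 : G) 1) (chartAt E (1 : G) 1))
  have h4 := h2.unique ((hasFDerivAt_id (𝕜 := ℝ) _).congr_of_eventuallyEq (by
    filter_upwards [chartAt_one_target_mem_nhds (E := E) (G := G)] with y hy
    simp [hs1, hy]))
  have h5 := h3.unique ((hasFDerivAt_id (𝕜 := ℝ) _).congr_of_eventuallyEq (by
    filter_upwards [chartAt_one_target_mem_nhds (E := E) (G := G)] with y hy
    simp [hs1, hy]))
  refine ContinuousLinearMap.ext fun z => ?_
  have h6 := congrArg (fun L : E →L[ℝ] E => L z.2) h4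
  have h7 := congrArg (fun L : E →L[ℝ] E => L z.1) h5
  simp only [ContinuousLinearMap.comp_apply, ContinuousLinearMap.inr_apply,
    ContinuousLinearMap.inl_apply, ContinuousLinearMap.id_apply] at h6 h7
  have h8 : z = (z.1, 0) + (0, z.2) := by simp
  rw [h8, map_add, h6, h7]
  simp

/-- Openness alone suffices. Lift a curve `h` with velocity `w` to points `g t` nearly as close to
`1` as possible, and rescale by `σ t`, the larger of the displacement and `t`. In the limit `dπ v =
τ w`. If `τ ≠ 0`, then `w` is in the range. If `τ = 0`, then `v` is a unit vector tangent to the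
kernel, and correcting `g t` by a kernel element close to `-σ t • v` gives a lift much nearer to
`1`, against the choice of `g t`. -/
theorem modelDifferential_surjective [SecondCountableTopology G] (hπ : Function.Surjective π) :
    Function.Surjective (modelDifferential π) := by
  have := LieGroup.isTopologicalGroup_real E G
  have hs1 := (chartAt E (1 : G)).left_inv (mem_chart_source E (1 : G))
  have hopen := isOpenMap_hom π hπ
  intro w
  set x₀ := chartAt E (1 : G) 1 with hx₀
  set y₀ := chartAt F (1 : H) 1 with hy₀
  set h : ℝ → H := fun t => (chartAt F (1 : H)).symm (y₀ + t • w) with hh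
  have hline : Tendsto (fun t : ℝ => y₀ + t • w) (𝓝[>] 0) (𝓝 y₀) := by
    have : Continuous fun t : ℝ => y₀ + t • w := by fun_prop
    have := (this.tendsto 0).mono_left (nhdsWithin_le_nhds (s := Ioi 0))
    simpa using this
  have hht : ∀ᶠ t in 𝓝[>] (0 : ℝ), chartAt F (1 : H) (h t) = y₀ + t • w := by
    filter_upwards [hline.eventually_mem (chartAt_one_target_mem_nhds (G := H))] with t ht
    exact (chartAt F (1 : H)).right_inv ht
  have hh1 : Tendsto h (𝓝[>] 0) (𝓝 1) := by
    have := ((chartAt F (1 : H)).continuousAt_symm (mem_chart_target F (1 : H))).tendsto.comp hline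
    rwa [(chartAt F (1 : H)).left_inv (mem_chart_source F (1 : H))] at this
  -- The infimum over the fibre need not be attained, so a defect `t` is allowed; it is harmless,
  -- being negligible against `σ t` in the case `τ = 0`.
  have hex : ∀ t : ℝ, 0 < t → (∃ g ∈ (chartAt E (1 : G)).source, π g = h t) →
      ∃ g ∈ (chartAt E (1 : G)).source, π g = h t ∧ ∀ g' ∈ (chartAt E (1 : G)).source,
        π g' = h t → ‖chartAt E (1 : G) g - x₀‖ ≤ ‖chartAt E (1 : G) g' - x₀‖ + t := by
    rintro t ht ⟨g₀, hg₀, hg₀'⟩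
    set A := {ρ : ℝ | ∃ g ∈ (chartAt E (1 : G)).source, π g = h t ∧
      ‖chartAt E (1 : G) g - x₀‖ = ρ} with hA
    have hne : A.Nonempty := ⟨_, g₀, hg₀, hg₀', rfl⟩
    have hbdd : BddBelow A := ⟨0, by rintro _ ⟨g, -, -, rfl⟩; positivity⟩
    obtain ⟨_, ⟨g, hg, hg', rfl⟩, hlt⟩ := exists_lt_of_csInf_lt hne (lt_add_of_pos_right (sInf A) ht)
    refine ⟨g, hg, hg', fun g' h1 h2 => hlt.le.trans ?_⟩
    have := csInf_le hbdd ⟨g', h1, h2, rfl⟩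
    linarith
  have hlift : ∀ U ∈ 𝓝 (1 : G), ∀ᶠ t in 𝓝[>] (0 : ℝ), ∃ g ∈ U, π g = h t := by
    intro U hU
    have := hopen.image_mem_nhds hU
    rw [map_one] at this
    exact hh1.eventually_mem this
  choose! g hgs hgh hgmin using hex
  have hgood : ∀ᶠ t in 𝓝[>] (0 : ℝ), 0 < t ∧ ∃ g ∈ (chartAt E (1 : G)).source, π g = h t :=
    (eventually_mem_nhdsWithin (s := Ioi (0 : ℝ))).and (hlift _ (chartAt_one_source_mem_nhds (E := E)))
  have hρ : Tendsto (fun t => ‖chartAt E (1 : G) (g t) - x₀‖) (𝓝[>] 0) (𝓝 0) := by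
    rw [Metric.tendsto_nhds]
    intro ε hε
    have hU : {k : G | k ∈ (chartAt E (1 : G)).source ∧ ‖chartAt E (1 : G) k - x₀‖ < ε / 2} ∈
        𝓝 (1 : G) := by
      refine inter_mem chartAt_one_source_mem_nhds ?_
      have := ((chartAt E (1 : G)).continuousAt (mem_chart_source E (1 : G))).eventually_mem
        (Metric.ball_mem_nhds _ (half_pos hε))
      filter_upwards [this] with k hk
      rwa [Metric.mem_ball, dist_eq_norm] at hk
    filter_upwards [hgood, hlift _ hU, mem_nhdsWithin_of_mem_nhds (Iio_mem_nhds (half_pos hε))]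
      with t ht ⟨k, ⟨hk1, hk2⟩, hk3⟩ hte
    have := hgmin t ht.1 ht.2 k hk1 hk3
    simp only [dist_zero_right, norm_norm]
    have hte' : t < ε / 2 := hte
    linarith
  set σ : ℝ → ℝ := fun t => max ‖chartAt E (1 : G) (g t) - x₀‖ t with hσ
  have hσ0 : Tendsto σ (𝓝[>] 0) (𝓝 0) := by
    have := hρ.max (tendsto_nhdsWithin_of_tendsto_nhds (s := Ioi (0 : ℝ)) (tendsto_id (x := 𝓝 (0:ℝ))))
    simpa using this
  have hσpos : ∀ᶠ t in 𝓝[>] (0 : ℝ), 0 < σ t := by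
    filter_upwards [self_mem_nhdsWithin] with t ht using lt_max_of_lt_right ht
  set U : Ultrafilter ℝ := Ultrafilter.of (𝓝[>] (0 : ℝ)) with hU
  have hUle : (U : Filter ℝ) ≤ 𝓝[>] 0 := Ultrafilter.of_le _
  obtain ⟨v, -, hv⟩ := (isCompact_closedBall (0 : E) 1).ultrafilter_le_nhds
    (U.map fun t => (σ t)⁻¹ • (chartAt E (1 : G) (g t) - x₀)) (by
      rw [le_principal_iff, Ultrafilter.coe_map]
      refine mem_map.2 ?_
      filter_upwards [hUle hσpos] with t ht
      change _ ∈ Metric.closedBall _ _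
      rw [mem_closedBall_zero_iff, norm_smul, norm_inv, Real.norm_of_nonneg ht.le,
        inv_mul_le_iff₀ ht, mul_one]
      exact le_max_left _ _)
  obtain ⟨τ, -, hτ⟩ := (isCompact_Icc (a := (0 : ℝ)) (b := 1)).ultrafilter_le_nhds
    (U.map fun t => (σ t)⁻¹ * t) (by
      rw [le_principal_iff, Ultrafilter.coe_map]
      refine mem_map.2 ?_
      filter_upwards [hUle hσpos, hUle self_mem_nhdsWithin] with t ht ht0
      have ht0' : 0 < t := ht0
      refine ⟨by positivity, ?_⟩
      rw [inv_mul_le_iff₀ ht, mul_one]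
      exact le_max_right _ _)
  change Tendsto (fun t => (σ t)⁻¹ • (chartAt E (1 : G) (g t) - x₀)) U (𝓝 v) at hv
  change Tendsto (fun t => (σ t)⁻¹ * t) U (𝓝 τ) at hτ
  have hd0 : Tendsto (fun t => chartAt E (1 : G) (g t) - x₀) U (𝓝 0) :=
    (tendsto_zero_iff_norm_tendsto_zero.2 hρ).mono_left hUle
  have h1 := (hasFDerivWithinAt_univ.2 (hasFDerivAt_chartHom π)).lim hd0
    (Eventually.of_forall fun _ => mem_univ _) hv
  have h2 : Tendsto (fun t => ((σ t)⁻¹ * t) • w) U (𝓝 (modelDifferential π v)) := by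
    refine h1.congr' ?_
    filter_upwards [hUle hgood, hUle hht] with t ht ht'
    rw [← hx₀, add_sub_cancel, chartHom_one, chartHom, (chartAt E (1 : G)).left_inv
      (hgs t ht.1 ht.2), hgh t ht.1 ht.2, ht', ← hy₀, add_sub_cancel_left, smul_smul]
  have h3 : modelDifferential π v = τ • w := tendsto_nhds_unique h2 (hτ.smul_const w)
  by_cases hτ0 : τ = 0
  swap
  · exact ⟨τ⁻¹ • v, by rw [map_smul, h3, smul_smul, inv_mul_cancel₀ hτ0, one_smul]⟩
  exfalso
  subst hτ0
  rw [zero_smul] at h3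
  obtain ⟨k, hk0, hkc, hkd, hkπ⟩ := exists_curve_ker π h3
  have hσU : Tendsto (fun t => -σ t) U (𝓝 0) := by simpa using (hσ0.mono_left hUle).neg
  have h4 : Tendsto (fun t => (σ t)⁻¹ • (chartAt E (1 : G) (k (-σ t)) - x₀)) U (𝓝 (-v)) := by
    have := (hasFDerivWithinAt_univ.2 hkd.hasFDerivAt).lim (l := U) (c := fun t => (σ t)⁻¹)
      (d := fun t => -σ t) (v := -1) hσU (Eventually.of_forall fun _ => mem_univ _)
      (tendsto_const_nhds.congr' (by
        filter_upwards [hUle hσpos] with t ht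
        rw [smul_eq_mul, mul_neg, inv_mul_cancel₀ ht.ne']))
    simpa [hk0] using this
  have hk1 : Tendsto (fun t => k (-σ t)) U (𝓝 1) := by
    have := hkc.tendsto.comp hσU
    rwa [hk0] at this
  have hg1 : Tendsto g U (𝓝 1) := by
    have h5 : Tendsto (fun t => chartAt E (1 : G) (g t)) U (𝓝 x₀) := by
      simpa using hd0.add_const x₀
    have h6 := ((chartAt E (1 : G)).continuousAt_symm (mem_chart_target E (1 : G))).tendsto.comp h5
    rw [hs1] at h6
    refine h6.congr' ?_
    filter_upwards [hUle hgood] with t ht using (chartAt E (1 : G)).left_inv (hgs t ht.1 ht.2)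
  have hgk : Tendsto (fun t => g t * k (-σ t)) U (𝓝 1) := by simpa using hg1.mul hk1
  have hd1 : Tendsto (fun t => chartAt E (1 : G) (k (-σ t)) - x₀) U (𝓝 0) := by
    have := ((chartAt E (1 : G)).continuousAt (mem_chart_source E (1 : G))).tendsto.comp hk1
    have := this.sub_const x₀
    rwa [← hx₀, sub_self] at this
  have h7 := (hasFDerivWithinAt_univ.2 (hasFDerivAt_chartAt_mul E G)).lim
    (l := U) (c := fun t => (σ t)⁻¹) (d := fun t => (chartAt E (1 : G) (g t) - x₀,
      chartAt E (1 : G) (k (-σ t)) - x₀)) (v := (v, -v)) (by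
      rw [← Prod.mk_zero_zero]
      exact hd0.prodMk_nhds hd1)
    (Eventually.of_forall fun _ => mem_univ _) (hv.prodMk_nhds h4)
  -- To first order multiplication is addition in the chart, so the rescaled displacement of the
  -- corrected lift tends to `v + (-v) = 0`.
  have h8 : Tendsto (fun t => (σ t)⁻¹ • (chartAt E (1 : G) (g t * k (-σ t)) - x₀)) U (𝓝 0) := by
    have e : (ContinuousLinearMap.fst ℝ E E + ContinuousLinearMap.snd ℝ E E) (v, -v) = 0 := by simp
    rw [e] at h7
    refine h7.congr' ?_
    filter_upwards [hUle hgood, hk1.eventually_mem (chartAt_one_source_mem_nhds (E := E))]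
      with t ht htk
    simp only [← hx₀, Prod.mk_add_mk, add_sub_cancel]
    rw [(chartAt E (1 : G)).left_inv (hgs t ht.1 ht.2), (chartAt E (1 : G)).left_inv htk, hs1,
      mul_one]
  have h9 : Tendsto (fun t => (σ t)⁻¹ * ‖chartAt E (1 : G) (g t) - x₀‖) U (𝓝 ‖v‖) := by
    refine hv.norm.congr' ?_
    filter_upwards [hUle hσpos] with t ht
    rw [norm_smul, norm_inv, Real.norm_of_nonneg ht.le]
  have h10 : ‖v‖ ≤ 0 := by
    have h8' := h8.norm.add hτ
    rw [norm_zero, add_zero] at h8'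
    refine le_of_tendsto_of_tendsto h9 h8' ?_
    filter_upwards [hUle hgood, hUle hσpos, hσU.eventually hkπ,
      hgk.eventually_mem (chartAt_one_source_mem_nhds (E := E))] with t ht hσt hkt hst
    rw [norm_smul, norm_inv, Real.norm_of_nonneg hσt.le, ← mul_add]
    refine mul_le_mul_of_nonneg_left (hgmin t ht.1 ht.2 _ hst ?_) (by positivity)
    rw [map_mul, hkt, mul_one, hgh t ht.1 ht.2]
  -- By the choice of `σ` the larger of the two rescaled quantities is always `1`, which is
  -- incompatible with `v = 0` and `τ = 0`.
  have h11 : Tendsto (fun _ : ℝ => (1 : ℝ)) U (𝓝 (max ‖v‖ 0)) := by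
    refine (h9.max hτ).congr' ?_
    filter_upwards [hUle hσpos] with t ht
    rw [← mul_max_of_nonneg _ _ (by positivity)]
    exact inv_mul_cancel₀ ht.ne'
  have := tendsto_nhds_unique h11 tendsto_const_nhds
  rw [max_eq_right h10] at this
  exact zero_ne_one this

end Surjective

/-! ### The differential preserves brackets. -/

section LieBracket

variable {E : Type*} [NormedAddCommGroup E] [NormedSpace ℝ E] [FiniteDimensional ℝ E]
  {G : Type*} [TopologicalSpace G] [ChartedSpace E G] [Group G] [LieGroup 𝓘(ℝ, E) ∞ G]
  {F : Type*} [NormedAddCommGroup F] [NormedSpace ℝ F] [FiniteDimensional ℝ F]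
  {H : Type*} [TopologicalSpace H] [ChartedSpace F H] [Group H] [LieGroup 𝓘(ℝ, F) ∞ H]
  (π : ContMDiffMonoidMorphism 𝓘(ℝ, E) 𝓘(ℝ, F) ∞ G H)

omit [FiniteDimensional ℝ E] in
theorem differentiableAt_leftFrame :
    DifferentiableAt ℝ (leftFrame E G) (chartAt E (1 : G) 1) := by
  have hs1 := (chartAt E (1 : G)).left_inv (mem_chart_source E (1 : G))
  have h1 := contDiffAt_chartAt_mul (mem_chart_target E (1 : G)) (mem_chart_target E (1 : G))
    (by rw [hs1, mul_one]; exact mem_chart_source E 1)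
  have h2 : ContDiffAt ℝ 1 (leftFrame E G) (chartAt E (1 : G) 1) :=
    ContDiffAt.fderiv (m := 1) (n := ∞) (f := fun x y => chartAt E (1 : G)
      ((chartAt E (1 : G)).symm x * (chartAt E (1 : G)).symm y)) h1 contDiffAt_const
      (by rw [one_add_one_eq_two]; exact ENat.LEInfty.out)
  exact h2.differentiableAt (by simp)

/-- The left-invariant vector fields in the chart at the identity. -/
theorem mpullbackWithin_mulInvariantVectorField (v : GroupLieAlgebra 𝓘(ℝ, E) G) {x : E}
    (hx : x ∈ (chartAt E (1 : G)).target) :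
    VectorField.mpullbackWithin 𝓘(ℝ, E) 𝓘(ℝ, E) (extChartAt 𝓘(ℝ, E) (1 : G)).symm
      (mulInvariantVectorField (I := 𝓘(ℝ, E)) v) (range 𝓘(ℝ, E)) x =
    (leftFrame E G x (v : E) : E) := by
  have hs1 := (chartAt E (1 : G)).left_inv (mem_chart_source E (1 : G))
  set g := (chartAt E (1 : G)).symm x with hg
  have hgs : g ∈ (chartAt E (1 : G)).source := (chartAt E (1 : G)).map_target hx
  have hA := ((contMDiffAt_chartAt (E := E) 1 hgs).mdifferentiableAt (by simp)).hasMFDerivAt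
  have hB := ((contMDiffAt_chartAt_symm (E := E) (1 : G) hx).mdifferentiableAt
    (by simp)).hasMFDerivAt
  set A : E →L[ℝ] E := mfderiv 𝓘(ℝ, E) 𝓘(ℝ, E) (chartAt E (1 : G)) g with hAd
  set B : E →L[ℝ] E := mfderiv 𝓘(ℝ, E) 𝓘(ℝ, E) (chartAt E (1 : G)).symm x with hBd
  have hAB : A ∘L B = ContinuousLinearMap.id ℝ E := by
    have h1 : HasFDerivAt (chartAt E (1 : G) ∘ (chartAt E (1 : G)).symm) (A ∘L B) x :=
      hasMFDerivAt_iff_hasFDerivAt.1 (hA.comp x hB)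
    refine h1.unique ((hasFDerivAt_id (𝕜 := ℝ) _).congr_of_eventuallyEq ?_)
    filter_upwards [(chartAt E (1 : G)).open_target.mem_nhds hx] with y hy
    simp [hy]
  -- In finite dimension a one-sided inverse is two-sided.
  have hBA : B ∘L A = ContinuousLinearMap.id ℝ E := by
    have h1 : (A : E →ₗ[ℝ] E) * (B : E →ₗ[ℝ] E) = 1 :=
      LinearMap.ext fun z => congrArg (fun L : E →L[ℝ] E => L z) hAB
    have h2 := mul_eq_one_comm.1 h1
    exact ContinuousLinearMap.ext fun z => congrArg (fun L : E →ₗ[ℝ] E => L z) h2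
  have hinv : B.inverse = A := ContinuousLinearMap.inverse_eq hBA hAB
  have hm := hasMFDerivAt_mul_left_of_eq_one (E := E) g hs1
  have hsy := hasMFDerivAt_chartAt_symm_of_eq (x := (1 : G)) (y := chartAt E (1 : G) 1) rfl
  have hA' : HasMFDerivAt 𝓘(ℝ, E) 𝓘(ℝ, E) (chartAt E (1 : G))
      (g * (chartAt E (1 : G)).symm (chartAt E (1 : G) 1)) A := by
    have e : g * (chartAt E (1 : G)).symm (chartAt E (1 : G) 1) = g := by rw [hs1, mul_one]
    rw [e]
    exact hA
  set M : E →L[ℝ] E := mfderiv 𝓘(ℝ, E) 𝓘(ℝ, E) (fun h : G => g * h) 1 with hM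
  have h2 : HasFDerivAt (fun y => chartAt E (1 : G) (g * (chartAt E (1 : G)).symm y))
      (A ∘L (M ∘L ContinuousLinearMap.id ℝ E)) (chartAt E (1 : G) 1) :=
    hasMFDerivAt_iff_hasFDerivAt.1
      (hA'.comp (chartAt E (1 : G) 1) (hm.comp (chartAt E (1 : G) 1) hsy))
  have h3 : leftFrame E G x = A ∘L (M ∘L ContinuousLinearMap.id ℝ E) := h2.fderiv
  rw [h3, VectorField.mpullbackWithin_apply]
  have h4 : mfderivWithin 𝓘(ℝ, E) 𝓘(ℝ, E) (extChartAt 𝓘(ℝ, E) (1 : G)).symm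
      (range 𝓘(ℝ, E)) x = B := by
    simp only [modelWithCornersSelf_coe, range_id, mfderivWithin_univ]
    rfl
  rw [h4]
  change B.inverse _ = _
  rw [hinv]
  rfl

theorem lieBracket_groupLieAlgebra_eq (v w : GroupLieAlgebra 𝓘(ℝ, E) G) :
    (⁅v, w⁆ : GroupLieAlgebra 𝓘(ℝ, E) G) =
      VectorField.lieBracket ℝ (fun x => leftFrame E G x (v : E))
        (fun x => leftFrame E G x (w : E)) (chartAt E (1 : G) 1) := by
  rw [GroupLieAlgebra.bracket_def, ← VectorField.mlieBracketWithin_univ,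
    VectorField.mlieBracketWithin_apply]
  have h1 : mfderiv 𝓘(ℝ, E) 𝓘(ℝ, E) (extChartAt 𝓘(ℝ, E) (1 : G)) (1 : G) =
      ContinuousLinearMap.id ℝ E :=
    (hasMFDerivAt_chartAt_of_eq (E := E) (rfl : (1 : G) = 1)).mfderiv
  rw [h1]
  change (ContinuousLinearMap.id ℝ E).inverse _ = _
  rw [ContinuousLinearMap.inverse_id]
  have h2 : ∀ u : GroupLieAlgebra 𝓘(ℝ, E) G,
      VectorField.mpullbackWithin 𝓘(ℝ, E) 𝓘(ℝ, E) (extChartAt 𝓘(ℝ, E) (1 : G)).symm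
        (mulInvariantVectorField (I := 𝓘(ℝ, E)) u) (range 𝓘(ℝ, E))
      =ᶠ[𝓝 (chartAt E (1 : G) 1)] fun x => (leftFrame E G x (u : E) : E) := by
    intro u
    filter_upwards [chartAt_one_target_mem_nhds (E := E) (G := G)] with x hx
    exact mpullbackWithin_mulInvariantVectorField u hx
  refine Eq.trans ?_ ((h2 v).lieBracket_vectorField_eq (𝕜 := ℝ) (h2 w))
  simp only [modelWithCornersSelf_coe, range_id, preimage_univ, univ_inter]
  exact congrFun (VectorField.lieBracketWithin_univ (𝕜 := ℝ) (E := E)) (chartAt E (1 : G) 1)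

omit [FiniteDimensional ℝ E] in
theorem hasFDerivAt_leftFrame {x : E} (hx : x ∈ (chartAt E (1 : G)).target) :
    HasFDerivAt (fun y => chartAt E (1 : G)
      ((chartAt E (1 : G)).symm x * (chartAt E (1 : G)).symm y)) (leftFrame E G x)
      (chartAt E (1 : G) 1) := by
  have hs1 := (chartAt E (1 : G)).left_inv (mem_chart_source E (1 : G))
  have h5 := contDiffAt_chartAt_mul (G := G) hx (mem_chart_target E (1 : G))
    (by rw [hs1, mul_one]; exact (chartAt E (1 : G)).map_target hx)
  exact ((h5.differentiableAt (by simp)).comp (chartAt E (1 : G) 1)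
    (hasFDerivAt_prodMk_right x (chartAt E (1 : G) 1)).differentiableAt).hasFDerivAt

omit [FiniteDimensional ℝ E] [LieGroup 𝓘(ℝ, E) ∞ G] [FiniteDimensional ℝ F]
  [LieGroup 𝓘(ℝ, F) ∞ H] in
theorem modelDifferential_leftFrame_one (v : E) :
    modelDifferential π (leftFrame E G (chartAt E (1 : G) 1) v) =
      leftFrame F H (chartAt F (1 : H) 1) (modelDifferential π v) := by
  rw [leftFrame_one, leftFrame_one]
  rfl

omit [FiniteDimensional ℝ E] [FiniteDimensional ℝ F] in
-- Since `π (g * h) = π g * π h`, the left-invariant fields of `v` and of `dπ v` are `π`-related;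
-- this is the chart form near the identity.
theorem fderiv_chartHom_leftFrame : ∀ᶠ x in 𝓝 (chartAt E (1 : G) 1), ∀ v : E,
    fderiv ℝ (chartHom π) x (leftFrame E G x v) =
      leftFrame F H (chartHom π x) (modelDifferential π v) := by
  have := LieGroup.isTopologicalGroup_real E G
  have hs1 := (chartAt E (1 : G)).left_inv (mem_chart_source E (1 : G))
  have hs1' := (chartAt F (1 : H)).left_inv (mem_chart_source F (1 : H))
  have hsym := (chartAt E (1 : G)).continuousAt_symm (mem_chart_target E (1 : G))
  have hπs : ∀ᶠ x in 𝓝 (chartAt E (1 : G) 1),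
      π ((chartAt E (1 : G)).symm x) ∈ (chartAt F (1 : H)).source := by
    refine (π.contMDiff_toFun.continuous.continuousAt.comp hsym) (?_ : _ ∈ 𝓝 (π _))
    rw [hs1, map_one]
    exact chartAt_one_source_mem_nhds
  filter_upwards [chartAt_one_target_mem_nhds (E := E) (G := G), hπs] with x hx hxs v
  set g := (chartAt E (1 : G)).symm x with hg
  have hgs : g ∈ (chartAt E (1 : G)).source := (chartAt E (1 : G)).map_target hx
  have hgx : chartAt E (1 : G) g = x := (chartAt E (1 : G)).right_inv hx
  have hd1 : DifferentiableAt ℝ (chartHom π) x :=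
    (contDiffAt_chartAt_comp (f := fun y => π ((chartAt E (1 : G)).symm y)) 1
      ((π.contMDiff_toFun.contMDiffAt).comp x (contMDiffAt_chartAt_symm 1 hx)) hxs).differentiableAt
      (by simp)
  have h1 := hasFDerivAt_leftFrame hx
  have hd2 : HasFDerivAt (chartHom π) (fderiv ℝ (chartHom π) x) (chartAt E (1 : G)
      ((chartAt E (1 : G)).symm x * (chartAt E (1 : G)).symm (chartAt E (1 : G) 1))) := by
    rw [hs1, mul_one, ← hg, hgx]
    exact hd1.hasFDerivAt
  have h2 := hd2.comp (chartAt E (1 : G) 1) h1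
  have h3 := hasFDerivAt_leftFrame ((chartAt F (1 : H)).map_source hxs)
  rw [← chartHom_one π] at h3
  have h4 := h3.comp (chartAt E (1 : G) 1) (hasFDerivAt_chartHom π)
  have hmulc : ∀ᶠ z in 𝓝 (chartAt E (1 : G) 1),
      g * (chartAt E (1 : G)).symm z ∈ (chartAt E (1 : G)).source := by
    refine (continuousAt_const.mul hsym) (?_ : _ ∈ 𝓝 (g * _))
    rw [hs1, mul_one]
    exact (chartAt E (1 : G)).open_source.mem_nhds hgs
  have hπs' : ∀ᶠ z in 𝓝 (chartAt E (1 : G) 1),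
      π ((chartAt E (1 : G)).symm z) ∈ (chartAt F (1 : H)).source := hπs
  have h5 := h2.unique (h4.congr_of_eventuallyEq (by
    filter_upwards [hmulc, hπs'] with z hz hz'
    simp only [Function.comp, chartHom]
    rw [(chartAt E (1 : G)).left_inv hz, map_mul, (chartAt F (1 : H)).left_inv hz',
      (chartAt F (1 : H)).left_inv hxs]))
  exact congrArg (fun L : E →L[ℝ] F => L v) h5

/-- Related vector fields have related brackets. Both brackets are computed in the charts at the
identities, where second derivatives of `chartHom π` cancel by symmetry. -/
theorem lieDifferential_lie (v w : GroupLieAlgebra 𝓘(ℝ, E) G) :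
    lieDifferential π ⁅v, w⁆ = ⁅lieDifferential π v, lieDifferential π w⁆ := by
  have hs1 := (chartAt E (1 : G)).left_inv (mem_chart_source E (1 : G))
  have hsm : ContDiffAt ℝ ∞ (chartHom π) (chartAt E (1 : G) 1) := by
    refine contDiffAt_chartAt_comp (f := fun y => π ((chartAt E (1 : G)).symm y)) 1
      ((π.contMDiff_toFun.contMDiffAt).comp _ (contMDiffAt_chartAt_symm 1 (mem_chart_target E 1))) ?_
    rw [hs1, map_one]
    exact mem_chart_source F 1
  have hV : ∀ u : E, DifferentiableAt ℝ (fun x => leftFrame E G x u) (chartAt E (1 : G) 1) :=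
    fun u => differentiableAt_leftFrame.clm_apply (differentiableAt_const u)
  have hV' : ∀ u : F, DifferentiableAt ℝ (fun x => leftFrame F H x u)
      (chartHom π (chartAt E (1 : G) 1)) := fun u => by
    rw [chartHom_one]
    exact differentiableAt_leftFrame.clm_apply (differentiableAt_const u)
  have h1 := VectorField.fderiv_apply_lieBracket hsm (by simpa using (ENat.LEInfty.out : (2 : ℕ∞ω) ≤ ∞)) (hV w) (hV v)
  rw [← lieBracket_groupLieAlgebra_eq] at h1
  rw [(hasFDerivAt_chartHom π).fderiv] at h1
  have h2 : ∀ a b : E, fderiv ℝ (fun x => fderiv ℝ (chartHom π) x (leftFrame E G x a))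
      (chartAt E (1 : G) 1) (leftFrame E G (chartAt E (1 : G) 1) b) =
      fderiv ℝ (fun x => leftFrame F H x (modelDifferential π a)) (chartAt F (1 : H) 1)
        (leftFrame F H (chartAt F (1 : H) 1) (modelDifferential π b)) := by
    intro a b
    have e1 : (fun x => fderiv ℝ (chartHom π) x (leftFrame E G x a)) =ᶠ[𝓝 (chartAt E (1 : G) 1)]
        (fun x => leftFrame F H x (modelDifferential π a)) ∘ chartHom π := by
      filter_upwards [fderiv_chartHom_leftFrame π] with x hx using hx a
    rw [e1.fderiv_eq, fderiv_comp _ (hV' _) (hasFDerivAt_chartHom π).differentiableAt,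
      (hasFDerivAt_chartHom π).fderiv, ContinuousLinearMap.comp_apply,
      modelDifferential_leftFrame_one, chartHom_one]
  refine Eq.trans ?_ (lieBracket_groupLieAlgebra_eq (E := F) (G := H)
    (lieDifferential π v) (lieDifferential π w)).symm
  exact h1.trans (congrArg₂ (· - ·) (h2 w v) (h2 v w))

end LieBracket

/-- The quotient of a norm on a finite-dimensional space by a surjective linear map. -/
theorem Seminorm.exists_quotient_of_normed {E W : Type*} [NormedAddCommGroup E] [NormedSpace ℝ E]
    [FiniteDimensional ℝ E] [AddCommGroup W] [Module ℝ W] (p : Seminorm ℝ E)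
    (hp : ∀ x, p x = 0 → x = 0) (L : E →ₗ[ℝ] W) (hL : Function.Surjective L) :
    ∃ q : Seminorm ℝ W, (∀ w, ∃ v, L v = w ∧ p v = q w) ∧ ∀ v, q (L v) ≤ p v := by
  obtain ⟨C, hC, hCp⟩ := Submodule.exists_norm_le_mul (⊤ : Submodule ℝ E)
    (p.comp (⊤ : Submodule ℝ E).subtype) (fun v hv => Subtype.ext (hp v hv))
  -- Fibres are closed and `p` is coercive, so the quotient norm is attained. The seminorm axioms
  -- then follow by comparing minimal representatives.
  have hmin : ∀ w, ∃ v, L v = w ∧ ∀ v', L v' = w → p v ≤ p v' := by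
    intro w
    obtain ⟨x₀, hx₀⟩ := hL w
    have hcl : IsClosed {x | L x = w} := by
      have h1 := (Submodule.closed_of_finiteDimensional (LinearMap.ker L)).preimage
        (continuous_id.sub (continuous_const (y := x₀)))
      have h2 : {x | L x = w} = (fun x => id x - x₀) ⁻¹' (LinearMap.ker L) := by
        ext x
        simp [sub_eq_zero, hx₀]
      rwa [h2]
    obtain ⟨v, hv, hmin⟩ := p.continuous_of_finiteDimensional_real.continuousOn.exists_isMinOn'
      hcl hx₀ (by
        refine Filter.Eventually.filter_mono inf_le_left ?_
        filter_upwards [(tendsto_norm_cocompact_atTop (E := E)).eventually_ge_atTop (C * p x₀)]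
          with x hx
        have := hCp ⟨x, trivial⟩
        exact le_of_mul_le_mul_left (hx.trans this) hC)
    exact ⟨v, hv, fun v' hv' => hmin hv'⟩
  choose m hm hmin using hmin
  refine ⟨Seminorm.ofSMulLE (fun w => p (m w)) ?_ ?_ ?_, fun w => ⟨m w, hm w, rfl⟩,
    fun v => hmin _ v rfl⟩
  · have := hmin 0 0 (map_zero L)
    rw [map_zero] at this
    exact le_antisymm this (apply_nonneg _ _)
  · exact fun x y => (hmin (x + y) (m x + m y) (by rw [map_add, hm, hm])).trans (map_add_le_add _ _ _)
  · exact fun r x => (hmin (r • x) (r • m x) (by rw [map_smul, hm])).trans (map_smul_eq_mul _ _ _).le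

theorem Seminorm.exists_quotient {V W : Type*} [AddCommGroup V] [Module ℝ V]
    [FiniteDimensional ℝ V] [AddCommGroup W] [Module ℝ W] (p : Seminorm ℝ V)
    (hp : ∀ x, p x = 0 → x = 0) (L : V →ₗ[ℝ] W) (hL : Function.Surjective L) :
    ∃ q : Seminorm ℝ W, (∀ w, ∃ v, L v = w ∧ p v = q w) ∧ ∀ v, q (L v) ≤ p v := by
  set e := (Module.finBasis ℝ V).equivFun
  obtain ⟨q, h1, h2⟩ := Seminorm.exists_quotient_of_normed (p.comp e.symm.toLinearMap)
    (fun x hx => e.symm.map_eq_zero_iff.1 (hp _ hx)) (L ∘ₗ e.symm.toLinearMap)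
    (fun w => by
      obtain ⟨v, rfl⟩ := hL w
      exact ⟨e v, by simp⟩)
  refine ⟨q, fun w => ?_, fun v => by simpa using h2 (e v)⟩
  obtain ⟨v, hv⟩ := h1 w
  exact ⟨e.symm v, hv⟩

/-! ### The push-forward structure and first-order lifting. -/

namespace SubFinslerStructure

variable {E : Type*} [NormedAddCommGroup E] [NormedSpace ℝ E] [FiniteDimensional ℝ E]
  {G : Type*} [TopologicalSpace G] [ChartedSpace E G] [Group G] [LieGroup 𝓘(ℝ, E) ∞ G]
  {F : Type*} [NormedAddCommGroup F] [NormedSpace ℝ F] [FiniteDimensional ℝ F]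
  {H : Type*} [TopologicalSpace H] [ChartedSpace F H] [Group H] [LieGroup 𝓘(ℝ, F) ∞ H]
  (S : SubFinslerStructure E G) {T : SubFinslerStructure F H}
  (π : ContMDiffMonoidMorphism 𝓘(ℝ, E) 𝓘(ℝ, F) ∞ G H)

instance finiteDimensional_polarization : FiniteDimensional ℝ S.polarization :=
  FiniteDimensional.of_injective S.incl S.incl_injective

theorem lieSpan_map_lieDifferential (hπ : Function.Surjective (lieDifferential π)) :
    LieSubalgebra.lieSpan ℝ (GroupLieAlgebra 𝓘(ℝ, F) H)
      (S.polarization.map (lieDifferential π) : Set (GroupLieAlgebra 𝓘(ℝ, F) H)) = ⊤ := by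
  set φ : GroupLieAlgebra 𝓘(ℝ, E) G →ₗ⁅ℝ⁆ GroupLieAlgebra 𝓘(ℝ, F) H :=
    { lieDifferential π with map_lie' := fun {x y} => lieDifferential_lie π x y } with hφ
  rw [eq_top_iff]
  rintro x -
  obtain ⟨v, rfl⟩ := hπ x
  have h1 : LieSubalgebra.lieSpan ℝ (GroupLieAlgebra 𝓘(ℝ, E) G)
      (S.polarization : Set (GroupLieAlgebra 𝓘(ℝ, E) G)) ≤
      (LieSubalgebra.lieSpan ℝ (GroupLieAlgebra 𝓘(ℝ, F) H)
        (S.polarization.map (lieDifferential π) : Set (GroupLieAlgebra 𝓘(ℝ, F) H))).comap φ := by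
    rw [LieSubalgebra.lieSpan_le]
    exact fun w hw => LieSubalgebra.subset_lieSpan ⟨w, hw, rfl⟩
  rw [S.bracketGenerating] at h1
  exact h1 (LieSubalgebra.mem_top v)

/-- The push-forward of a sub-Finsler structure. -/
theorem exists_pushforward (hπ : Function.Surjective (lieDifferential π)) :
    ∃ T : SubFinslerStructure F H,
      (∀ v : S.polarization, ∃ w : T.polarization,
        T.incl w = modelDifferential π (S.incl v) ∧ T.norm w ≤ S.norm v) ∧
      ∀ w : T.polarization, ∃ v : S.polarization,
        modelDifferential π (S.incl v) = T.incl w ∧ S.norm v = T.norm w := by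
  obtain ⟨q, h1, h2⟩ := S.norm.exists_quotient S.norm_definite
    ((lieDifferential π).submoduleMap S.polarization)
    (LinearMap.submoduleMap_surjective (lieDifferential π) S.polarization)
  refine ⟨⟨S.polarization.map (lieDifferential π), S.lieSpan_map_lieDifferential π hπ, q,
    fun w hw => ?_⟩, fun v => ⟨_, rfl, h2 v⟩, fun w => ?_⟩
  · obtain ⟨v, rfl, hv⟩ := h1 w
    rw [S.norm_definite v (hv.trans hw), map_zero]
  · obtain ⟨v, hv, hv'⟩ := h1 w
    exact ⟨v, congrArg Subtype.val hv, hv'⟩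

variable {S π}

theorem isPushforward_of_lift
    (h1 : ∀ v : S.polarization, ∃ w : T.polarization,
      T.incl w = modelDifferential π (S.incl v) ∧ T.norm w ≤ S.norm v)
    (h2 : ∀ w : T.polarization, ∃ v : S.polarization,
      modelDifferential π (S.incl v) = T.incl w ∧ S.norm v = T.norm w) :
    S.IsPushforward T π := by
  refine ⟨le_antisymm (fun w hw => ?_) ?_, fun w => IsLeast.isGLB ⟨?_, ?_⟩⟩
  · obtain ⟨v, hv, -⟩ := h2 ⟨w, hw⟩
    exact ⟨v, v.2, hv⟩
  · rintro _ ⟨v, hv, rfl⟩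
    obtain ⟨w, hw, -⟩ := h1 ⟨v, hv⟩
    have hw' : (w : GroupLieAlgebra 𝓘(ℝ, F) H) = lieDifferential π v := hw
    exact hw' ▸ w.2
  · obtain ⟨v, hv, hv'⟩ := h2 w
    exact ⟨v, hv, hv'⟩
  · rintro _ ⟨v, hv, rfl⟩
    obtain ⟨w', hw, hle⟩ := h1 v
    have : w' = w := Subtype.ext (Eq.trans hw hv)
    exact this ▸ hle

theorem ccDist_map_le (h1 : ∀ v : S.polarization, ∃ w : T.polarization,
      T.incl w = modelDifferential π (S.incl v) ∧ T.norm w ≤ S.norm v) (p q : G) :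
    T.ccDist (π p) (π q) ≤ S.ccDist p q := by
  choose w hw hle using h1
  refine le_sInf ?_
  rintro _ ⟨γ, u, hγ, rfl, rfl, rfl⟩
  have hh : T.IsHorizontal (Icc 0 1) (π ∘ γ) (w ∘ u) := by
    rw [isHorizontal_iff] at hγ ⊢
    refine ⟨hγ.1.contMDiff_comp π.contMDiff_toFun, hγ.2.mono fun t ht => ⟨?_, ?_⟩⟩
    · exact (π.contMDiff_toFun.continuous.continuousAt).comp_continuousWithinAt ht.1
    · have := ht.2.hom_comp π ht.1
      rwa [← hw] at this
  refine (hh.ccDist_le zero_le_one).trans (lintegral_mono fun t => ENNReal.ofReal_le_ofReal (hle _))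

/-- Compactness gives uniformity in `h`. If the claim failed along radii tending to `0`, the
rescaled positions would converge along an ultrafilter to a horizontal vector of norm at most `1`.
Lifting this vector with the same norm and following a curve tangent to the lift gives points of `G`
that are first-order accurate, a contradiction. -/
theorem exists_lift_approx
    (h2 : ∀ w : T.polarization, ∃ v : S.polarization,
      modelDifferential π (S.incl v) = T.incl w ∧ S.norm v = T.norm w) {ε : ℝ} (hε : 0 < ε) :
    ∃ δ > 0, ∀ r, 0 < r → r < δ → ∀ h : H, T.ccDist 1 h ≤ ENNReal.ofReal r →
      ∃ g : G, S.ccDist 1 g ≤ ENNReal.ofReal r ∧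
        dist (chartAt F (1 : H) h) (chartAt F (1 : H) (π g)) ≤ ε * r := by
  by_contra! hcon
  choose r hr0 hrn h hh hbad using fun n : ℕ => hcon (1 / ((n : ℝ) + 1)) (by positivity)
  have hr : Tendsto r atTop (𝓝 0) := squeeze_zero (fun n => (hr0 n).le) (fun n => (hrn n).le)
    tendsto_one_div_add_atTop_nhds_zero_nat
  set U : Ultrafilter ℕ := hyperfilter ℕ with hU
  have hrU : Tendsto r U (𝓝 0) := hr.mono_left Nat.hyperfilter_le_atTop
  set y₀ := chartAt F (1 : H) 1 with hy₀
  have hest : ∀ p : Seminorm ℝ F, (∀ v : T.polarization, p (T.incl v) ≤ T.norm v) →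
      ∀ η > 0, ∀ᶠ n in (U : Filter ℕ),
        p ((r n)⁻¹ • (chartAt F (1 : H) (h n) - y₀)) ≤ 1 + η := by
    intro p hp η hη
    obtain ⟨O, hO, δ, hδ, hest⟩ := T.exists_chart_estimate p hp hη
    filter_upwards [hrU.eventually (gt_mem_nhds hδ)] with n hn
    have := (hest 1 (mem_of_mem_nhds hO) (h n) (r n) (hr0 n).le hn (hh n)).2
    rw [map_smul_eq_mul, Real.norm_of_nonneg (inv_nonneg.2 (hr0 n).le),
      inv_mul_le_iff₀ (hr0 n), mul_comm]
    exact this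
  obtain ⟨D, hD, p₀, hp₀, hpD⟩ := T.exists_normSeminorm_le
  obtain ⟨w, -, hw⟩ := (isCompact_closedBall (0 : F) (D * 2)).ultrafilter_le_nhds
    (U.map fun n => (r n)⁻¹ • (chartAt F (1 : H) (h n) - y₀)) (by
      rw [le_principal_iff, Ultrafilter.coe_map]
      refine mem_map.2 ?_
      filter_upwards [hest p₀ hp₀ 1 one_pos] with n hn
      change _ ∈ Metric.closedBall _ _
      rw [mem_closedBall_zero_iff, hpD]
      exact mul_le_mul_of_nonneg_left (hn.trans (by norm_num)) hD.le)
  change Tendsto (fun n => (r n)⁻¹ • (chartAt F (1 : H) (h n) - y₀)) U (𝓝 w) at hw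
  obtain ⟨w', rfl, hw1⟩ := exists_incl_eq_of_seminorm_le (S := T) (x := w) (r := 1) fun p hp =>
    le_of_forall_pos_le_add fun η hη =>
      le_of_tendsto ((p.continuous_of_finiteDimensional_real.tendsto w).comp hw) (hest p hp η hη)
  obtain ⟨v, hv, hvn⟩ := h2 w'
  obtain ⟨c, hc0, hcc, hcd, hcl⟩ := S.exists_curve_tangent v
  have hcd' : HasDerivAt (fun s => chartAt F (1 : H) (π (c s))) (T.incl w') 0 := by
    have e : chartAt E (1 : G) 1 = chartAt E (1 : G) (c 0) := by rw [hc0]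
    have h3 := hasFDerivAt_chartHom π
    rw [e] at h3
    have h4 := HasFDerivAt.comp_hasDerivAt 0 h3 hcd
    rw [hv] at h4
    refine h4.congr_of_eventuallyEq ?_
    have hsrc : ∀ᶠ s in 𝓝 (0 : ℝ), c s ∈ (chartAt E (1 : G)).source := by
      refine hcc (?_ : _ ∈ 𝓝 (c 0))
      rw [hc0]
      exact chartAt_one_source_mem_nhds
    filter_upwards [hsrc] with s hs
    simp only [Function.comp, chartHom]
    rw [(chartAt E (1 : G)).left_inv hs]
  have h5 : Tendsto (fun n => (r n)⁻¹ • (chartAt F (1 : H) (π (c (r n))) - y₀)) U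
      (𝓝 (T.incl w')) := by
    have := (hasFDerivWithinAt_univ.2 hcd'.hasFDerivAt).lim (l := U) (c := fun n => (r n)⁻¹)
      (d := r) (v := 1) hrU (Eventually.of_forall fun _ => mem_univ _)
      (tendsto_const_nhds.congr fun n => by
        rw [smul_eq_mul, inv_mul_cancel₀ (hr0 n).ne'])
    simpa [hc0] using this
  have h6 : Tendsto (fun n => (r n)⁻¹ • (chartAt F (1 : H) (h n) -
      chartAt F (1 : H) (π (c (r n))))) U (𝓝 0) := by
    have := hw.sub h5
    rw [sub_self] at this
    refine this.congr fun n => ?_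
    rw [← smul_sub, sub_sub_sub_cancel_right]
  have hr' : Tendsto r U (𝓝[≥] 0) := tendsto_nhdsWithin_iff.2
    ⟨hrU, Eventually.of_forall fun n => (hr0 n).le⟩
  have h6' := h6.norm
  rw [norm_zero] at h6'
  have h7 := (h6'.eventually (gt_mem_nhds hε)).and (hr'.eventually hcl)
  obtain ⟨n, hn, hn'⟩ := h7.exists
  refine absurd (hbad n (c (r n)) (hn'.trans (ENNReal.ofReal_le_ofReal ?_))) (not_lt.2 ?_)
  · exact mul_le_of_le_one_right (hr0 n).le (hvn.le.trans hw1)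
  · rw [norm_smul, norm_inv, Real.norm_of_nonneg (hr0 n).le, inv_mul_lt_iff₀ (hr0 n)] at hn
    rw [dist_eq_norm, mul_comm]
    exact hn.le

end SubFinslerStructure

/-! ### Propagation of errors in products. -/

section Perturbation

variable {E : Type*} [NormedAddCommGroup E] [NormedSpace ℝ E]
  {G : Type*} [TopologicalSpace G] [ChartedSpace E G] [Group G] [LieGroup 𝓘(ℝ, E) ∞ G]

theorem exists_conj_lipschitz {K : Set G} (hK : IsCompact K) {O : Set G} (hO : O ∈ 𝓝 (1 : G)) :
    ∃ V ∈ 𝓝 (1 : G), ∃ C : ℝ, 0 < C ∧ ∀ a ∈ K, ∀ y ∈ V, a * y * a⁻¹ ∈ O ∧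
      dist (chartAt E (1 : G) (a * y * a⁻¹)) (chartAt E (1 : G) 1) ≤
        C * dist (chartAt E (1 : G) y) (chartAt E (1 : G) 1) := by
  have := LieGroup.isTopologicalGroup_real E G
  refine hK.induction_on (p := fun s => ∃ V ∈ 𝓝 (1 : G), ∃ C : ℝ, 0 < C ∧ ∀ a ∈ s, ∀ y ∈ V,
    a * y * a⁻¹ ∈ O ∧ dist (chartAt E (1 : G) (a * y * a⁻¹)) (chartAt E (1 : G) 1) ≤
        C * dist (chartAt E (1 : G) y) (chartAt E (1 : G) 1)) ?_ ?_ ?_ ?_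
  · exact ⟨univ, univ_mem, 1, one_pos, by simp⟩
  · rintro s t hst ⟨V, hV, C, hC, h⟩
    exact ⟨V, hV, C, hC, fun a ha => h a (hst ha)⟩
  · rintro s t ⟨V, hV, C, hC, h⟩ ⟨V', hV', C', hC', h'⟩
    refine ⟨V ∩ V', inter_mem hV hV', max C C', lt_max_of_lt_left hC, ?_⟩
    rintro a (ha | ha) y ⟨hy, hy'⟩
    · exact ⟨(h a ha y hy).1, (h a ha y hy).2.trans
        (mul_le_mul_of_nonneg_right (le_max_left _ _) dist_nonneg)⟩
    · exact ⟨(h' a ha y hy').1, (h' a ha y hy').2.trans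
        (mul_le_mul_of_nonneg_right (le_max_right _ _) dist_nonneg)⟩
  · intro a _
    have hf : ContMDiff (𝓘(ℝ, E).prod 𝓘(ℝ, E)) 𝓘(ℝ, E) ∞ (fun x : G × G => x.1 * x.2 * x.1⁻¹) :=
      (contMDiff_fst.mul contMDiff_snd).mul contMDiff_fst.inv
    obtain ⟨U, hU, V, hV, C, hC, h⟩ := exists_nhds_lipschitz_chartAt_one_prod (a := a) hf (by simp)
    have hc : (fun x : G × G => x.1 * x.2 * x.1⁻¹) ⁻¹' O ∈ 𝓝 (a, (1 : G)) := by
      refine hf.continuous.continuousAt (?_ : _ ∈ 𝓝 (a * 1 * a⁻¹))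
      simpa using hO
    rw [nhds_prod_eq] at hc
    obtain ⟨U', hU', V', hV', hsub⟩ := mem_prod_iff.1 hc
    refine ⟨U ∩ U', mem_nhdsWithin_of_mem_nhds (inter_mem hU hU'), V ∩ V', inter_mem hV hV', C, hC,
      fun b hb y hy => ⟨hsub (mk_mem_prod hb.2 hy.2), ?_⟩⟩
    have := h b hb.1 y hy.1 1 (mem_of_mem_nhds hV)
    simpa using this

/-- Here `e` is the current error between a point and its approximation `a`, while `h` and `b` are
the exact and the approximate next increments. The displayed product is the next error, and its
change is linear in the discrepancy of increments, uniformly for `a` in a compact set. -/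
theorem exists_perturbation_lipschitz {K : Set G} (hK : IsCompact K) :
    ∃ W ∈ 𝓝 (1 : G), ∃ N ∈ 𝓝 (1 : G), ∃ M : ℝ, 0 < M ∧ ∀ e ∈ W, ∀ a ∈ K, ∀ h ∈ N, ∀ b ∈ N,
      e * (a * (h * b⁻¹) * a⁻¹) ∈ (chartAt E (1 : G)).source ∧
      dist (chartAt E (1 : G) (e * (a * (h * b⁻¹) * a⁻¹))) (chartAt E (1 : G) e) ≤
        M * dist (chartAt E (1 : G) h) (chartAt E (1 : G) b) := by
  have := LieGroup.isTopologicalGroup_real E G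
  have hf₁ : ContMDiff (𝓘(ℝ, E).prod 𝓘(ℝ, E)) 𝓘(ℝ, E) ∞ (fun x : G × G => x.1 * x.2) :=
    contMDiff_fst.mul contMDiff_snd
  have hf₂ : ContMDiff (𝓘(ℝ, E).prod 𝓘(ℝ, E)) 𝓘(ℝ, E) ∞ (fun x : G × G => x.2 * x.1⁻¹) :=
    contMDiff_snd.mul contMDiff_fst.inv
  obtain ⟨U₁, hU₁, V₁, hV₁, C₁, hC₁, h₁⟩ :=
    exists_nhds_lipschitz_chartAt_one_prod (a := 1) hf₁ (by simp)
  obtain ⟨U₂, hU₂, V₂, hV₂, C₂, hC₂, h₂⟩ :=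
    exists_nhds_lipschitz_chartAt_one_prod (a := 1) hf₂ (by simp)
  have hc : (fun x : G × G => x.1 * x.2) ⁻¹' (chartAt E (1 : G)).source ∈ 𝓝 ((1 : G), (1 : G)) := by
    refine hf₁.continuous.continuousAt (?_ : _ ∈ 𝓝 ((1 : G) * 1))
    rw [mul_one]
    exact chartAt_one_source_mem_nhds
  rw [nhds_prod_eq] at hc
  obtain ⟨W, hW, V, hV, hsub⟩ := mem_prod_iff.1 hc
  obtain ⟨V₃, hV₃, C₃, hC₃, h₃⟩ := exists_conj_lipschitz (E := E) hK (inter_mem hV₁ hV)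
  have hd : (fun x : G × G => x.2 * x.1⁻¹) ⁻¹' V₃ ∈ 𝓝 ((1 : G), (1 : G)) := by
    refine hf₂.continuous.continuousAt (?_ : _ ∈ 𝓝 ((1 : G) * 1⁻¹))
    simpa using hV₃
  rw [nhds_prod_eq] at hd
  obtain ⟨N, hN, N', hN', hsub'⟩ := mem_prod_iff.1 hd
  refine ⟨W ∩ U₁, inter_mem hW hU₁, (N ∩ N') ∩ (U₂ ∩ V₂),
    inter_mem (inter_mem hN hN') (inter_mem hU₂ hV₂), C₁ * (C₃ * C₂), by positivity,
    fun e he a ha h hh b hb => ?_⟩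
  have hy : h * b⁻¹ ∈ V₃ := hsub' (mk_mem_prod hb.1.1 hh.1.2)
  have e₃ := h₃ a ha _ hy
  have e₂ := h₂ b hb.2.1 h hh.2.2 b hb.2.2
  have e₁ := h₁ e he.2 _ e₃.1.1 1 (mem_of_mem_nhds hV₁)
  simp only [mul_inv_cancel, mul_one] at e₁ e₂
  refine ⟨hsub (mk_mem_prod he.1 e₃.1.2), e₁.trans ?_⟩
  rw [mul_assoc C₁]
  refine mul_le_mul_of_nonneg_left (e₃.2.trans ?_) hC₁.le
  rw [mul_assoc C₃]
  exact mul_le_mul_of_nonneg_left e₂ hC₃.le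

end Perturbation

/-! ### The push-forward makes the homomorphism a submetry. -/

namespace SubFinslerStructure

variable {E : Type*} [NormedAddCommGroup E] [NormedSpace ℝ E] [FiniteDimensional ℝ E]
  {G : Type*} [TopologicalSpace G] [ChartedSpace E G] [Group G] [LieGroup 𝓘(ℝ, E) ∞ G]
  {F : Type*} [NormedAddCommGroup F] [NormedSpace ℝ F] [FiniteDimensional ℝ F]
  {H : Type*} [TopologicalSpace H] [ChartedSpace F H] [Group H] [LieGroup 𝓘(ℝ, F) ∞ H]
  {S : SubFinslerStructure E G} {T : SubFinslerStructure F H}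
  {π : ContMDiffMonoidMorphism 𝓘(ℝ, E) 𝓘(ℝ, F) ∞ G H}

/-- A discrete lifting. With `n` steps of length `L / n`, each lifted up to an error `ε L / n`, the
product of the lifted steps stays in the ball of radius `L` and its image is within about `M ε L` of
`q`. Compactness of the ball then yields an exact lift. -/
theorem exists_lift_of_ccDist_lt
    (h1 : ∀ v : S.polarization, ∃ w : T.polarization,
      T.incl w = modelDifferential π (S.incl v) ∧ T.norm w ≤ S.norm v)
    (h2 : ∀ w : T.polarization, ∃ v : S.polarization,
      modelDifferential π (S.incl v) = T.incl w ∧ S.norm v = T.norm w)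
    {q : H} {L : ℝ} (hL : 0 < L) (hq : T.ccDist 1 q < ENNReal.ofReal L) :
    ∃ p, π p = q ∧ S.ccDist 1 p ≤ ENNReal.ofReal L := by
  have := LieGroup.isTopologicalGroup_real F H
  have := LieGroup.t2Space_real F H
  set K : Set H := π '' {p | S.ccDist 1 p ≤ ENNReal.ofReal L} with hKd
  have hK : IsCompact K := (S.isCompact_ccDist_le hL.le).image π.contMDiff_toFun.continuous
  suffices hmem : q ∈ closure K by
    rw [hK.isClosed.closure_eq] at hmem
    obtain ⟨p, hp, hpq⟩ := hmem
    exact ⟨p, hpq, hp⟩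
  rw [mem_closure_iff_nhds]
  intro Q hQ
  have hO : {x : H | x⁻¹ * q ∈ Q} ∈ 𝓝 (1 : H) := by
    have : Continuous fun x : H => x⁻¹ * q := by fun_prop
    refine this.continuousAt (?_ : _ ∈ 𝓝 ((1 : H)⁻¹ * q))
    simpa using hQ
  set O := {x : H | x⁻¹ * q ∈ Q}
  obtain ⟨W, hW, N, hN, M, hM, hpert⟩ := exists_perturbation_lipschitz (E := F) hK
  set y₀ := chartAt F (1 : H) 1 with hy₀
  obtain ⟨ρ, hρ, hball⟩ : ∃ ρ > 0, ∀ g ∈ (chartAt F (1 : H)).source,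
      dist (chartAt F (1 : H) g) y₀ < ρ → g ∈ W ∩ O := by
    have h3 := (chartAt F (1 : H)).continuousAt_symm (mem_chart_target F (1 : H))
    have h4 : (chartAt F (1 : H)).symm ⁻¹' (W ∩ O) ∈ 𝓝 y₀ := by
      refine h3 ?_
      rw [(chartAt F (1 : H)).left_inv (mem_chart_source F (1 : H))]
      exact inter_mem hW hO
    obtain ⟨ρ, hρ, hsub⟩ := Metric.mem_nhds_iff.1 h4
    refine ⟨ρ, hρ, fun g hg hgρ => ?_⟩
    have := hsub (Metric.mem_ball.2 hgρ)
    rwa [mem_preimage, (chartAt F (1 : H)).left_inv hg] at this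
  -- Chosen so that the total error `M * ε * L` is `ρ / 2`; this keeps every intermediate error in
  -- `W` and the final one in `O`.
  set ε := ρ / (2 * M * L) with hε
  have hε0 : 0 < ε := by positivity
  obtain ⟨δ₁, hδ₁, happ⟩ := exists_lift_approx h2 hε0
  obtain ⟨δ₂, hδ₂, hN'⟩ := T.exists_ccDist_lt_mem hN
  obtain ⟨n, hn⟩ := exists_nat_gt (L / min δ₁ δ₂)
  have hmin : 0 < min δ₁ δ₂ := lt_min hδ₁ hδ₂
  have hn0 : (0 : ℝ) < n := lt_of_le_of_lt (by positivity) hn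
  set Δ := L / n with hΔ
  have hΔ0 : 0 < Δ := by positivity
  have hΔm : Δ < min δ₁ δ₂ := by
    rw [hΔ, div_lt_iff₀ hn0]
    rwa [div_lt_iff₀ hmin, mul_comm] at hn
  have hΔL : Δ * n = L := by rw [hΔ]; field_simp
  obtain ⟨c, hc0, hc1, hc⟩ := T.exists_lipschitz_param hq
  have hstep : ∀ k : ℕ, k < n → T.ccDist 1 ((c (k / n))⁻¹ * c ((k + 1 : ℕ) / n)) ≤
      ENNReal.ofReal Δ := by
    intro k hk
    rw [← ccDist_eq_one_left]
    have hk' : ((k + 1 : ℕ) : ℝ) ≤ n := by exact_mod_cast hk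
    refine (hc _ _ (by positivity) (by gcongr; omega) ((div_le_one hn0).2 hk')).trans
      (ENNReal.ofReal_le_ofReal (le_of_eq ?_))
    rw [hΔ]
    push_cast
    field_simp
    ring
  choose! g hg hgd using fun (k : ℕ) (hk : k < n) =>
    happ Δ hΔ0 (hΔm.trans_le (min_le_left _ _)) _ (hstep k hk)
  set a : ℕ → G := fun k => Nat.rec 1 (fun k x => x * g k) k with ha
  have ha0 : a 0 = 1 := rfl
  have has : ∀ k, a (k + 1) = a k * g k := fun k => rfl
  have haL : ∀ k ≤ n, S.ccDist 1 (a k) ≤ ENNReal.ofReal (Δ * k) := by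
    intro k
    induction k with
    | zero => intro; simp [ha0, ccDist_self]
    | succ k ih =>
      intro hk
      refine (S.ccDist_triangle 1 (a k) _).trans ?_
      push_cast
      rw [mul_add, mul_one, ENNReal.ofReal_add (by positivity) hΔ0.le]
      refine add_le_add (ih (by omega)) ?_
      rw [ccDist_eq_one_left, has, inv_mul_cancel_left]
      exact hg k (by omega)
  have haK : ∀ k ≤ n, π (a k) ∈ K := fun k hk => ⟨a k, (haL k hk).trans
    (ENNReal.ofReal_le_ofReal (by
      rw [← hΔL]
      exact mul_le_mul_of_nonneg_left (by exact_mod_cast hk) hΔ0.le)), rfl⟩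
  have key : ∀ k ≤ n, c (k / n) * (π (a k))⁻¹ ∈ (chartAt F (1 : H)).source ∧
      dist (chartAt F (1 : H) (c (k / n) * (π (a k))⁻¹)) y₀ ≤ M * (ε * Δ) * k := by
    intro k
    induction k with
    | zero =>
      intro
      simp [ha0, hc0, hy₀]
    | succ k ih =>
      intro hk
      obtain ⟨i1, i2⟩ := ih (by omega)
      have hkn : (k : ℝ) ≤ n := by exact_mod_cast (by omega : k ≤ n)
      have hW' := (hball _ i1 (i2.trans_lt (by
        calc M * (ε * Δ) * k ≤ M * (ε * Δ) * n := by gcongr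
          _ = M * ε * L := by rw [← hΔL]; ring
          _ = ρ / 2 := by rw [hε]; field_simp
          _ < ρ := half_lt_self hρ))).1
      have hp := hpert _ hW' _ (haK k (by omega)) _ (hN' _ ((hstep k (by omega)).trans_lt
        ((ENNReal.ofReal_lt_ofReal_iff hδ₂).2 (hΔm.trans_le (min_le_right _ _))))) (π (g k))
        (hN' _ (by
          have := ccDist_map_le h1 1 (g k)
          rw [map_one] at this
          exact (this.trans (hg k (by omega))).trans_lt
            ((ENNReal.ofReal_lt_ofReal_iff hδ₂).2 (hΔm.trans_le (min_le_right _ _)))))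
      -- The new error is the old one times a conjugate of the discrepancy of the `k`-th increments,
      -- which is the shape of the perturbation estimate.
      have heq : c (k / n) * (π (a k))⁻¹ * (π (a k) * ((c (k / n))⁻¹ * c ((k + 1 : ℕ) / n) *
          (π (g k))⁻¹) * (π (a k))⁻¹) = c ((k + 1 : ℕ) / n) * (π (a (k + 1)))⁻¹ := by
        rw [has, map_mul]
        group
      rw [heq] at hp
      have hd := hp.2.trans (mul_le_mul_of_nonneg_left (hgd k (by omega)) hM.le)
      refine ⟨hp.1, (dist_triangle _ _ _).trans ((add_le_add hd i2).trans (le_of_eq ?_))⟩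
      push_cast
      ring
  obtain ⟨k1, k2⟩ := key n le_rfl
  have hO' := (hball _ k1 (k2.trans_lt (by
    calc M * (ε * Δ) * n = M * ε * L := by rw [← hΔL]; ring
      _ = ρ / 2 := by rw [hε]; field_simp
      _ < ρ := half_lt_self hρ))).2
  rw [div_self hn0.ne', hc1] at hO'
  refine ⟨π (a n), ?_, haK n le_rfl⟩
  have : (q * (π (a n))⁻¹)⁻¹ * q ∈ Q := hO'
  simpa using this

/-- Lifts at distance at most `r + 1 / (n + 1)` lie in a common compact ball; a limit along an
ultrafilter has distance at most `r` because balls are closed. -/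
theorem exists_lift_of_ccDist_le
    (h1 : ∀ v : S.polarization, ∃ w : T.polarization,
      T.incl w = modelDifferential π (S.incl v) ∧ T.norm w ≤ S.norm v)
    (h2 : ∀ w : T.polarization, ∃ v : S.polarization,
      modelDifferential π (S.incl v) = T.incl w ∧ S.norm v = T.norm w)
    {p : G} {q : H} {r : ℝ} (hr : 0 ≤ r) (hq : T.ccDist (π p) q ≤ ENNReal.ofReal r) :
    ∃ p', π p' = q ∧ S.ccDist p p' ≤ ENNReal.ofReal r := by
  have := LieGroup.t2Space_real F H
  rw [ccDist_eq_one_left] at hq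
  have hex : ∀ n : ℕ, ∃ p', π p' = (π p)⁻¹ * q ∧
      S.ccDist 1 p' ≤ ENNReal.ofReal (r + 1 / ((n : ℝ) + 1)) := fun n =>
    have hn : (0 : ℝ) < 1 / ((n : ℝ) + 1) := by positivity
    exists_lift_of_ccDist_lt h1 h2 (by positivity)
      (hq.trans_lt ((ENNReal.ofReal_lt_ofReal_iff (by positivity)).2 (by linarith)))
  choose x hx hxd using hex
  have hle : ∀ n : ℕ, 1 / ((n : ℝ) + 1) ≤ 1 := fun n => by
    rw [div_le_one (by positivity)]
    linarith [(Nat.cast_nonneg n : (0 : ℝ) ≤ n)]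
  obtain ⟨y, -, hy⟩ := (S.isCompact_ccDist_le (by positivity : 0 ≤ r + 1)).ultrafilter_le_nhds
    ((hyperfilter ℕ).map x) (by
      rw [le_principal_iff, Ultrafilter.coe_map]
      exact mem_map.2 (Eventually.of_forall fun n => (hxd n).trans
        (ENNReal.ofReal_le_ofReal (by linarith [hle n]))))
  change Tendsto x (hyperfilter ℕ) (𝓝 y) at hy
  refine ⟨p * y, ?_, ?_⟩
  · have h3 : Tendsto (fun n => π (x n)) (hyperfilter ℕ) (𝓝 (π y)) :=
      (π.contMDiff_toFun.continuous.tendsto y).comp hy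
    have h4 := tendsto_nhds_unique h3 (tendsto_const_nhds.congr fun n => (hx n).symm)
    rw [map_mul, h4, mul_inv_cancel_left]
  · rw [ccDist_eq_one_left, inv_mul_cancel_left]
    refine ENNReal.le_of_forall_pos_le_add fun η hη _ => ?_
    rw [← ENNReal.ofReal_coe_nnreal, ← ENNReal.ofReal_add hr η.coe_nonneg]
    refine (S.isClosed_ccDist_le (add_nonneg hr η.coe_nonneg)).mem_of_tendsto hy ?_
    have h5 := (tendsto_one_div_add_atTop_nhds_zero_nat (𝕜 := ℝ)).eventually
      (gt_mem_nhds (NNReal.coe_pos.2 hη))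
    filter_upwards [Nat.hyperfilter_le_atTop h5] with n hn
    exact (hxd n).trans (ENNReal.ofReal_le_ofReal (add_le_add le_rfl (le_of_lt hn)))

theorem isSubmetry_of_lift
    (h1 : ∀ v : S.polarization, ∃ w : T.polarization,
      T.incl w = modelDifferential π (S.incl v) ∧ T.norm w ≤ S.norm v)
    (h2 : ∀ w : T.polarization, ∃ v : S.polarization,
      modelDifferential π (S.incl v) = T.incl w ∧ S.norm v = T.norm w) :
    S.IsSubmetry T π := by
  intro p r hr
  ext q
  constructor
  · rintro ⟨p', hp', rfl⟩
    exact (ccDist_map_le h1 p p').trans hp'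
  · intro hq
    obtain ⟨p', h3, h4⟩ := exists_lift_of_ccDist_le h1 h2 hr.le hq
    exact ⟨p', h4, h3⟩

end SubFinslerStructure

/-! ### Uniqueness of the structure and normality of lifts. -/

namespace SubFinslerStructure

variable {E : Type*} [NormedAddCommGroup E] [NormedSpace ℝ E] [FiniteDimensional ℝ E]
  {G : Type*} [TopologicalSpace G] [ChartedSpace E G] [Group G] [LieGroup 𝓘(ℝ, E) ∞ G]
  (S : SubFinslerStructure E G)

/-- The horizontal vectors of norm at most `r` are the velocities at `0` of the curves of speed
at most `r`. -/
theorem exists_incl_eq_and_norm_le_iff {w : E} {r : ℝ} (hr : 0 ≤ r) :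
    (∃ v : S.polarization, S.incl v = w ∧ S.norm v ≤ r) ↔
    ∃ c : ℝ → G, c 0 = 1 ∧ HasDerivAt (fun s => chartAt E (1 : G) (c s)) w 0 ∧
      ∀ᶠ t in 𝓝[>] (0 : ℝ), S.ccDist 1 (c t) ≤ ENNReal.ofReal (t * r) := by
  constructor
  · rintro ⟨v, rfl, hv⟩
    obtain ⟨c, h0, -, hd, hc⟩ := S.exists_curve_tangent v
    refine ⟨c, h0, hd, ?_⟩
    filter_upwards [nhdsWithin_mono 0 Ioi_subset_Ici_self hc, self_mem_nhdsWithin] with t ht ht0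
    exact ht.trans (ENNReal.ofReal_le_ofReal (mul_le_mul_of_nonneg_left hv (le_of_lt ht0)))
  · rintro ⟨c, h0, hd, hc⟩
    refine exists_incl_eq_of_seminorm_le fun p hp => ?_
    have hΘ : HasDerivWithinAt (fun t : ℝ => t * r) r (Ioi 0) 0 := by
      simpa using ((hasDerivAt_id (0 : ℝ)).mul_const r).hasDerivWithinAt
    refine p.le_of_hasDerivWithinAt hd.hasDerivWithinAt hΘ fun ε hε => ?_
    obtain ⟨O, hO, δ, hδ, H⟩ := S.exists_chart_estimate p hp hε
    have h1 : Tendsto (fun t : ℝ => t * r) (𝓝[>] 0) (𝓝 0) := by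
      have : Continuous fun t : ℝ => t * r := by fun_prop
      simpa using (this.tendsto 0).mono_left (nhdsWithin_le_nhds (s := Ioi 0))
    filter_upwards [hc, self_mem_nhdsWithin, h1.eventually (gt_mem_nhds hδ)] with t ht ht0 htδ
    have ht0' : 0 < t := ht0
    have := (H 1 (mem_of_mem_nhds hO) (c t) (t * r) (by positivity) htδ ht).2
    simpa [h0] using this

/-- Balls at the identity decide which curves satisfy `d(1, c t) ≤ t r` for small `t > 0`, hence
which vectors are horizontal of norm at most `r`. Only `r > 0` is available, so norms are compared
through all `r` above them. -/
theorem eq_of_ccDist_le_iff {S₁ S₂ : SubFinslerStructure E G}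
    (h : ∀ (q : G) (r : ℝ), 0 < r →
      (S₁.ccDist 1 q ≤ ENNReal.ofReal r ↔ S₂.ccDist 1 q ≤ ENNReal.ofReal r)) : S₁ = S₂ := by
  have key : ∀ {S₁ S₂ : SubFinslerStructure E G}, (∀ (q : G) (r : ℝ), 0 < r →
      (S₁.ccDist 1 q ≤ ENNReal.ofReal r ↔ S₂.ccDist 1 q ≤ ENNReal.ofReal r)) →
      ∀ (v : S₁.polarization), ∃ w : S₂.polarization, S₂.incl w = S₁.incl v ∧
        S₂.norm w ≤ S₁.norm v := by
    intro S₁ S₂ h v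
    have h1 : ∀ r > S₁.norm v, ∃ w : S₂.polarization, S₂.incl w = S₁.incl v ∧
        S₂.norm w ≤ r := by
      intro r hr
      have hr0 : 0 < r := (apply_nonneg S₁.norm v).trans_lt hr
      obtain ⟨c, h0, hd, hc⟩ := (S₁.exists_incl_eq_and_norm_le_iff hr0.le).1 ⟨v, rfl, hr.le⟩
      refine (S₂.exists_incl_eq_and_norm_le_iff hr0.le).2 ⟨c, h0, hd, ?_⟩
      filter_upwards [hc, self_mem_nhdsWithin] with t ht ht0
      exact (h _ _ (mul_pos ht0 hr0)).1 ht
    obtain ⟨w, hw, -⟩ := h1 (S₁.norm v + 1) (by linarith)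
    refine ⟨w, hw, le_of_forall_gt_imp_ge_of_dense fun r hr => ?_⟩
    obtain ⟨w', hw', hr'⟩ := h1 r hr
    rwa [S₂.incl_injective (hw.trans hw'.symm)]
  have k₁ := key h
  have k₂ := key fun q r hr => (h q r hr).symm
  have hpol : S₁.polarization = S₂.polarization := by
    refine le_antisymm (fun v hv => ?_) fun v hv => ?_
    · obtain ⟨w, hw, -⟩ := k₁ ⟨v, hv⟩
      have : (w : GroupLieAlgebra 𝓘(ℝ, E) G) = v := hw
      exact this ▸ w.2
    · obtain ⟨w, hw, -⟩ := k₂ ⟨v, hv⟩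
      have : (w : GroupLieAlgebra 𝓘(ℝ, E) G) = v := hw
      exact this ▸ w.2
  have hnorm : ∀ (v : GroupLieAlgebra 𝓘(ℝ, E) G) (h₁ : v ∈ S₁.polarization)
      (h₂ : v ∈ S₂.polarization), S₁.norm ⟨v, h₁⟩ = S₂.norm ⟨v, h₂⟩ := by
    intro v h₁ h₂
    refine le_antisymm ?_ ?_
    · obtain ⟨w, hw, hle⟩ := k₂ ⟨v, h₂⟩
      have : w = ⟨v, h₁⟩ := Subtype.ext hw
      exact this ▸ hle
    · obtain ⟨w, hw, hle⟩ := k₁ ⟨v, h₁⟩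
      have : w = ⟨v, h₂⟩ := Subtype.ext hw
      exact this ▸ hle
  cases S₁ with | mk V₁ b₁ N₁ d₁ =>
  cases S₂ with | mk V₂ b₂ N₂ d₂ =>
  obtain rfl : V₁ = V₂ := hpol
  congr
  exact Seminorm.ext fun v => hnorm v v.2 v.2

variable {F : Type*} [NormedAddCommGroup F] [NormedSpace ℝ F] [FiniteDimensional ℝ F]
  {H : Type*} [TopologicalSpace H] [ChartedSpace F H] [Group H] [LieGroup 𝓘(ℝ, F) ∞ H]
  {π : ContMDiffMonoidMorphism 𝓘(ℝ, E) 𝓘(ℝ, F) ∞ G H} {S}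

theorem IsSubmetry.unique {T₁ T₂ : SubFinslerStructure F H} (h₁ : S.IsSubmetry T₁ π)
    (h₂ : S.IsSubmetry T₂ π) : T₁ = T₂ := by
  refine eq_of_ccDist_le_iff fun q r hr => ?_
  have e := (h₁ 1 r hr).symm.trans (h₂ 1 r hr)
  rw [map_one] at e
  exact Set.ext_iff.1 e q

/-- The control of a lift projects to the control of the curve. -/
theorem IsHorizontal.modelDifferential_control {T : SubFinslerStructure F H} {I : Set ℝ}
    (hI : I.OrdConnected) {γ : ℝ → H} {u : ℝ → T.polarization} {γ' : ℝ → G}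
    {u' : ℝ → S.polarization} (h : T.IsHorizontal I γ u) (h' : S.IsHorizontal I γ' u')
    (hγ : ∀ t ∈ I, π (γ' t) = γ t) :
    ∀ᵐ t ∂(volume.restrict I), modelDifferential π (S.incl (u' t)) = T.incl (u t) := by
  rw [isHorizontal_iff] at h h'
  filter_upwards [h.2, h'.2, hI.ae_mem_interior] with t h1 h2 ht
  have h3 := (h2.2.hom_comp π h2.1).hasDerivAt (mem_interior_iff_mem_nhds.1 ht)
  have h4 := h1.2.hasDerivAt (mem_interior_iff_mem_nhds.1 ht)
  refine h3.unique (h4.congr_of_eventuallyEq ?_)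
  filter_upwards [mem_interior_iff_mem_nhds.1 ht] with s hs
  rw [hγ s hs, hγ t (interior_subset ht)]

/-- Test the subgradient inequality in `H` against `w = dπ v`. The left side is unchanged because
`dπ` intertwines the adjoint actions and maps `u'` to `u`; on the right, `‖w‖ ≤ ‖v‖` and `‖u‖ =
‖u'‖`. -/
theorem IsNormal.of_isLift {T : SubFinslerStructure F H} {I : Set ℝ} (hI : I.OrdConnected)
    (h1 : ∀ v : S.polarization, ∃ w : T.polarization,
      T.incl w = modelDifferential π (S.incl v) ∧ T.norm w ≤ S.norm v)
    {γ : ℝ → H} {u : ℝ → T.polarization} {lam : Module.Dual ℝ (GroupLieAlgebra 𝓘(ℝ, F) H)}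
    (h : T.IsNormal I γ u lam) {γ' : ℝ → G} {u' : ℝ → S.polarization}
    (hl : S.IsLift T π I γ u γ' u') : S.IsNormal I γ' u' (lam ∘ₗ lieDifferential π) := by
  obtain ⟨hh, hL2, hsub⟩ := h
  obtain ⟨hh', hπ, hn⟩ := hl
  refine ⟨hh', fun a b hab => ?_, ?_⟩
  · refine lt_of_eq_of_lt (lintegral_congr_ae ?_) (hL2 a b hab)
    filter_upwards [ae_restrict_of_ae_restrict_of_subset hab hn] with t ht
    rw [ht]
  · have hI' : ∀ᵐ t ∂(volume.restrict I), t ∈ I := hI.ae_mem_interior.mono fun t ht =>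
      interior_subset ht
    filter_upwards [hsub, hn, hh.modelDifferential_control hI hh' hπ, hI'] with t h2 h3 h4 h5 v
    obtain ⟨w, hw, hle⟩ := h1 v
    have h6 := h2 w
    have e1 : lieDifferential π ((v - u' t : S.polarization) : GroupLieAlgebra 𝓘(ℝ, E) G) =
        ((w - u t : T.polarization) : GroupLieAlgebra 𝓘(ℝ, F) H) := by
      have e2 : lieDifferential π (v : GroupLieAlgebra 𝓘(ℝ, E) G) =
        (w : GroupLieAlgebra 𝓘(ℝ, F) H) := hw.symm
      have e3 : lieDifferential π (u' t : GroupLieAlgebra 𝓘(ℝ, E) G) =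
        (u t : GroupLieAlgebra 𝓘(ℝ, F) H) := h4
      rw [Submodule.coe_sub, Submodule.coe_sub, map_sub, e2, e3]
    have e4 : lieDifferential π (lieAd (γ' t)
        ((v - u' t : S.polarization) : GroupLieAlgebra 𝓘(ℝ, E) G)) =
        lieAd (γ t) ((w - u t : T.polarization) : GroupLieAlgebra 𝓘(ℝ, F) H) := by
      rw [lieDifferential_lieAd, hπ t h5, e1]
    have h7 : lam (lieDifferential π (lieAd (γ' t)
        ((v - u' t : S.polarization) : GroupLieAlgebra 𝓘(ℝ, E) G))) ≤
        T.energy w - T.energy (u t) := by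
      rw [e4]
      exact h6
    refine h7.trans (sub_le_sub ?_ ?_)
    · have := pow_le_pow_left₀ (apply_nonneg _ _) hle 2
      simp only [energy]
      linarith
    · simp only [energy, h3, le_refl]

end SubFinslerStructure

/-! ### Primitives on an arbitrary interval. -/

section Primitive

variable {I : Set ℝ} {θ : ℝ → ℝ} {t₀ : ℝ}

theorem absolutelyContinuousOnInterval_primitive (ht₀ : t₀ ∈ I)
    (hθ : ∀ a ∈ I, ∀ b ∈ I, IntervalIntegrable θ volume a b) {a b : ℝ} (hab : a ≤ b)
    (h : Icc a b ⊆ I) :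
    AbsolutelyContinuousOnInterval (fun t => ∫ s in t₀..t, θ s) a b := by
  have ha := h (left_mem_Icc.2 hab)
  have hb := h (right_mem_Icc.2 hab)
  have h1 := (hθ a ha b hb).absolutelyContinuousOnInterval_intervalIntegral
    (left_mem_uIcc (a := a) (b := b))
  refine h1.of_dist_le (C := 1) fun s hs t ht => ?_
  rw [uIcc_of_le hab] at hs ht
  rw [one_mul, Real.dist_eq, Real.dist_eq,
    intervalIntegral.integral_interval_sub_left (hθ _ ht₀ _ (h hs)) (hθ _ ht₀ _ (h ht)),
    intervalIntegral.integral_interval_sub_left (hθ _ ha _ (h hs)) (hθ _ ha _ (h ht))]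

theorem ae_hasDerivAt_primitive (hI : I.OrdConnected) (ht₀ : t₀ ∈ I)
    (hθ : ∀ a ∈ I, ∀ b ∈ I, IntervalIntegrable θ volume a b) :
    ∀ᵐ t ∂(volume.restrict I), HasDerivAt (fun t => ∫ s in t₀..t, θ s) (θ t) t := by
  rw [ae_restrict_iff' hI.measurableSet]
  -- The integrand is only integrable on compact subintervals; those with rational endpoints are
  -- countably many and cover the interior.
  have h1 : ∀ᵐ t : ℝ, ∀ a b : ℚ, (a : ℝ) ∈ I → (b : ℝ) ∈ I → t ∈ uIcc (a : ℝ) b →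
      ∀ c ∈ uIcc (a : ℝ) b, HasDerivAt (fun t => ∫ s in c..t, θ s) (θ t) t := by
    refine ae_all_iff.2 fun a => ae_all_iff.2 fun b => ?_
    by_cases ha : (a : ℝ) ∈ I
    swap
    · exact Eventually.of_forall fun t h => absurd h ha
    by_cases hb : (b : ℝ) ∈ I
    swap
    · exact Eventually.of_forall fun t _ h => absurd h hb
    filter_upwards [(hθ a ha b hb).ae_hasDerivAt_integral] with t ht _ _ ht' c hc
    exact ht ht' c hc
  have h2 := hI.ae_mem_interior
  rw [ae_restrict_iff' hI.measurableSet] at h2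
  filter_upwards [h1, h2] with t ht ht2 htI
  obtain ⟨r, hr, hball⟩ := Metric.mem_nhds_iff.1 (mem_interior_iff_mem_nhds.1 (ht2 htI))
  rw [Real.ball_eq_Ioo] at hball
  obtain ⟨a, ha1, ha2⟩ := exists_rat_btwn (show t - r < t by linarith)
  obtain ⟨b, hb1, hb2⟩ := exists_rat_btwn (show t < t + r by linarith)
  have haI : (a : ℝ) ∈ I := hball ⟨ha1, by linarith⟩
  have hbI : (b : ℝ) ∈ I := hball ⟨by linarith, hb2⟩
  have h3 := ht a b haI hbI (by rw [uIcc_of_le (by linarith)]; exact ⟨ha2.le, hb1.le⟩) a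
    left_mem_uIcc
  refine (h3.const_add (∫ s in t₀..(a : ℝ), θ s)).congr_of_eventuallyEq ?_
  filter_upwards [Ioo_mem_nhds (show t - r < t by linarith) (show t < t + r by linarith)] with s hs
  exact (intervalIntegral.integral_add_adjacent_intervals (hθ _ ht₀ _ haI)
    (hθ _ haI _ (hball hs))).symm

theorem continuousOn_primitive_ordConnected (hI : I.OrdConnected) (ht₀ : t₀ ∈ I)
    (hθ : ∀ a ∈ I, ∀ b ∈ I, IntervalIntegrable θ volume a b) :
    ContinuousOn (fun t => ∫ s in t₀..t, θ s) I := by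
  intro t ht
  -- If `t` is the left end of `I`, then `a = t` serves; otherwise any earlier point does.
  have h1 : ∃ a ∈ I, a ≤ t ∧ Ici a ∈ 𝓝[I] t := by
    by_cases h : ∃ a ∈ I, a < t
    · obtain ⟨a, ha, hat⟩ := h
      exact ⟨a, ha, hat.le, mem_nhdsWithin_of_mem_nhds (Ici_mem_nhds hat)⟩
    · push Not at h
      exact ⟨t, ht, le_rfl, mem_of_superset self_mem_nhdsWithin h⟩
  have h2 : ∃ b ∈ I, t ≤ b ∧ Iic b ∈ 𝓝[I] t := by
    by_cases h : ∃ b ∈ I, t < b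
    · obtain ⟨b, hb, htb⟩ := h
      exact ⟨b, hb, htb.le, mem_nhdsWithin_of_mem_nhds (Iic_mem_nhds htb)⟩
    · push Not at h
      exact ⟨t, ht, le_rfl, mem_of_superset self_mem_nhdsWithin h⟩
  obtain ⟨a, ha, hat, ha'⟩ := h1
  obtain ⟨b, hb, htb, hb'⟩ := h2
  have h3 := (absolutelyContinuousOnInterval_primitive ht₀ hθ (hat.trans htb)
    (hI.out ha hb)).continuousOn
  rw [uIcc_of_le (hat.trans htb)] at h3
  exact (h3 t ⟨hat, htb⟩).mono_of_mem_nhdsWithin (inter_mem ha' hb')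

end Primitive

/-! ### Lifting curves. -/

namespace SubFinslerStructure

variable {E : Type*} [NormedAddCommGroup E] [NormedSpace ℝ E] [FiniteDimensional ℝ E]
  {G : Type*} [TopologicalSpace G] [ChartedSpace E G] [Group G] [LieGroup 𝓘(ℝ, E) ∞ G]
  {F : Type*} [NormedAddCommGroup F] [NormedSpace ℝ F] [FiniteDimensional ℝ F]
  {H : Type*} [TopologicalSpace H] [ChartedSpace F H] [Group H] [LieGroup 𝓘(ℝ, F) ∞ H]
  {S : SubFinslerStructure E G} {T : SubFinslerStructure F H}
  {π : ContMDiffMonoidMorphism 𝓘(ℝ, E) 𝓘(ℝ, F) ∞ G H}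

/-- Both orders of the arguments are covered, so that times before and after the base time can be
treated without invoking symmetry of the distance. -/
theorem exists_isCompact_ccDist_le_subset (S : SubFinslerStructure E G) (g : G) {r : ℝ}
    (hr : 0 ≤ r) : ∃ K : Set G, IsCompact K ∧ ∀ h, S.ccDist g h ≤ ENNReal.ofReal r ∨
      S.ccDist h g ≤ ENNReal.ofReal r → h ∈ K := by
  have := LieGroup.isTopologicalGroup_real E G
  have hc := S.isCompact_ccDist_le hr
  refine ⟨_, (hc.image (f := fun x => g * x) (by fun_prop)).union
    (hc.image (f := fun x => g * x⁻¹) (by fun_prop)), ?_⟩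
  rintro h (hh | hh) <;> rw [ccDist_eq_one_left] at hh
  · exact Or.inl ⟨g⁻¹ * h, hh, by simp⟩
  · exact Or.inr ⟨h⁻¹ * g, hh, by simp⟩

/-- Times are added in increasing order. The new point is lifted from the previous largest time, and
the bounds from earlier times follow from the triangle inequality because increments of `Θ` add up.
-/
theorem exists_lift_finset (hπ : Function.Surjective π)
    (hlift : ∀ (p : G) (q : H) (r : ℝ), 0 ≤ r → T.ccDist (π p) q ≤ ENNReal.ofReal r →
      ∃ p', π p' = q ∧ S.ccDist p p' ≤ ENNReal.ofReal r)
    {I : Set ℝ} {γ : ℝ → H} {Θ : ℝ → ℝ} (hΘ : MonotoneOn Θ I)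
    (hγ : ∀ s ∈ I, ∀ t ∈ I, s ≤ t → T.ccDist (γ s) (γ t) ≤ ENNReal.ofReal (Θ t - Θ s))
    (A : Finset ℝ) : (A : Set ℝ) ⊆ I → ∃ c : ℝ → G, (∀ s ∈ A, π (c s) = γ s) ∧
      ∀ s ∈ A, ∀ t ∈ A, s ≤ t → S.ccDist (c s) (c t) ≤ ENNReal.ofReal (Θ t - Θ s) := by
  classical
  refine Finset.induction_on_max A (fun _ => ⟨fun _ => 1, by simp, by simp⟩) ?_
  intro a A hmax ih hA
  rw [Finset.coe_insert, insert_subset_iff] at hA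
  obtain ⟨c, hc1, hc2⟩ := ih hA.2
  obtain ⟨x, hx, hxd⟩ : ∃ x, π x = γ a ∧ ∀ s ∈ A,
      S.ccDist (c s) x ≤ ENNReal.ofReal (Θ a - Θ s) := by
    rcases A.eq_empty_or_nonempty with rfl | hne
    · obtain ⟨x, hx⟩ := hπ (γ a)
      exact ⟨x, hx, by simp⟩
    · have hm := A.max'_mem hne
      set m := A.max' hne
      have hma := hΘ (hA.2 hm) hA.1 (hmax m hm).le
      obtain ⟨x, hx, hxd⟩ := hlift (c m) (γ a) (Θ a - Θ m) (sub_nonneg.2 hma) (by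
        rw [hc1 m hm]
        exact hγ m (hA.2 hm) a hA.1 (hmax m hm).le)
      refine ⟨x, hx, fun s hs => (S.ccDist_triangle _ (c m) _).trans ?_⟩
      have hsm : s ≤ m := A.le_max' s hs
      have := hΘ (hA.2 hs) (hA.2 hm) hsm
      rw [show Θ a - Θ s = (Θ m - Θ s) + (Θ a - Θ m) by ring,
        ENNReal.ofReal_add (sub_nonneg.2 this) (sub_nonneg.2 hma)]
      exact add_le_add (hc2 s hs m hm hsm) hxd
  have hne : ∀ s ∈ A, s ≠ a := fun s hs => (hmax s hs).ne
  refine ⟨Function.update c a x, fun s hs => ?_, fun s hs t ht hst => ?_⟩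
  · rcases Finset.mem_insert.1 hs with rfl | hs
    · simpa using hx
    · rw [Function.update_of_ne (hne s hs)]
      exact hc1 s hs
  · rcases Finset.mem_insert.1 hs with rfl | hs' <;> rcases Finset.mem_insert.1 ht with rfl | ht'
    · simp [ccDist_self]
    · exact absurd (hmax t ht') (not_lt.2 hst)
    · rw [Function.update_of_ne (hne s hs'), Function.update_self]
      exact hxd s hs'
    · rw [Function.update_of_ne (hne s hs'), Function.update_of_ne (hne t ht')]
      exact hc2 s hs' t ht' hst

/-- Lifts over finite sets of times are not compatible with each other, but with the value at `t₀`
fixed their values at each time lie in a compact set. A limit along an ultrafilter on finite sets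
keeps all constraints, since each one involves at most two times and is closed. -/
theorem exists_lift_of_ccDist_increment (hπ : Function.Surjective π)
    (hlift : ∀ (p : G) (q : H) (r : ℝ), 0 ≤ r → T.ccDist (π p) q ≤ ENNReal.ofReal r →
      ∃ p', π p' = q ∧ S.ccDist p p' ≤ ENNReal.ofReal r)
    {I : Set ℝ} {γ : ℝ → H} {Θ : ℝ → ℝ} (hΘ : MonotoneOn Θ I) {t₀ : ℝ} (ht₀ : t₀ ∈ I)
    (hγ : ∀ s ∈ I, ∀ t ∈ I, s ≤ t → T.ccDist (γ s) (γ t) ≤ ENNReal.ofReal (Θ t - Θ s)) :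
    ∃ γ' : ℝ → G, (∀ s ∈ I, π (γ' s) = γ s) ∧
      ∀ s ∈ I, ∀ t ∈ I, s ≤ t → S.ccDist (γ' s) (γ' t) ≤ ENNReal.ofReal (Θ t - Θ s) := by
  classical
  have := LieGroup.t2Space_real F H
  obtain ⟨g, hg⟩ := hπ (γ t₀)
  have hfin : ∀ A : Finset ℝ, ∃ c : ℝ → G, (∀ s ∈ A, s ∈ I → π (c s) = γ s) ∧
      (t₀ ∈ A → c t₀ = g) ∧ ∀ s ∈ A, ∀ t ∈ A, s ∈ I → t ∈ I → s ≤ t →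
        S.ccDist (c s) (c t) ≤ ENNReal.ofReal (Θ t - Θ s) := by
    intro A
    obtain ⟨c, h1, h2⟩ := exists_lift_finset hπ hlift hΘ hγ (A.filter (· ∈ I)) (by
      intro s hs
      exact (Finset.mem_filter.1 hs).2)
    by_cases hA : t₀ ∈ A
    · have h3 := h1 t₀ (Finset.mem_filter.2 ⟨hA, ht₀⟩)
      -- The factor `g * (c t₀)⁻¹` lies in the kernel of `π`, and left translation preserves
      -- distances, so the lift can be normalized to equal `g` at `t₀`.
      refine ⟨fun s => g * (c t₀)⁻¹ * c s, fun s hs hsI => ?_, fun _ => by simp,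
        fun s hs t ht hsI htI hst => ?_⟩
      · rw [map_mul, map_mul, map_inv, hg, h3, mul_inv_cancel, one_mul,
          h1 s (Finset.mem_filter.2 ⟨hs, hsI⟩)]
      · rw [ccDist_mul_left]
        exact h2 s (Finset.mem_filter.2 ⟨hs, hsI⟩) t (Finset.mem_filter.2 ⟨ht, htI⟩) hst
    · exact ⟨c, fun s hs hsI => h1 s (Finset.mem_filter.2 ⟨hs, hsI⟩), fun h => absurd h hA,
        fun s hs t ht hsI htI hst =>
          h2 s (Finset.mem_filter.2 ⟨hs, hsI⟩) t (Finset.mem_filter.2 ⟨ht, htI⟩) hst⟩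
  choose c hc1 hc2 hc3 using hfin
  set U : Ultrafilter (Finset ℝ) := Ultrafilter.of atTop with hU
  have hmem : ∀ s : ℝ, ∀ᶠ A in (U : Filter (Finset ℝ)), s ∈ A := by
    intro s
    refine Ultrafilter.of_le atTop ?_
    filter_upwards [eventually_ge_atTop ({s} : Finset ℝ)] with A hA
    exact hA (Finset.mem_singleton_self s)
  have hlim : ∀ s ∈ I, ∃ y, Tendsto (fun A => c A s) U (𝓝 y) := by
    intro s hs
    obtain ⟨K, hK, hKm⟩ := S.exists_isCompact_ccDist_le_subset g (abs_nonneg (Θ s - Θ t₀))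
    obtain ⟨y, -, hy⟩ := hK.ultrafilter_le_nhds (U.map fun A => c A s) (by
      rw [le_principal_iff, Ultrafilter.coe_map]
      refine mem_map.2 ?_
      filter_upwards [hmem s, hmem t₀] with A h1 h2
      refine hKm _ ?_
      rw [← hc2 A h2]
      rcases le_total t₀ s with h | h
      · exact Or.inl ((hc3 A t₀ h2 s h1 ht₀ hs h).trans (ENNReal.ofReal_le_ofReal (le_abs_self _)))
      · refine Or.inr ((hc3 A s h1 t₀ h2 hs ht₀ h).trans (ENNReal.ofReal_le_ofReal ?_))
        rw [abs_sub_comm]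
        exact le_abs_self _)
    exact ⟨y, hy⟩
  choose! y hy using hlim
  refine ⟨y, fun s hs => ?_, fun s hs t ht hst => ?_⟩
  · refine tendsto_nhds_unique ((π.contMDiff_toFun.continuous.tendsto (y s)).comp (hy s hs))
      (tendsto_const_nhds.congr' ?_)
    filter_upwards [hmem s] with A hA using (hc1 A s hA hs).symm
  · refine (S.isClosed_setOf_ccDist_le (sub_nonneg.2 (hΘ hs ht hst))).mem_of_tendsto
      ((hy s hs).prodMk_nhds (hy t ht)) ?_
    filter_upwards [hmem s, hmem t] with A h1 h2
    exact hc3 A s h1 t h2 hs ht hst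

theorem lintegral_norm_ne_top_of_sq {u : ℝ → S.polarization} {a b : ℝ}
    (hL2 : ∫⁻ t in Icc a b, ENNReal.ofReal (S.norm (u t) ^ 2) < ⊤) :
    ∫⁻ t in Icc a b, ENNReal.ofReal (S.norm (u t)) ≠ ⊤ := by
  have h1 : ∫⁻ t in Icc a b, (1 + ENNReal.ofReal (S.norm (u t) ^ 2)) < ⊤ := by
    rw [lintegral_add_left measurable_const]
    exact ENNReal.add_lt_top.2 ⟨by simp, hL2⟩
  refine ((lintegral_mono fun t => ?_).trans_lt h1).ne
  rw [← ENNReal.ofReal_one, ← ENNReal.ofReal_add zero_le_one (by positivity)]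
  exact ENNReal.ofReal_le_ofReal (by nlinarith [sq_nonneg (S.norm (u t) - 1)])

/-- With `Θ` the arclength of `γ`, the metric lift is horizontal of speed at most `‖u‖`. Its control
projects to `u`, and `dπ` does not increase norms, so the speed is exactly `‖u‖`. Square
integrability serves only to make arclength finite on compact subintervals. -/
theorem IsNormal.exists_isLift (hπ : Function.Surjective π)
    (h1 : ∀ v : S.polarization, ∃ w : T.polarization,
      T.incl w = modelDifferential π (S.incl v) ∧ T.norm w ≤ S.norm v)
    (hlift : ∀ (p : G) (q : H) (r : ℝ), 0 ≤ r → T.ccDist (π p) q ≤ ENNReal.ofReal r →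
      ∃ p', π p' = q ∧ S.ccDist p p' ≤ ENNReal.ofReal r)
    {I : Set ℝ} (hI : I.OrdConnected) {γ : ℝ → H} {u : ℝ → T.polarization}
    {lam : Module.Dual ℝ (GroupLieAlgebra 𝓘(ℝ, F) H)} (h : T.IsNormal I γ u lam) :
    ∃ (γ' : ℝ → G) (u' : ℝ → S.polarization), S.IsLift T π I γ u γ' u' := by
  obtain ⟨hh, hL2, -⟩ := h
  rcases I.eq_empty_or_nonempty with rfl | ⟨t₀, ht₀⟩
  · exact ⟨fun _ => 1, 0, isHorizontal_const S ∅ 1, by simp, by simp⟩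
  have hfin : ∀ {a b : ℝ}, Icc a b ⊆ I →
      ∫⁻ t in Icc a b, ENNReal.ofReal (T.norm (u t)) ≠ ⊤ := fun hs =>
    lintegral_norm_ne_top_of_sq (hL2 _ _ hs)
  have hint : ∀ a ∈ I, ∀ b ∈ I, IntervalIntegrable (fun t => T.norm (u t)) volume a b := by
    intro a ha b hb
    rcases le_total a b with hab | hab
    · exact (hh.mono (hI.out ha hb)).intervalIntegrable_norm hab (hfin (hI.out ha hb))
    · exact ((hh.mono (hI.out hb ha)).intervalIntegrable_norm hab (hfin (hI.out hb ha))).symm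
  set Θ : ℝ → ℝ := fun t => ∫ s in t₀..t, T.norm (u s) with hΘ
  have hsub : ∀ s ∈ I, ∀ t ∈ I, Θ t - Θ s = ∫ r in s..t, T.norm (u r) := fun s hs t ht =>
    intervalIntegral.integral_interval_sub_left (hint _ ht₀ _ ht) (hint _ ht₀ _ hs)
  have hmono : MonotoneOn Θ I := fun s hs t ht hst => by
    have : 0 ≤ ∫ r in s..t, T.norm (u r) :=
      intervalIntegral.integral_nonneg hst fun r _ => apply_nonneg _ _
    linarith [hsub s hs t ht]
  have hd : ∀ s ∈ I, ∀ t ∈ I, s ≤ t → T.ccDist (γ s) (γ t) ≤ ENNReal.ofReal (Θ t - Θ s) := by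
    intro s hs t ht hst
    have hm := hh.mono (hI.out hs ht)
    rw [hsub s hs t ht, hm.intervalIntegral_norm hst, ENNReal.ofReal_toReal (hfin (hI.out hs ht))]
    exact hm.ccDist_le hst
  obtain ⟨γ', hγ', hγd⟩ := exists_lift_of_ccDist_increment hπ hlift hmono ht₀ hd
  obtain ⟨u', hu', hle⟩ := exists_isHorizontal_of_ccDist_le (S := S) hI
    (continuousOn_primitive_ordConnected hI ht₀ hint)
    (fun a b hab hs => absolutelyContinuousOnInterval_primitive ht₀ hint hab hs)
    (ae_hasDerivAt_primitive hI ht₀ hint) hmono hγd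
  refine ⟨γ', u', hu', hγ', ?_⟩
  filter_upwards [hle, hh.modelDifferential_control hI hu' hγ'] with t h3 h4
  obtain ⟨w, hw, hwle⟩ := h1 (u' t)
  have : w = u t := T.incl_injective (hw.trans h4)
  exact le_antisymm h3 (this ▸ hwle)

end SubFinslerStructure

/-! ### The main theorem. -/

theorem mainTheorem7
    {E : Type*} [NormedAddCommGroup E] [NormedSpace ℝ E] [FiniteDimensional ℝ E]
    {G : Type*} [TopologicalSpace G] [ChartedSpace E G] [Group G] [LieGroup 𝓘(ℝ, E) ∞ G]
    [SecondCountableTopology G]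
    {F : Type*} [NormedAddCommGroup F] [NormedSpace ℝ F] [FiniteDimensional ℝ F]
    {H : Type*} [TopologicalSpace H] [ChartedSpace F H] [Group H] [LieGroup 𝓘(ℝ, F) ∞ H]
    (S : SubFinslerStructure E G)
    (π : ContMDiffMonoidMorphism 𝓘(ℝ, E) 𝓘(ℝ, F) ∞ G H) (hπ : Function.Surjective π) :
    (∃! T : SubFinslerStructure F H, S.IsSubmetry T π) ∧
    ∀ T : SubFinslerStructure F H, S.IsSubmetry T π →
      S.IsPushforward T π ∧
      ∀ (I : Set ℝ), I.OrdConnected → ∀ (γ : ℝ → H) (u : ℝ → T.polarization)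
        (lam : Module.Dual ℝ (GroupLieAlgebra 𝓘(ℝ, F) H)), T.IsNormal I γ u lam →
        (∃ (γ' : ℝ → G) (u' : ℝ → S.polarization), S.IsLift T π I γ u γ' u') ∧
        ∀ (γ' : ℝ → G) (u' : ℝ → S.polarization), S.IsLift T π I γ u γ' u' →
          S.IsNormal I γ' u' (lam ∘ₗ lieDifferential π) := by
  obtain ⟨T₀, h1, h2⟩ := S.exists_pushforward π (modelDifferential_surjective π hπ)
  have hsub := SubFinslerStructure.isSubmetry_of_lift h1 h2
  refine ⟨⟨T₀, hsub, fun T hT => hT.unique hsub⟩, fun T hT => ?_⟩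
  -- Uniqueness identifies an arbitrary submetric structure with the push-forward, for which `h1`
  -- and `h2` are known.
  obtain rfl := hT.unique hsub
  exact ⟨SubFinslerStructure.isPushforward_of_lift h1 h2, fun I hI γ u lam h =>
    ⟨h.exists_isLift hπ h1
      (fun _ _ _ hr hq => SubFinslerStructure.exists_lift_of_ccDist_le h1 h2 hr hq) hI,
    fun γ' u' hl => h.of_isLift hI h1 hl⟩⟩
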